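/- **Twisted virtual biracks and shadows.** Let $X$ be a set with bijections $B,V:X\times X\to X\times X$, written $B(x,y)=(y^x,x_y)$, $V(x,y)=(y^{\tilde x},x_{\tilde y})$, and a map $T:X\to X$ with $T^2=\mathrm{Id}$. $X$ is a *twisted virtual birack* if: there are unique, invertible maps $\mathcal S,v\mathcal S:X\times X\to X\times X$ with $\mathcal S(y^x,x)=(x_y,y)$ and $v\mathcal S(y^{\tilde x},x)=(x_{\tilde y},y)$ for all $x,y$; with $\Delta(x)=(x,x)$, both components of $\mathcal S\circ\Delta$ and of $\mathcal S^{-1}\circ\Delta$ are bijections $X\to X$; $V^2=\mathrm{Id}$ and $(v\mathcal S\circ\Delta)_1=(v\mathcal S\circ\Delta)_2$; $B$ and $V$ both satisfy the set-theoretic Yang–Baxter equation, and $(B\times \mathrm{Id})(\mathrm{Id}\times V)(V\times \mathrm{Id})=(\mathrm{Id}\times V)(V\times \mathrm{Id})(\mathrm{Id}\times B)$; $(T\times\mathrm{Id})V=V(\mathrm{Id}\times T)$, $(\mathrm{Id}\times T)V=V(T\times\mathrm{Id})$ and $(T\times T)B(T\times T)=VBV$. Put $\alpha=(\mathcal S^{-1}\circ\Delta)_2^{-1}$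 and $\pi=(\mathcal S^{-1}\circ\Delta)_1\circ\alpha$; the birack rank $N$ is the order of $\pi$, assumed finite. A *twisted $X$-shadow* is a set $S$ with a map $S\times X\to S$, $(A,x)\mapsto A\cdot x$, such that $A\mapsto A\cdot x$ is bijective for each $x$, $(A\cdot y_x)\cdot x^y=(A\cdot y_{\tilde x})\cdot x^{\tilde y}=(A\cdot x)\cdot y$ and $A\cdot Tx=A\cdot x$. **The algebra.** $\mathbb Z[X,S]$ is the quotient of the commutative ring $\mathbb Z[v_{A,x,y}^{\pm1},t_{A,x,y}^{\pm1},r_{A,x,y}^{\pm1},q_{A,x}]$ $(A\in S;\ x,y\in X)$ by the following relations, for all $A\in S$ and $x,y,z\in X$, where $C=A\cdot (x_{\tilde y})_{\tilde z}$, $D=A\cdot (x_y)_z$, $w=z^{\widetilde{x_{\tilde y}}}$ and $(m,n)=B(V(x,y))$: $$\begin{aligned} &v_{A,y^{\tilde x},x_{\tilde y}}=v_{A,x,y},\\ &v_{A\cdot y_{\tilde z},x,z^{\tilde y}}\,v_{A,y,z}=v_{C,y^{\tilde x},w}\,v_{A,x_{\tilde y},z},\\ &v_{C,y^{\tilde x},w}\,v_{A,x_{\widetilde{z^{\tilde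 y}}},y_{\tilde z}}=v_{A\cdot z,x,y}\,v_{A,y,z},\\ &v_{A\cdot z,x,y}\,v_{A,x_{\tilde y},z}=v_{A\cdot y_{\tilde z},x,z^{\tilde y}}\,v_{A,x_{\widetilde{z^{\tilde y}}},y_{\tilde z}},\\ &v_{A\cdot y_z,x,z^y}\,v_{A,x_{\widetilde{z^y}},y_z}=v_{A\cdot z,x,y}\,v_{A,x_{\tilde y},z},\\ &v_{A,x_{\widetilde{z^y}},y_z}\,r_{A,y,z}=r_{C,y^{\tilde x},w}\,v_{A\cdot z,x,y},\\ &v_{A\cdot y_z,x,z^y}\,t_{A,y,z}=t_{C,y^{\tilde x},w}\,v_{A,x_{\tilde y},z},\\ &r_{A,x_{z^y},y_z}\,r_{A\cdot y_z,x,z^y}=r_{A,x_y,z}\,r_{A\cdot z,x,y},\\ &t_{A,x_{z^y},y_z}\,r_{A,y,z}=r_{D,y^x,z^{x_y}}\,t_{A\cdot z,x,y},\\ &t_{A\cdot y_z,x,z^y}\,t_{A,y,z}=t_{D,y^x,z^{x_y}}\,t_{A,x_y,z},\\ &q_{A,Tx}\,q_{A,x}=1,\qquad v_{A,x,Ty}=v_{A,x,y}=v_{A,Tx,y},\\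 &q_{A\cdot y,x}\,v_{A,x,y}=v_{A,Tx,y}\,q_{A,x_{\tilde y}},\qquad v_{A,x,Ty}\,q_{A,y}=q_{A\cdot x_{\tilde y},y^{\tilde x}}\,v_{A,x,y},\\ &v_{A,m,n}\,q_{A,(Tx)_{(Ty)}}\,r_{A,Tx,Ty}\,q_{A\cdot y,x}\,v_{A,x,y}=t_{A,y^{\tilde x},x_{\tilde y}},\\ &q_{A\cdot (Tx)_{(Ty)},(Ty)^{(Tx)}}\,t_{A,Tx,Ty}\,q_{A,y}=v_{A,m,n}\,r_{A,y^{\tilde x},x_{\tilde y}}\,v_{A,x,y},\\ &\prod_{k=0}^{N-1}t_{A\cdot^{-1}\alpha(\pi^k(x)),\pi^k(x),\alpha(\pi^k(x))}\,r_{A\cdot^{-1}\alpha(\pi^k(x)),\pi^k(x),\alpha(\pi^k(x))}=1 . \end{aligned}$$ **Labelings.** An $X,S$-labeling $f$ of an oriented twisted virtual link diagram (a planar link diagram with classical crossings, virtual crossings and twist bars) assigns elements of $X$ to the semiarcs (the diagram being divided at all crossings and twist bars) and elements of $S$ to the regions of the plane, such that: for a semiarc labeled $x$ with region $A$ on its right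 (seen along the orientation) the region on its left is $A\cdot x$; at a crossing drawn with both strands upward, with labels $(x,y)$ at the bottom and $(x',y')$ at the top, read from left to right, $(x',y')=B(x,y)$ if it is positive, $(x,y)=B(x',y')$ if it is negative, $(x',y')=V(x,y)$ if it is virtual; and a twist bar changes $x$ to $Tx$. The fundamental module $\mathbb Z[f]$ is the $\mathbb Z[X,S]$-module generated by one bead for each semiarc, with these relations, where $A$ is the region to the right of both strands (to the right of the strand at a twist bar): at a positive crossing with labels $(x,y)$ and beads $(a,b)$ at the bottom the beads at the top are $(t_{A,x,y}b,\ r_{A,x,y}a)$; at a negative crossing the same holds with bottom and top exchanged; at a virtual crossing with bottom labels $(x,y)$ and beads $(a,b)$ the beads at the top are $(v_{A,x,y}b,\ v_{A,x,y}^{-1}a)$; at a twist bar with incoming label $x$ and bead $a$ the outgoing bead is $q_{A,x}a$. **The invariants.** Let $G$ be a $\mathbb Z[X,S]$-module. For an oriented twisted virtual link $L$ of $c$ components choose for each $\mathbf w\in(\mathbb Z/N)^c$ a diagram $(L,\mathbf w)$ of $L$ whose components have the writhes $\mathbf w$ modulo $N$ (the writhe of a component is the sum of the signs of its classical self-crossings).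 Let $\Phi^{M,G}_{X,S}(L)$ be the multiset of the isomorphism classes of the modules $\mathrm{Hom}_{\mathbb Z[X,S]}(\mathbb Z[f],G)$, for all $\mathbf w\in(\mathbb Z/N)^c$ and all $X,S$-labelings $f$ of $(L,\mathbf w)$ (the multiplicities are cardinal numbers, finite if $X$ and $S$ are finite). They are taken as modules over $\mathrm{End}_{\mathbb Z[X,S]}(G)$, hence in particular over $\mathbb Z[X,S]$, and over $G$ if $G$ is a commutative $\mathbb Z[X,S]$-algebra. If $X$ and $S$ are finite, let $$\Phi^{G}_{X,S}(L)=\sum_{\mathbf w}\ \sum_{f}\ u^{|\mathrm{Hom}_{\mathbb Z[X,S]}(\mathbb Z[f],G)|}$$ over the same $\mathbf w$ and $f$ (with $G$ finite, or $|\cdot|$ read as $0$ for infinite sets). **Theorem.** Diagrams $(L,\mathbf w)$ exist for all $\mathbf w\in(\mathbb Z/N)^c$, and $\Phi^{M,G}_{X,S}(L)$ and, if $X$ and $S$ are finite, $\Phi^{G}_{X,S}(L)$ do not depend on their choice. If $L$ and $L'$ are twisted virtually isotopic oriented twisted virtual links, that is, related by planar isotopy, the (unframed) Reidemeister moves I–III,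 the virtual Reidemeister moves (the mixed one included), the cancellation of two adjacent twist bars, the moves of a twist bar through a virtual crossing, and the move that replaces a classical crossing with a twist bar on each of its four ends by the classical crossing of the same sign with over and under strand exchanged, between two virtual crossings, then $$\Phi^{M,G}_{X,S}(L)=\Phi^{M,G}_{X,S}(L')\qquad\text{and, if $X$ and $S$ are finite,}\qquad \Phi^{G}_{X,S}(L)=\Phi^{G}_{X,S}(L').$$ -/

import Mathlib

universe u v w

namespace TwistedVirtual

section Biracks

/-- `f × Id` on triples. -/
def onLeft {X : Type u} (f : X × X → X × X) (p : X × X × X) : X × X × X :=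
  ((f (p.1, p.2.1)).1, (f (p.1, p.2.1)).2, p.2.2)

/-- `Id × f` on triples. -/
def onRight {X : Type u} (f : X × X → X × X) (p : X × X × X) : X × X × X :=
  (p.1, f p.2)

/-- A virtual birack.  `side` and `vside` are the sideways maps of `B` and `V`: they are the only
maps with their defining property, and they are invertible. -/
class VirtualBirack (X : Type u) where
  B : X × X ≃ X × X
  V : X × X ≃ X × X
  side : X × X ≃ X × X
  vside : X × X ≃ X × X
  side_apply : ∀ x y, side ((B (x, y)).1, x) = ((B (x, y)).2, y)
  side_unique : ∀ F : X × X → X × X,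
    (∀ x y, F ((B (x, y)).1, x) = ((B (x, y)).2, y)) → F = side
  vside_apply : ∀ x y, vside ((V (x, y)).1, x) = ((V (x, y)).2, y)
  vside_unique : ∀ F : X × X → X × X,
    (∀ x y, F ((V (x, y)).1, x) = ((V (x, y)).2, y)) → F = vside
  diag_side_fst : Function.Bijective fun x => (side (x, x)).1
  diag_side_snd : Function.Bijective fun x => (side (x, x)).2
  diag_side_symm_fst : Function.Bijective fun x => (side.symm (x, x)).1
  diag_side_symm_snd : Function.Bijective fun x => (side.symm (x, x)).2
  V_V : ∀ p, V (V p) = p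
  vside_diag : ∀ x, (vside (x, x)).1 = (vside (x, x)).2
  yang_baxter_B : ∀ p,
    onLeft B (onRight B (onLeft B p)) = onRight B (onLeft B (onRight B p))
  yang_baxter_V : ∀ p,
    onLeft V (onRight V (onLeft V p)) = onRight V (onLeft V (onRight V p))
  yang_baxter_mixed : ∀ p,
    onLeft B (onRight V (onLeft V p)) = onRight V (onLeft V (onRight B p))

/-- A twisted virtual birack. -/
class TwistedVirtualBirack (X : Type u) extends VirtualBirack X where
  T : X → X
  T_T : ∀ x, T (T x) = x
  T_V_left : ∀ x y, ((T (V (x, y)).1, (V (x, y)).2) : X × X) = V (x, T y)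
  T_V_right : ∀ x y, (((V (x, y)).1, T (V (x, y)).2) : X × X) = V (T x, y)
  T_B : ∀ x y, ((T (B (T x, T y)).1, T (B (T x, T y)).2) : X × X) = V (B (V (x, y)))

/-- The operation `y ^ x`, the first component of `B (x, y)`. -/
def up {X : Type u} [VirtualBirack X] (y x : X) : X := (VirtualBirack.B (x, y)).1

/-- The operation `x _ y`, the second component of `B (x, y)`. -/
def dn {X : Type u} [VirtualBirack X] (x y : X) : X := (VirtualBirack.B (x, y)).2

/-- The operation `y ^ ~x`, the first component of `V (x, y)`. -/
def vup {X : Type u} [VirtualBirack X] (y x : X) : X := (VirtualBirack.V (x, y)).1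

/-- The operation `x _ ~y`, the second component of `V (x, y)`. -/
def vdn {X : Type u} [VirtualBirack X] (x y : X) : X := (VirtualBirack.V (x, y)).2

/-- The map `α`, the inverse of the second component of `side⁻¹` on the diagonal. -/
noncomputable def kinkLoop (X : Type u) [VirtualBirack X] : Equiv.Perm X :=
  (Equiv.ofBijective _ (VirtualBirack.diag_side_symm_snd (X := X))).symm

/-- The kink map `π`, the first component of `side⁻¹` on the diagonal, after `α`. -/
noncomputable def kink (X : Type u) [VirtualBirack X] : Equiv.Perm X :=
  (kinkLoop X).trans (Equiv.ofBijective _ (VirtualBirack.diag_side_symm_fst (X := X)))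

/-- The birack rank: the least positive `N` with `π ^ N = Id` (and `0` if there is none). -/
noncomputable def birackRank (X : Type u) [VirtualBirack X] : ℕ := orderOf (kink X)

/-- A twisted virtual birack shadow: a right invertible right action of `X` on the set `S`
that is compatible with classical crossings, virtual crossings and twist bars. -/
class TwistedShadow (X : Type u) [TwistedVirtualBirack X] (S : Type v) where
  act : S → X → S
  act_bijective : ∀ x, Function.Bijective fun A => act A x
  act_classical : ∀ A x y, act (act A (dn y x)) (up x y) = act (act A x) y
  act_virtual : ∀ A x y, act (act A (vdn y x)) (vup x y) = act (act A x) y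
  act_T : ∀ A x, act A (TwistedVirtualBirack.T x) = act A x

/-- The region `A ·⁻¹ x`. -/
noncomputable def actInv {X : Type u} [TwistedVirtualBirack X] {S : Type v} [TwistedShadow X S]
    (A : S) (x : X) : S :=
  (Equiv.ofBijective _ (TwistedShadow.act_bijective (S := S) x)).symm A

end Biracks

section Algebra

/-- Names of the generators of the twisted virtual shadow algebra; `vInv`, `tInv`, `rInv` become
the inverses of `v`, `t`, `r`. -/
inductive Gen (X : Type u) (S : Type v) : Type (max u v)
  | v (A : S) (x y : X)
  | vInv (A : S) (x y : X)
  | t (A : S) (x y : X)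
  | tInv (A : S) (x y : X)
  | r (A : S) (x y : X)
  | rInv (A : S) (x y : X)
  | q (A : S) (x : X)

variable {X : Type u} [TwistedVirtualBirack X] {S : Type v} [TwistedShadow X S]

open TwistedShadow (act)

open TwistedVirtualBirack (T)

/-- The polynomial variable named by a generator. -/
noncomputable def var (g : Gen X S) : MvPolynomial (Gen X S) ℤ := MvPolynomial.X g

/-- The variable `v` at `A, x, y`. -/
noncomputable def pv (A : S) (x y : X) : MvPolynomial (Gen X S) ℤ := var (Gen.v A x y)

/-- The variable `t` at `A, x, y`. -/
noncomputable def pt (A : S) (x y : X) : MvPolynomial (Gen X S) ℤ := var (Gen.t A x y)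

/-- The variable `r` at `A, x, y`. -/
noncomputable def pr (A : S) (x y : X) : MvPolynomial (Gen X S) ℤ := var (Gen.r A x y)

/-- The variable `q` at `A, x`. -/
noncomputable def pq (A : S) (x : X) : MvPolynomial (Gen X S) ℤ := var (Gen.q A x)

/-- The coefficient `t * r` of a positive kink that is entered with label `x` and whose
complementary region on the right is labeled `A`. -/
noncomputable def kinkCoeff (A : S) (x : X) : MvPolynomial (Gen X S) ℤ :=
  pt (actInv A (kinkLoop X x)) x (kinkLoop X x) * pr (actInv A (kinkLoop X x)) x (kinkLoop X x)

/-- The polynomials that are set to zero in the twisted virtual shadow algebra. -/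
inductive IsRelator : MvPolynomial (Gen X S) ℤ → Prop
  | inv_v (A : S) (x y : X) : IsRelator (pv A x y * var (Gen.vInv A x y) - 1)
  | inv_t (A : S) (x y : X) : IsRelator (pt A x y * var (Gen.tInv A x y) - 1)
  | inv_r (A : S) (x y : X) : IsRelator (pr A x y * var (Gen.rInv A x y) - 1)
  | v_two (A : S) (x y : X) : IsRelator (pv A (vup y x) (vdn x y) - pv A x y)
  | v_three₁ (A : S) (x y z : X) : IsRelator
      (pv (act A (vdn y z)) x (vup z y) * pv A y z
        - pv (act A (vdn (vdn x y) z)) (vup y x) (vup z (vdn x y)) * pv A (vdn x y) z)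
  | v_three₂ (A : S) (x y z : X) : IsRelator
      (pv (act A (vdn (vdn x y) z)) (vup y x) (vup z (vdn x y))
          * pv A (vdn x (vup z y)) (vdn y z)
        - pv (act A z) x y * pv A y z)
  | v_three₃ (A : S) (x y z : X) : IsRelator
      (pv (act A z) x y * pv A (vdn x y) z
        - pv (act A (vdn y z)) x (vup z y) * pv A (vdn x (vup z y)) (vdn y z))
  | mixed₁ (A : S) (x y z : X) : IsRelator
      (pv (act A (dn y z)) x (up z y) * pv A (vdn x (up z y)) (dn y z)
        - pv (act A z) x y * pv A (vdn x y) z)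
  | mixed₂ (A : S) (x y z : X) : IsRelator
      (pv A (vdn x (up z y)) (dn y z) * pr A y z
        - pr (act A (vdn (vdn x y) z)) (vup y x) (vup z (vdn x y)) * pv (act A z) x y)
  | mixed₃ (A : S) (x y z : X) : IsRelator
      (pv (act A (dn y z)) x (up z y) * pt A y z
        - pt (act A (vdn (vdn x y) z)) (vup y x) (vup z (vdn x y)) * pv A (vdn x y) z)
  | three₁ (A : S) (x y z : X) : IsRelator
      (pr A (dn x (up z y)) (dn y z) * pr (act A (dn y z)) x (up z y)
        - pr A (dn x y) z * pr (act A z) x y)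
  | three₂ (A : S) (x y z : X) : IsRelator
      (pt A (dn x (up z y)) (dn y z) * pr A y z
        - pr (act A (dn (dn x y) z)) (up y x) (up z (dn x y)) * pt (act A z) x y)
  | three₃ (A : S) (x y z : X) : IsRelator
      (pt (act A (dn y z)) x (up z y) * pt A y z
        - pt (act A (dn (dn x y) z)) (up y x) (up z (dn x y)) * pt A (dn x y) z)
  | q_two (A : S) (x : X) : IsRelator (1 - pq A (T x) * pq A x)
  | v_T_right (A : S) (x y : X) : IsRelator (pv A x (T y) - pv A x y)
  | v_T_left (A : S) (x y : X) : IsRelator (pv A (T x) y - pv A x y)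
  | v_q_left (A : S) (x y : X) : IsRelator
      (pq (act A y) x * pv A x y - pv A (T x) y * pq A (vdn x y))
  | v_q_right (A : S) (x y : X) : IsRelator
      (pv A x (T y) * pq A y - pq (act A (vdn x y)) (vup y x) * pv A x y)
  | twist₁ (A : S) (x y : X) : IsRelator
      (pv A (up (vdn x y) (vup y x)) (dn (vup y x) (vdn x y)) * pq A (dn (T x) (T y))
          * pr A (T x) (T y) * pq (act A y) x * pv A x y
        - pt A (vup y x) (vdn x y))
  | twist₂ (A : S) (x y : X) : IsRelator
      (pq (act A (dn (T x) (T y))) (up (T y) (T x)) * pt A (T x) (T y) * pq A y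
        - pv A (up (vdn x y) (vup y x)) (dn (vup y x) (vdn x y)) * pr A (vup y x) (vdn x y)
          * pv A x y)
  | phone_cord (A : S) (x : X) : IsRelator
      (1 - ∏ k ∈ Finset.range (birackRank X), kinkCoeff A ((kink X ^ k) x))

variable (X S) in
/-- The twisted virtual shadow algebra `ℤ[X, S]`. -/
abbrev ShadowAlgebra : Type (max u v) :=
  MvPolynomial (Gen X S) ℤ ⧸ Ideal.span {p : MvPolynomial (Gen X S) ℤ | IsRelator p}

/-- The element of the twisted virtual shadow algebra named by a generator. -/
noncomputable def coeff (g : Gen X S) : ShadowAlgebra X S := Ideal.Quotient.mk _ (var g)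

end Algebra

section Diagrams

/- Link diagrams in the plane are cut by horizontal lines into slices, each of which holds one
maximum, minimum, crossing or twist bar next to vertical strands.  Read from bottom to top, this
is a word of slices. -/

/-- A strand that meets a horizontal line: its direction (`up` or down) and the name of the link
component it belongs to. -/
structure Strand (ι : Type) where
  up : Bool
  comp : ι

/-- The strand of the same component in the opposite direction. -/
def Strand.rev {ι : Type} (a : Strand ι) : Strand ι := ⟨!a.up, a.comp⟩

/-- The crossing of the strand from bottom left to top right with the strand from bottom right to
top left: classical with the former over, classical with the latter over, or virtual. -/
inductive CrossKind
  | leftOver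
  | rightOver
  | virt

/-- The kind of a crossing in which the strand that is over (if any) starts on the other side. -/
def CrossKind.swap : CrossKind → CrossKind
  | .leftOver => .rightOver
  | .rightOver => .leftOver
  | .virt => .virt

/-- Positive, negative and virtual crossings of oriented strands. -/
inductive CrossType
  | pos
  | neg
  | virt

/-- The type of a crossing, where `a` and `b` tell whether the strands that start at the bottom
left and bottom right of the crossing are directed upward. -/
def CrossKind.type : CrossKind → Bool → Bool → CrossType
  | .leftOver, a, b => if a = b then .pos else .neg
  | .rightOver, a, b => if a = b then .neg else .pos
  | .virt, _, _ => .virt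

/-- The contribution of a crossing to the writhe. -/
def CrossType.sign : CrossType → ℤ
  | .pos => 1
  | .neg => -1
  | .virt => 0

/-- The elementary pieces: a minimum, a maximum, a crossing, a twist bar. -/
inductive Piece (ι : Type)
  | cup (a : Strand ι)
  | cap (a : Strand ι)
  | cross (k : CrossKind) (a b : Strand ι)
  | bar (a : Strand ι)

/-- The strands that meet the bottom of a piece. -/
def Piece.dom {ι : Type} : Piece ι → List (Strand ι)
  | .cup _ => []
  | .cap a => [a, a.rev]
  | .cross _ a b => [a, b]
  | .bar a => [a]

/-- The strands that meet the top of a piece. -/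
def Piece.cod {ι : Type} : Piece ι → List (Strand ι)
  | .cup a => [a, a.rev]
  | .cap _ => []
  | .cross _ a b => [b, a]
  | .bar a => [a]

/-- A slice: a piece with vertical strands to its left and right. -/
structure Slice (ι : Type) where
  left : List (Strand ι)
  piece : Piece ι
  right : List (Strand ι)

/-- The strands at the bottom of a slice. -/
def Slice.src {ι : Type} (s : Slice ι) : List (Strand ι) := s.left ++ s.piece.dom ++ s.right

/-- The strands at the top of a slice. -/
def Slice.tgt {ι : Type} (s : Slice ι) : List (Strand ι) := s.left ++ s.piece.cod ++ s.right

/-- The strands on the `k`-th horizontal line, below the `k`-th slice (none above the last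
slice). -/
def level {ι : Type} (word : List (Slice ι)) (k : ℕ) : List (Strand ι) :=
  match word[k]? with
  | some s => s.src
  | none => []

/-- An oriented twisted virtual diagram in the plane: a word of slices that fit together, with
nothing below the first and nothing above the last one. -/
structure Diagram (ι : Type) where
  word : List (Slice ι)
  level_zero : level word 0 = []
  tgt_eq : ∀ k s, word[k]? = some s → s.tgt = level word (k + 1)

namespace Diagram

variable {ι : Type} (D : Diagram ι)

/-- The points where the diagram meets the horizontal lines: pairs (line, position). -/
def Pt : Type := {p : ℕ × ℕ // p.2 < (level D.word p.1).length}

/-- The gaps between (and beside) these points on the horizontal lines: pairs (line, position). -/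
def Gap : Type := {p : ℕ × ℕ // p.1 ≤ D.word.length ∧ p.2 ≤ (level D.word p.1).length}

/-- The strand through a point. -/
def strand (p : D.Pt) : Strand ι := (level D.word p.1.1)[p.1.2]'p.2

theorem fst_le (p : D.Pt) : p.1.1 ≤ D.word.length := by
  by_contra h
  have h2 := p.2
  rw [level, List.getElem?_eq_none (by omega)] at h2
  simp at h2

/-- The gap to the left of a point on its line. -/
def gapLeft (p : D.Pt) : D.Gap := ⟨p.1, D.fst_le p, p.2.le⟩

/-- The gap to the right of a point on its line. -/
def gapRight (p : D.Pt) : D.Gap := ⟨(p.1.1, p.1.2 + 1), D.fst_le p, p.2⟩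

/-- The `k`-th slice of the diagram is the slice `s`. -/
def Occurs (k : ℕ) (s : Slice ι) : Prop := D.word[k]? = some s

variable {D}

theorem Occurs.lt {k : ℕ} {s : Slice ι} (h : D.Occurs k s) : k < D.word.length :=
  (List.getElem?_eq_some_iff.1 h).1

theorem Occurs.length_src {k : ℕ} {s : Slice ι} (h : D.Occurs k s) :
    (level D.word k).length = s.left.length + s.piece.dom.length + s.right.length := by
  have h' : D.word[k]? = some s := h
  simp [level, h', Slice.src]
  omega

theorem Occurs.length_tgt {k : ℕ} {s : Slice ι} (h : D.Occurs k s) :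
    (level D.word (k + 1)).length
      = s.left.length + s.piece.cod.length + s.right.length := by
  rw [← D.tgt_eq k s h]
  simp [Slice.tgt]
  omega

/-- The `i`-th point at the bottom of the piece in a slice. -/
def Occurs.bot {k : ℕ} {s : Slice ι} (h : D.Occurs k s) (i : ℕ) (hi : i < s.piece.dom.length) :
    D.Pt :=
  ⟨(k, s.left.length + i), by simp only [h.length_src]; omega⟩

/-- The `i`-th point at the top of the piece in a slice. -/
def Occurs.top {k : ℕ} {s : Slice ι} (h : D.Occurs k s) (i : ℕ) (hi : i < s.piece.cod.length) :
    D.Pt :=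
  ⟨(k + 1, s.left.length + i), by simp only [h.length_tgt]; omega⟩

/-- The `i`-th point below the part of a slice to the left of its piece. -/
def Occurs.leftBot {k : ℕ} {s : Slice ι} (h : D.Occurs k s) (i : ℕ) (hi : i < s.left.length) :
    D.Pt :=
  ⟨(k, i), by simp only [h.length_src]; omega⟩

/-- The `i`-th point above the part of a slice to the left of its piece. -/
def Occurs.leftTop {k : ℕ} {s : Slice ι} (h : D.Occurs k s) (i : ℕ) (hi : i < s.left.length) :
    D.Pt :=
  ⟨(k + 1, i), by simp only [h.length_tgt]; omega⟩

/-- The `i`-th point below the part of a slice to the right of its piece. -/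
def Occurs.rightBot {k : ℕ} {s : Slice ι} (h : D.Occurs k s) (i : ℕ) (hi : i < s.right.length) :
    D.Pt :=
  ⟨(k, s.left.length + s.piece.dom.length + i), by simp only [h.length_src]; omega⟩

/-- The `i`-th point above the part of a slice to the right of its piece. -/
def Occurs.rightTop {k : ℕ} {s : Slice ι} (h : D.Occurs k s) (i : ℕ) (hi : i < s.right.length) :
    D.Pt :=
  ⟨(k + 1, s.left.length + s.piece.cod.length + i), by simp only [h.length_tgt]; omega⟩

/-- The `i`-th gap below the left part of a slice, up to the one directly left of its piece. -/
def Occurs.gapLeftBot {k : ℕ} {s : Slice ι} (h : D.Occurs k s) (i : ℕ) (hi : i ≤ s.left.length) :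
    D.Gap :=
  ⟨(k, i), h.lt.le, by simp only [h.length_src]; omega⟩

/-- The `i`-th gap above the left part of a slice, up to the one directly left of its piece. -/
def Occurs.gapLeftTop {k : ℕ} {s : Slice ι} (h : D.Occurs k s) (i : ℕ) (hi : i ≤ s.left.length) :
    D.Gap :=
  ⟨(k + 1, i), h.lt, by simp only [h.length_tgt]; omega⟩

/-- The `i`-th gap below the right part of a slice, from the one directly right of its piece. -/
def Occurs.gapRightBot {k : ℕ} {s : Slice ι} (h : D.Occurs k s) (i : ℕ)
    (hi : i ≤ s.right.length) : D.Gap :=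
  ⟨(k, s.left.length + s.piece.dom.length + i), h.lt.le, by simp only [h.length_src]; omega⟩

/-- The `i`-th gap above the right part of a slice, from the one directly right of its piece. -/
def Occurs.gapRightTop {k : ℕ} {s : Slice ι} (h : D.Occurs k s) (i : ℕ)
    (hi : i ≤ s.right.length) : D.Gap :=
  ⟨(k + 1, s.left.length + s.piece.cod.length + i), h.lt, by simp only [h.length_tgt]; omega⟩

variable (D)

/-- Two points are joined by an arc of the diagram within one slice, without passing through a
crossing or a twist bar. -/
inductive ArcRel : D.Pt → D.Pt → Prop
  | left {k : ℕ} {s : Slice ι} (h : D.Occurs k s) (i : ℕ) (hi : i < s.left.length) :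
      ArcRel (h.leftBot i hi) (h.leftTop i hi)
  | right {k : ℕ} {s : Slice ι} (h : D.Occurs k s) (i : ℕ) (hi : i < s.right.length) :
      ArcRel (h.rightBot i hi) (h.rightTop i hi)
  | cup {k : ℕ} {l r : List (Strand ι)} {a : Strand ι} (h : D.Occurs k ⟨l, .cup a, r⟩) :
      ArcRel (h.top 0 (by simp [Piece.cod])) (h.top 1 (by simp [Piece.cod]))
  | cap {k : ℕ} {l r : List (Strand ι)} {a : Strand ι} (h : D.Occurs k ⟨l, .cap a, r⟩) :
      ArcRel (h.bot 0 (by simp [Piece.dom])) (h.bot 1 (by simp [Piece.dom]))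

/-- The semiarcs of the diagram: it is divided at crossings (classical and virtual) and at twist
bars. -/
def Semiarc : Type := Quot D.ArcRel

/-- Two gaps are joined within one slice in the complement of the diagram. -/
inductive RegionRel : D.Gap → D.Gap → Prop
  | left {k : ℕ} {s : Slice ι} (h : D.Occurs k s) (i : ℕ) (hi : i ≤ s.left.length) :
      RegionRel (h.gapLeftBot i hi) (h.gapLeftTop i hi)
  | right {k : ℕ} {s : Slice ι} (h : D.Occurs k s) (i : ℕ) (hi : i ≤ s.right.length) :
      RegionRel (h.gapRightBot i hi) (h.gapRightTop i hi)

/-- The regions of the plane between the strands of the diagram. -/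
def Region : Type := Quot D.RegionRel

/-- Two points are joined by a part of a strand of the diagram within one slice; the strand goes
straight through crossings and twist bars. -/
inductive CompRel : D.Pt → D.Pt → Prop
  | arc {p q : D.Pt} (h : D.ArcRel p q) : CompRel p q
  | bar {k : ℕ} {l r : List (Strand ι)} {a : Strand ι} (h : D.Occurs k ⟨l, .bar a, r⟩) :
      CompRel (h.bot 0 (by simp [Piece.dom])) (h.top 0 (by simp [Piece.cod]))
  | cross_left {k : ℕ} {l r : List (Strand ι)} {c : CrossKind} {a b : Strand ι}
      (h : D.Occurs k ⟨l, .cross c a b, r⟩) :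
      CompRel (h.bot 0 (by simp [Piece.dom])) (h.top 1 (by simp [Piece.cod]))
  | cross_right {k : ℕ} {l r : List (Strand ι)} {c : CrossKind} {a b : Strand ι}
      (h : D.Occurs k ⟨l, .cross c a b, r⟩) :
      CompRel (h.bot 1 (by simp [Piece.dom])) (h.top 0 (by simp [Piece.cod]))

/-- A twist bar of the diagram. -/
structure Bar where
  k : ℕ
  l : List (Strand ι)
  a : Strand ι
  r : List (Strand ι)
  occurs : D.Occurs k ⟨l, .bar a, r⟩

/-- A crossing (classical or virtual) of the diagram. -/
structure Crossing where
  k : ℕ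
  l : List (Strand ι)
  kind : CrossKind
  a : Strand ι
  b : Strand ι
  r : List (Strand ι)
  occurs : D.Occurs k ⟨l, .cross kind a b, r⟩

variable {D}

/-- The region to the right of a point for a traveler along the oriented strand. -/
def rightRegion (p : D.Pt) : D.Region :=
  Quot.mk _ (if (D.strand p).up then D.gapRight p else D.gapLeft p)

/-- The region to the left of a point for a traveler along the oriented strand. -/
def leftRegion (p : D.Pt) : D.Region :=
  Quot.mk _ (if (D.strand p).up then D.gapLeft p else D.gapRight p)

/-- The point below a twist bar. -/
def Bar.bot (b : D.Bar) : D.Pt := b.occurs.bot 0 (by simp [Piece.dom])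

/-- The point above a twist bar. -/
def Bar.top (b : D.Bar) : D.Pt := b.occurs.top 0 (by simp [Piece.cod])

/-- The point directly before a twist bar on the oriented strand. -/
def Bar.before (b : D.Bar) : D.Pt := if b.a.up then b.bot else b.top

/-- The point directly after a twist bar on the oriented strand. -/
def Bar.after (b : D.Bar) : D.Pt := if b.a.up then b.top else b.bot

/-- The semiarc that enters a twist bar. -/
def Bar.inArc (b : D.Bar) : D.Semiarc := Quot.mk _ b.before

/-- The semiarc that leaves a twist bar. -/
def Bar.outArc (b : D.Bar) : D.Semiarc := Quot.mk _ b.after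

/-- The region to the right of the strand at a twist bar. -/
def Bar.base (b : D.Bar) : D.Region := rightRegion b.before

namespace Crossing

/-- The bottom left point at a crossing. -/
def botLeft (c : D.Crossing) : D.Pt := c.occurs.bot 0 (by simp [Piece.dom])

/-- The bottom right point at a crossing. -/
def botRight (c : D.Crossing) : D.Pt := c.occurs.bot 1 (by simp [Piece.dom])

/-- The top left point at a crossing. -/
def topLeft (c : D.Crossing) : D.Pt := c.occurs.top 0 (by simp [Piece.cod])

/-- The top right point at a crossing. -/
def topRight (c : D.Crossing) : D.Pt := c.occurs.top 1 (by simp [Piece.cod])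

/-- The positive, negative or virtual type of a crossing. -/
def type (c : D.Crossing) : CrossType := c.kind.type c.a.up c.b.up

/- Turn the crossing such that both of its strands are directed upward.  Then `inL`, `inR`,
`outL`, `outR` are the points at the bottom left, bottom right, top left and top right. -/

/-- The incoming left point. -/
def inL (c : D.Crossing) : D.Pt :=
  match c.a.up, c.b.up with
  | true, true => c.botLeft
  | false, false => c.topRight
  | true, false => c.topLeft
  | false, true => c.botRight

/-- The incoming right point. -/
def inR (c : D.Crossing) : D.Pt :=
  match c.a.up, c.b.up with
  | true, true => c.botRight
  | false, false => c.topLeft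
  | true, false => c.botLeft
  | false, true => c.topRight

/-- The outgoing left point. -/
def outL (c : D.Crossing) : D.Pt :=
  match c.a.up, c.b.up with
  | true, true => c.topLeft
  | false, false => c.botRight
  | true, false => c.topRight
  | false, true => c.botLeft

/-- The outgoing right point. -/
def outR (c : D.Crossing) : D.Pt :=
  match c.a.up, c.b.up with
  | true, true => c.topRight
  | false, false => c.botLeft
  | true, false => c.botRight
  | false, true => c.topLeft

/-- The incoming left semiarc. -/
def inLArc (c : D.Crossing) : D.Semiarc := Quot.mk _ c.inL

/-- The incoming right semiarc. -/
def inRArc (c : D.Crossing) : D.Semiarc := Quot.mk _ c.inR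

/-- The outgoing left semiarc. -/
def outLArc (c : D.Crossing) : D.Semiarc := Quot.mk _ c.outL

/-- The outgoing right semiarc. -/
def outRArc (c : D.Crossing) : D.Semiarc := Quot.mk _ c.outR

/-- The region at a crossing that is to the right of both strands. -/
def base (c : D.Crossing) : D.Region := rightRegion c.inR

end Crossing

variable (D)

/-- The writhe of a component: the sum of the signs of its classical self-crossings. -/
def writhe [DecidableEq ι] (i : ι) : ℤ :=
  (D.word.map fun s => match s.piece with
    | .cross k a b => if a.comp = i ∧ b.comp = i then (k.type a.up b.up).sign else 0
    | _ => 0).sum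

end Diagram

/-- An oriented twisted virtual link diagram whose components are named by `ι`: every name is the
name of exactly one closed curve. -/
structure LinkDiagram (ι : Type) extends Diagram ι where
  surjective : ∀ i : ι, ∃ p, (toDiagram.strand p).comp = i
  connected : ∀ p q, (toDiagram.strand p).comp = (toDiagram.strand q).comp →
    Relation.EqvGen toDiagram.CompRel p q

end Diagrams

section Isotopy

variable {ι : Type}

/-- The kinds of the crossings of three strands `a`, `b`, `c` (of `a` and `b`, of `a` and `c`, of
`b` and `c`) for which there is a Reidemeister move: all classical with one strand over, one under
and one in between; all virtual; or exactly one classical. -/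
def TripleAllowed : CrossKind → CrossKind → CrossKind → Prop
  | .leftOver, .rightOver, .leftOver => False
  | .rightOver, .leftOver, .rightOver => False
  | .virt, .virt, _ => True
  | .virt, _, .virt => True
  | _, .virt, .virt => True
  | .virt, _, _ => False
  | _, .virt, _ => False
  | _, _, .virt => False
  | _, _, _ => True

/-- The local moves on tangles that are written as words of slices from bottom to top. -/
inductive LocalMove : List (Slice ι) → List (Slice ι) → Prop
  /- isotopies of the plane -/
  | interchange (p q : Piece ι) (m : List (Strand ι)) : LocalMove
      [⟨[], p, m ++ q.dom⟩, ⟨p.cod ++ m, q, []⟩]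
      [⟨p.dom ++ m, q, []⟩, ⟨[], p, m ++ q.cod⟩]
  | zigzag_left (a : Strand ι) : LocalMove
      [⟨[a], .cup a.rev, []⟩, ⟨[], .cap a, [a]⟩] []
  | zigzag_right (a : Strand ι) : LocalMove
      [⟨[], .cup a, [a]⟩, ⟨[a], .cap a.rev, []⟩] []
  | cross_cap (k : CrossKind) (a c : Strand ι) : LocalMove
      [⟨[], .cross k a c, [a.rev]⟩, ⟨[c], .cap a, []⟩]
      [⟨[a], .cross k.swap c a.rev, []⟩, ⟨[], .cap a, [c]⟩]
  | cross_cup (k : CrossKind) (a c : Strand ι) : LocalMove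
      [⟨[c], .cup a, []⟩, ⟨[], .cross k c a, [a.rev]⟩]
      [⟨[], .cup a, [c]⟩, ⟨[a], .cross k.swap a.rev c, []⟩]
  | bar_cap (a : Strand ι) : LocalMove
      [⟨[], .bar a, [a.rev]⟩, ⟨[], .cap a, []⟩]
      [⟨[a], .bar a.rev, []⟩, ⟨[], .cap a, []⟩]
  | bar_cup (a : Strand ι) : LocalMove
      [⟨[], .cup a, []⟩, ⟨[], .bar a, [a.rev]⟩]
      [⟨[], .cup a, []⟩, ⟨[a], .bar a.rev, []⟩]
  /- the first, second and third Reidemeister moves, classical, virtual and mixed -/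
  | kink_right (k : CrossKind) (a : Strand ι) : LocalMove
      [⟨[a], .cup a, []⟩, ⟨[], .cross k a a, [a.rev]⟩, ⟨[a], .cap a, []⟩] []
  | kink_left (k : CrossKind) (a : Strand ι) : LocalMove
      [⟨[], .cup a.rev, [a]⟩, ⟨[a.rev], .cross k a a, []⟩, ⟨[], .cap a.rev, [a]⟩] []
  | two (k : CrossKind) (a b : Strand ι) : LocalMove
      [⟨[], .cross k a b, []⟩, ⟨[], .cross k.swap b a, []⟩] []
  | three (k₁ k₂ k₃ : CrossKind) (hk : TripleAllowed k₁ k₂ k₃) (a b c : Strand ι) : LocalMove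
      [⟨[], .cross k₁ a b, [c]⟩, ⟨[b], .cross k₂ a c, []⟩, ⟨[], .cross k₃ b c, [a]⟩]
      [⟨[a], .cross k₃ b c, []⟩, ⟨[], .cross k₂ a c, [b]⟩, ⟨[c], .cross k₁ a b, []⟩]
  /- the twisted moves -/
  | bar_bar (a : Strand ι) : LocalMove
      [⟨[], .bar a, []⟩, ⟨[], .bar a, []⟩] []
  | bar_virt_left (a b : Strand ι) : LocalMove
      [⟨[], .bar a, [b]⟩, ⟨[], .cross .virt a b, []⟩]
      [⟨[], .cross .virt a b, []⟩, ⟨[b], .bar a, []⟩]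
  | bar_virt_right (a b : Strand ι) : LocalMove
      [⟨[a], .bar b, []⟩, ⟨[], .cross .virt a b, []⟩]
      [⟨[], .cross .virt a b, []⟩, ⟨[], .bar b, [a]⟩]
  | bars_cross (k : CrossKind) (hk : k ≠ .virt) (a b : Strand ι) : LocalMove
      [⟨[], .bar a, [b]⟩, ⟨[a], .bar b, []⟩, ⟨[], .cross k a b, []⟩,
        ⟨[], .bar b, [a]⟩, ⟨[b], .bar a, []⟩]
      [⟨[], .cross .virt a b, []⟩, ⟨[], .cross k b a, []⟩, ⟨[], .cross .virt a b, []⟩]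

/-- Put vertical strands to the left and right of a slice. -/
def Slice.whisker (l r : List (Strand ι)) (s : Slice ι) : Slice ι :=
  ⟨l ++ s.left, s.piece, s.right ++ r⟩

/-- A local move inside a larger diagram. -/
def Move (w₁ w₂ : List (Slice ι)) : Prop :=
  ∃ (pre post : List (Slice ι)) (l r : List (Strand ι)) (m₁ m₂ : List (Slice ι)),
    LocalMove m₁ m₂ ∧
    w₁ = pre ++ m₁.map (Slice.whisker l r) ++ post ∧
    w₂ = pre ++ m₂.map (Slice.whisker l r) ++ post

/-- Twisted virtual isotopy of link diagrams with named components: the equivalence relation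
generated by the moves. -/
def Isotopic : LinkDiagram ι → LinkDiagram ι → Prop :=
  Relation.EqvGen fun D D' => Move D.word D'.word

/-- Change the names of the components of a strand. -/
def Strand.rename {κ : Type} (f : ι → κ) (a : Strand ι) : Strand κ := ⟨a.up, f a.comp⟩

/-- Change the names of the components in a piece. -/
def Piece.rename {κ : Type} (f : ι → κ) : Piece ι → Piece κ
  | .cup a => .cup (a.rename f)
  | .cap a => .cap (a.rename f)
  | .cross k a b => .cross k (a.rename f) (b.rename f)
  | .bar a => .bar (a.rename f)

/-- Change the names of the components in a slice. -/
def Slice.rename {κ : Type} (f : ι → κ) (s : Slice ι) : Slice κ :=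
  ⟨s.left.map (Strand.rename f), s.piece.rename f, s.right.map (Strand.rename f)⟩

/-- Twisted virtual isotopy of link diagrams, regardless of the numbering of the components. -/
def TwistedVirtuallyIsotopic (L L' : LinkDiagram ι) : Prop :=
  ∃ (σ : Equiv.Perm ι) (D : LinkDiagram ι),
    D.word = L.word.map (Slice.rename σ) ∧ Isotopic D L'

/-- A choice, for every writhe vector modulo `N`, of a diagram of the (unframed) link `L` with
this writhe vector. -/
structure FramingTile [DecidableEq ι] (L : LinkDiagram ι) (N : ℕ) where
  diagram : (ι → ZMod N) → LinkDiagram ι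
  isotopic : ∀ w, Isotopic L (diagram w)
  writhe_eq : ∀ w i, (((diagram w).writhe i : ℤ) : ZMod N) = w i

end Isotopy

section Invariant

variable (X : Type u) [TwistedVirtualBirack X] (S : Type v) [TwistedShadow X S]

variable {ι : Type}

open TwistedVirtualBirack (T)

open VirtualBirack (B V)

/-- The condition on the labels at the four ends of a crossing. -/
def CrossingRule {X : Type u} [VirtualBirack X] (inL inR outL outR : X) : CrossType → Prop
  | .pos => B (inL, inR) = (outL, outR)
  | .neg => B (outL, outR) = (inL, inR)
  | .virt => V (inL, inR) = (outL, outR)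

/-- An `X, S`-labeling of a diagram. -/
@[ext]
structure Labeling (D : Diagram ι) where
  arc : D.Semiarc → X
  region : D.Region → S
  region_eq : ∀ p : D.Pt, region (Diagram.leftRegion p)
    = TwistedShadow.act (region (Diagram.rightRegion p)) (arc (Quot.mk _ p))
  crossing : ∀ c : D.Crossing,
    CrossingRule (arc c.inLArc) (arc c.inRArc) (arc c.outLArc) (arc c.outRArc) c.type
  bar : ∀ b : D.Bar, arc b.outArc = T (arc b.inArc)

variable {X S}

/-- The relations between the beads on the semiarcs of a labeled diagram.  At a positive crossing
with labels `x, y` on the incoming and beads `a, b` on the incoming semiarcs, the outgoing beads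
are `t b` and `r a`; at a negative crossing the same holds with in and out exchanged; at a virtual
crossing the outgoing beads are `v b` and `v⁻¹ a`; at a twist bar the outgoing bead is `q a`. -/
inductive BeadRelator {D : Diagram ι} (f : Labeling X S D) :
    (D.Semiarc →₀ ShadowAlgebra X S) → Prop
  | pos_t (c : D.Crossing) (hc : c.type = .pos) : BeadRelator f
      (Finsupp.single c.outLArc 1
        - Finsupp.single c.inRArc (coeff (.t (f.region c.base) (f.arc c.inLArc) (f.arc c.inRArc))))
  | pos_r (c : D.Crossing) (hc : c.type = .pos) : BeadRelator f
      (Finsupp.single c.outRArc 1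
        - Finsupp.single c.inLArc (coeff (.r (f.region c.base) (f.arc c.inLArc) (f.arc c.inRArc))))
  | neg_t (c : D.Crossing) (hc : c.type = .neg) : BeadRelator f
      (Finsupp.single c.inLArc 1
        - Finsupp.single c.outRArc
          (coeff (.t (f.region c.base) (f.arc c.outLArc) (f.arc c.outRArc))))
  | neg_r (c : D.Crossing) (hc : c.type = .neg) : BeadRelator f
      (Finsupp.single c.inRArc 1
        - Finsupp.single c.outLArc
          (coeff (.r (f.region c.base) (f.arc c.outLArc) (f.arc c.outRArc))))
  | virt_v (c : D.Crossing) (hc : c.type = .virt) : BeadRelator f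
      (Finsupp.single c.outLArc 1
        - Finsupp.single c.inRArc (coeff (.v (f.region c.base) (f.arc c.inLArc) (f.arc c.inRArc))))
  | virt_vInv (c : D.Crossing) (hc : c.type = .virt) : BeadRelator f
      (Finsupp.single c.outRArc 1
        - Finsupp.single c.inLArc
          (coeff (.vInv (f.region c.base) (f.arc c.inLArc) (f.arc c.inRArc))))
  | bar_q (b : D.Bar) : BeadRelator f
      (Finsupp.single b.outArc 1
        - Finsupp.single b.inArc (coeff (.q (f.region b.base) (f.arc b.inArc))))

/-- The fundamental `ℤ[X, S]`-module `ℤ[f]` of a labeling `f`: generated by the beads on the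
semiarcs, subject to the bead relations. -/
abbrev FundamentalModule {D : Diagram ι} (f : Labeling X S D) : Type (max u v) :=
  (D.Semiarc →₀ ShadowAlgebra X S) ⧸
    Submodule.span (ShadowAlgebra X S) {m : D.Semiarc →₀ ShadowAlgebra X S | BeadRelator f m}

variable (G : Type w) [AddCommGroup G] [Module (ShadowAlgebra X S) G]

/-- The module of homomorphisms `Hom (ℤ[f], G)`. -/
abbrev BeadModule {D : Diagram ι} (f : Labeling X S D) : Type (max u v w) :=
  FundamentalModule f →ₗ[ShadowAlgebra X S] G

/-- The ring of endomorphisms of `G`.  It acts on `Hom (ℤ[f], G)` by composition. -/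
abbrev EndRing : Type w := Module.End (ShadowAlgebra X S) G

/-- Isomorphism classes of modules over the endomorphism ring of `G`. -/
abbrev ModuleClass : Type (max (u + 1) (v + 1) (w + 1)) :=
  Quotient (CategoryTheory.isIsomorphicSetoid
    (ModuleCat.{max u v w} (EndRing (X := X) (S := S) G)))

/-- The isomorphism class of `Hom (ℤ[f], G)`. -/
noncomputable def beadClass {D : Diagram ι} (f : Labeling X S D) :
    ModuleClass (X := X) (S := S) G :=
  Quotient.mk _ (ModuleCat.of (EndRing (X := X) (S := S) G) (BeadModule G f))

variable [DecidableEq ι] {L : LinkDiagram ι}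

/-- The twisted virtual shadow module multiset, computed with given diagrams of all writhe vectors
modulo `N`: the function that takes an isomorphism class to its multiplicity, which is the number
of pairs of a writhe vector and a labeling of the diagram with this writhe vector such that the
module of homomorphisms is in the class. -/
noncomputable def moduleMultiset {N : ℕ} (F : FramingTile L N)
    (M : ModuleClass (X := X) (S := S) G) : Cardinal.{max u v} :=
  Cardinal.mk {f : Σ w : ι → ZMod N, Labeling X S (F.diagram w).toDiagram // beadClass G f.2 = M}

/-- The twisted virtual shadow module polynomial, computed with given diagrams of all writhe
vectors modulo `N`. -/
noncomputable def modulePolynomial {N : ℕ} (F : FramingTile L N) : Polynomial ℕ :=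
  ∑ᶠ w : ι → ZMod N, ∑ᶠ f : Labeling X S (F.diagram w).toDiagram,
    (Polynomial.X : Polynomial ℕ) ^ Nat.card (BeadModule G f)

end Invariant

end TwistedVirtual

/-! A homomorphism from `ℤ[f]` to `G` is the same as an assignment of elements of `G` to the
semiarcs that satisfies the bead relations. So a labeling together with a homomorphism is a coloring
of the diagram by pairs in `X × G`, with elements of `S` in the gaps. Read from slice to slice, it
is a path of lines of pairs (`Labeling.toCol`), and a local move becomes a statement about paths
with given ends (`LocalMove.thin`).

At a single crossing the axioms say that the pairs at two neighbouring ends determine the other two.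
Hence crossings can be turned in the plane (`CrossRel.rot`), and the third Reidemeister move only
has to be checked for three upward strands, where it is the Yang–Baxter equation together with the
relations of the algebra (`braidRel_of_allowed`).

The first Reidemeister move does not preserve colorings. A positive kink acts on the pairs of a
strand with region `A` on its right by a permutation `kap A`. Its `N`-th power is the identity, by
the definition of the rank and the phone cord relation (`kap_pow_birackRank`). A loop on the left
has the same effect as one on the right (`eq_kap_of_left_loop`), and `kap` passes through all
crossings (`kap_left`, `kap_right`) and through twist bars (`kap_tau`). Therefore one may put formal
kinks, powers of `kap`, on the strands and slide them along a component; only their number on each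
component matters. Removing a real kink is paid for by a formal one. Thus the colorings of a diagram
with `n i` formal kinks on its `i`-th component depend, up to bijection, only on the isotopy class
and on the sums of `n i` and the writhe of component `i` (`framedSim_of_isotopic`). Multiples of `N`
are invisible, so isotopic diagrams with equal writhes modulo `N` have equally many colorings.

These bijections are natural in `G`. Naturality alone implies that they come from a bijection of the
labelings and, for corresponding labelings, from isomorphisms of the modules of homomorphisms over
`End G` (`Sim.exists_equiv`). Diagrams of all writhe vectors exist because kinks can be inserted
(`LinkDiagram.exists_insert_kink`). A renumbering of the components only permutes the writhe
vectors. -/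

set_option linter.unusedSimpArgs false
set_option linter.unusedSectionVars false

namespace TwistedVirtual

/-! ### Solving a crossing from its left or right ends -/

section Sideways

/-- If the sideways map of `f` is unique, it is defined on all pairs. -/
theorem sideways_surjective {X : Type u} (f : X × X → X × X) (side : X × X → X × X)
    (hu : ∀ F : X × X → X × X, (∀ x y, F ((f (x, y)).1, x) = ((f (x, y)).2, y)) → F = side)
    (hs : ∀ x y, side ((f (x, y)).1, x) = ((f (x, y)).2, y)) (y' x : X) :
    ∃ y, (f (x, y)).1 = y' := by
  classical
  by_contra! h
  rcases subsingleton_or_nontrivial X with hX | hX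
  · exact h x (Subsingleton.elim _ _)
  -- If `(y', x)` is never hit, nothing constrains a sideways map there, so changing its value to
  -- `w` gives a second one.
  · obtain ⟨w, hw⟩ := exists_ne (side (y', x))
    have := hu (Function.update side (y', x) w) fun a b => by
      rw [Function.update_of_ne, hs]
      rintro hab
      obtain ⟨h1, rfl⟩ := Prod.ext_iff.1 hab
      exact h _ h1
    have h2 := congrFun this (y', x)
    rw [Function.update_self] at h2
    exact hw h2

variable (X : Type u) [VirtualBirack X]

/-- The classical (`true`) or virtual (`false`) crossing map. -/
def op : Bool → (X × X ≃ X × X)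
  | true => VirtualBirack.B
  | false => VirtualBirack.V

/-- The sideways map of `op`. -/
def sideOp : Bool → (X × X ≃ X × X)
  | true => VirtualBirack.side
  | false => VirtualBirack.vside

variable {X}

theorem sideOp_apply (c : Bool) {x y y' x' : X} (h : op X c (x, y) = (y', x')) :
    sideOp X c (y', x) = (x', y) := by
  cases c
  · have := VirtualBirack.vside_apply x y
    simp only [op] at h
    rw [h] at this
    exact this
  · have := VirtualBirack.side_apply x y
    simp only [op] at h
    rw [h] at this
    exact this

/-- Uniqueness of the sideways map is used only here: it forces the pairs `(y^x, x)` to exhaust `X ×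
X`. -/
theorem op_left_exists (c : Bool) (x y' : X) : ∃ y x', op X c (x, y) = (y', x') := by
  have : ∃ y, (op X c (x, y)).1 = y' := by
    cases c
    · exact sideways_surjective _ _ VirtualBirack.vside_unique VirtualBirack.vside_apply y' x
    · exact sideways_surjective _ _ VirtualBirack.side_unique VirtualBirack.side_apply y' x
  obtain ⟨y, rfl⟩ := this
  exact ⟨y, _, rfl⟩

theorem op_of_sideOp (c : Bool) {x y y' x' : X} (h : sideOp X c (y', x) = (x', y)) :
    op X c (x, y) = (y', x') := by
  obtain ⟨y₂, x₂, h2⟩ := op_left_exists c x y'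
  have h3 := sideOp_apply c h2
  rw [h] at h3
  obtain ⟨rfl, rfl⟩ := Prod.ext_iff.1 h3
  exact h2

theorem op_iff_sideOp (c : Bool) {x y y' x' : X} :
    op X c (x, y) = (y', x') ↔ sideOp X c (y', x) = (x', y) :=
  ⟨sideOp_apply c, op_of_sideOp c⟩

/-- Invertibility of the sideways map: `(x', y)` has a preimage, and this preimage consists of the
other two ends. -/
theorem op_right_exists (c : Bool) (y x' : X) : ∃ x y', op X c (x, y) = (y', x') := by
  refine ⟨((sideOp X c).symm (x', y)).2, ((sideOp X c).symm (x', y)).1, op_of_sideOp c ?_⟩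
  exact (sideOp X c).apply_symm_apply _

theorem op_right_unique (c : Bool) {x y y' x' x₂ y₂' : X} (h : op X c (x, y) = (y', x'))
    (h2 : op X c (x₂, y) = (y₂', x')) : x = x₂ ∧ y' = y₂' := by
  have := (sideOp X c).injective ((sideOp_apply c h).trans (sideOp_apply c h2).symm)
  exact ⟨congrArg Prod.snd this, congrArg Prod.fst this⟩

theorem op_left_unique (c : Bool) {x y y' x' y₂ x₂' : X} (h : op X c (x, y) = (y', x'))
    (h2 : op X c (x, y₂) = (y', x₂')) : y = y₂ ∧ x' = x₂' := by
  have := (sideOp_apply c h).symm.trans (sideOp_apply c h2)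
  exact ⟨congrArg Prod.snd this, congrArg Prod.fst this⟩

end Sideways

/-! ### Crossings of labels with beads -/

section Letters

variable {X : Type u} [TwistedVirtualBirack X] {S : Type v} [TwistedShadow X S]

open TwistedShadow (act)

open TwistedVirtualBirack (T)

open VirtualBirack (B V)

theorem mk_relator {p : MvPolynomial (Gen X S) ℤ} (h : IsRelator p) :
    (Ideal.Quotient.mk (Ideal.span {p : MvPolynomial (Gen X S) ℤ | IsRelator p})) p = 0 :=
  Ideal.Quotient.eq_zero_iff_mem.2 (Ideal.subset_span h)

theorem coeff_v_mul_inv (A : S) (x y : X) : coeff (.v A x y) * coeff (.vInv A x y) = 1 := by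
  have := mk_relator (IsRelator.inv_v A x y)
  rw [map_sub, sub_eq_zero, map_mul, map_one] at this
  exact this

theorem coeff_t_mul_inv (A : S) (x y : X) : coeff (.t A x y) * coeff (.tInv A x y) = 1 := by
  have := mk_relator (IsRelator.inv_t A x y)
  rw [map_sub, sub_eq_zero, map_mul, map_one] at this
  exact this

theorem coeff_r_mul_inv (A : S) (x y : X) : coeff (.r A x y) * coeff (.rInv A x y) = 1 := by
  have := mk_relator (IsRelator.inv_r A x y)
  rw [map_sub, sub_eq_zero, map_mul, map_one] at this
  exact this

/-- The coefficient of the bead that moves to the left at a crossing. -/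
noncomputable def leftCoeff (c : Bool) (A : S) (x y : X) : (ShadowAlgebra X S)ˣ :=
  match c with
  | true => ⟨coeff (.t A x y), coeff (.tInv A x y), coeff_t_mul_inv A x y,
      (mul_comm _ _).trans (coeff_t_mul_inv A x y)⟩
  | false => ⟨coeff (.v A x y), coeff (.vInv A x y), coeff_v_mul_inv A x y,
      (mul_comm _ _).trans (coeff_v_mul_inv A x y)⟩

/-- The coefficient of the bead that moves to the right at a crossing. -/
noncomputable def rightCoeff (c : Bool) (A : S) (x y : X) : (ShadowAlgebra X S)ˣ :=
  match c with
  | true => ⟨coeff (.r A x y), coeff (.rInv A x y), coeff_r_mul_inv A x y,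
      (mul_comm _ _).trans (coeff_r_mul_inv A x y)⟩
  | false => ⟨coeff (.vInv A x y), coeff (.v A x y),
      (mul_comm _ _).trans (coeff_v_mul_inv A x y), coeff_v_mul_inv A x y⟩

theorem q_mul_q (A : S) (x : X) : coeff (.q A (T x)) * coeff (.q A x) = 1 := by
  have := mk_relator (IsRelator.q_two A x)
  rw [map_sub, sub_eq_zero, map_mul, map_one] at this
  exact this.symm

/-- The coefficient of a twist bar. -/
noncomputable def barCoeff (A : S) (x : X) : (ShadowAlgebra X S)ˣ :=
  ⟨coeff (.q A x), coeff (.q A (T x)), (mul_comm _ _).trans (q_mul_q A x), q_mul_q A x⟩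

theorem act_injective {A A' : S} (x : X) (h : act A x = act A' x) : A = A' :=
  (TwistedShadow.act_bijective x).1 h

theorem act_actInv (A : S) (x : X) : act (actInv A x) x = A :=
  (Equiv.ofBijective _ (TwistedShadow.act_bijective (S := S) x)).apply_symm_apply A

theorem actInv_act (A : S) (x : X) : actInv (act A x) x = A :=
  act_injective x (act_actInv _ x)

theorem op_region (c : Bool) (A : S) {x y y' x' : X} (h : op X c (x, y) = (y', x')) :
    act (act A y) x = act (act A x') y' := by
  cases c
  · have := TwistedShadow.act_virtual A y x
    simp only [op] at h
    simp only [vdn, vup, h] at this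
    exact this.symm
  · have := TwistedShadow.act_classical A y x
    simp only [op] at h
    simp only [dn, up, h] at this
    exact this.symm

variable {G : Type w} [AddCommGroup G] [Module (ShadowAlgebra X S) G]

/-- The relation between the labels with beads at the bottom left, bottom right, top left and top
right of a crossing of two strands directed upward, classical positive or virtual, with region `A`
on the right. -/
def Crosses (c : Bool) (A : S) (x y y' x' : X × G) : Prop :=
  op X c (x.1, y.1) = (y'.1, x'.1) ∧ y'.2 = leftCoeff c A x.1 y.1 • y.2 ∧
    x'.2 = rightCoeff c A x.1 y.1 • x.2

namespace Crosses

variable {c : Bool} {A A' : S} {x y y' x' x₂ y₂ x₂' y₂' : X × G}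

theorem exists_out (c : Bool) (A : S) (x y : X × G) : ∃ y' x', Crosses c A x y y' x' :=
  ⟨(_, _), (_, _), rfl, rfl, rfl⟩

theorem out_unique (h : Crosses c A x y y' x') (h' : Crosses c A x y y₂' x₂') :
    y' = y₂' ∧ x' = x₂' := by
  have := h.1.symm.trans h'.1
  simp only [Prod.mk.injEq] at this
  exact ⟨Prod.ext this.1 (h.2.1.trans h'.2.1.symm), Prod.ext this.2 (h.2.2.trans h'.2.2.symm)⟩

theorem exists_in (c : Bool) (A : S) (y' x' : X × G) : ∃ x y, Crosses c A x y y' x' := by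
  obtain ⟨⟨x, y⟩, h⟩ := (op X c).surjective (y'.1, x'.1)
  exact ⟨(x, (rightCoeff c A x y)⁻¹ • x'.2), (y, (leftCoeff c A x y)⁻¹ • y'.2), h, by simp,
    by simp⟩

theorem in_unique (h : Crosses c A x y y' x') (h' : Crosses c A x₂ y₂ y' x') :
    x = x₂ ∧ y = y₂ := by
  have := (op X c).injective (h.1.trans h'.1.symm)
  simp only [Prod.mk.injEq] at this
  obtain ⟨h1, h2⟩ := this
  refine ⟨Prod.ext h1 ?_, Prod.ext h2 ?_⟩
  · have := h.2.2.symm.trans h'.2.2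
    rwa [h1, h2, smul_left_cancel_iff] at this
  · have := h.2.1.symm.trans h'.2.1
    rwa [h1, h2, smul_left_cancel_iff] at this

theorem exists_right (c : Bool) (A : S) (y x' : X × G) : ∃ x y', Crosses c A x y y' x' := by
  obtain ⟨x, y', h⟩ := op_right_exists c y.1 x'.1
  exact ⟨(x, (rightCoeff c A x y.1)⁻¹ • x'.2), (y', _), h, rfl, by simp⟩

theorem right_unique (h : Crosses c A x y y' x') (h' : Crosses c A x₂ y y₂' x') :
    x = x₂ ∧ y' = y₂' := by
  obtain ⟨h1, h2⟩ := op_right_unique c h.1 h'.1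
  refine ⟨Prod.ext h1 ?_, Prod.ext h2 ?_⟩
  · have := h.2.2.symm.trans h'.2.2
    rwa [h1, smul_left_cancel_iff] at this
  · rw [h.2.1, h'.2.1, h1]

theorem region (h : Crosses c A x y y' x') : act (act A y.1) x.1 = act (act A x'.1) y'.1 :=
  op_region c A h.1

/-- The left ends do not touch the region on the far right of a crossing. So the region `F` on the
far left is prescribed instead, and `A` is recovered as `(F ·⁻¹ x) ·⁻¹ y`. -/
theorem exists_left (c : Bool) (F : S) (x y' : X × G) :
    ∃ A y x', Crosses c A x y y' x' ∧ act (act A y.1) x.1 = F := by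
  obtain ⟨y, x', h⟩ := op_left_exists c x.1 y'.1
  refine ⟨actInv (actInv F x.1) y, (y, (leftCoeff c (actInv (actInv F x.1) y) x.1 y)⁻¹ • y'.2), (x', _),
    ⟨h, ?_, rfl⟩, ?_⟩
  · simp
  · simp [act_actInv]

theorem left_unique (h : Crosses c A x y y' x') (h' : Crosses c A' x y₂ y' x₂')
    (hF : act (act A y.1) x.1 = act (act A' y₂.1) x.1) : y = y₂ ∧ x' = x₂' ∧ A = A' := by
  obtain ⟨h1, h2⟩ := op_left_unique c h.1 h'.1
  have hA : A = A' := by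
    rw [h1] at hF
    exact act_injective _ (act_injective _ hF)
  subst hA
  refine ⟨Prod.ext h1 ?_, Prod.ext h2 ?_, rfl⟩
  · have := h.2.1.symm.trans h'.2.1
    rwa [h1, smul_left_cancel_iff] at this
  · rw [h.2.2, h'.2.2, h1]

/-- For the labels, `V` is an involution. For the beads, `v` takes the same value at the bottom and
the top labels by the relation `v_two`, and the two coefficients of a virtual crossing are inverse
to each other. -/
theorem symm_virt (h : Crosses false A x y y' x') : Crosses false A y' x' x y := by
  obtain ⟨h1, h2, h3⟩ := h
  have hv : leftCoeff false A y'.1 x'.1 = leftCoeff false A x.1 y.1 := by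
    have := mk_relator (IsRelator.v_two A x.1 y.1)
    simp only [op] at h1
    simp only [vup, vdn, h1] at this
    rw [map_sub, sub_eq_zero] at this
    exact Units.ext this
  have hw : rightCoeff false A y'.1 x'.1 = (leftCoeff false A x.1 y.1)⁻¹ := by
    rw [← hv]; rfl
  refine ⟨?_, ?_, ?_⟩
  · simp only [op] at h1 ⊢
    rw [← h1, VirtualBirack.V_V]
  · rw [h3, hv]
    change _ = leftCoeff false A x.1 y.1 • (leftCoeff false A x.1 y.1)⁻¹ • x.2
    simp
  · rw [h2, hw]
    simp

end Crosses

end Letters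

/-! ### The third Reidemeister move for upward strands -/

section YangBaxter

variable {X : Type u} [TwistedVirtualBirack X] {S : Type v} [TwistedShadow X S]

open TwistedShadow (act)

open TwistedVirtualBirack (T)

open VirtualBirack (B V)

theorem op_true_iff {x y y' x' : X} : op X true (x, y) = (y', x') ↔ y' = up y x ∧ x' = dn x y := by
  simp only [op, up, dn, Prod.ext_iff]
  tauto

theorem op_false_iff {x y y' x' : X} :
    op X false (x, y) = (y', x') ↔ y' = vup y x ∧ x' = vdn x y := by
  simp only [op, vup, vdn, Prod.ext_iff]
  tauto

theorem coeff_relation {p q : MvPolynomial (Gen X S) ℤ} (h : IsRelator (p - q)) :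
    (Ideal.Quotient.mk (Ideal.span {p : MvPolynomial (Gen X S) ℤ | IsRelator p})) p =
      Ideal.Quotient.mk _ q := by
  have := mk_relator h
  rwa [map_sub, sub_eq_zero] at this

variable {G : Type w} [AddCommGroup G] [Module (ShadowAlgebra X S) G]

namespace Crosses

variable {A : S} {x y z y₁ x₁ z₁ x₂ z₂ y₂ z₁' y₁' z₂' x₁' y₂' x₂' : X × G}

/-- The hypotheses without prime follow the strands through one side of the move, those with prime
through the other; `A` is the region to the right of all strands. The labels agree by the
Yang–Baxter equation. Comparing the beads of the strands that start as `z`, `y` and `x` gives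
exactly the relations `three₃`, `three₂` and `three₁`. -/
theorem yang_baxter_classical
    (h₁ : Crosses true (act A z.1) x y y₁ x₁) (h₂ : Crosses true A x₁ z z₁ x₂)
    (h₃ : Crosses true (act A x₂.1) y₁ z₁ z₂ y₂)
    (h₁' : Crosses true A y z z₁' y₁') (h₂' : Crosses true (act A y₁'.1) x z₁' z₂' x₁')
    (h₃' : Crosses true A x₁' y₁' y₂' x₂') : z₂ = z₂' ∧ y₂ = y₂' ∧ x₂ = x₂' := by
  obtain ⟨x, a⟩ := x
  obtain ⟨y, b⟩ := y
  obtain ⟨z, d⟩ := z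
  obtain ⟨y₁, by₁⟩ := y₁
  obtain ⟨x₁, bx₁⟩ := x₁
  obtain ⟨z₁, bz₁⟩ := z₁
  obtain ⟨x₂, bx₂⟩ := x₂
  obtain ⟨z₂, bz₂⟩ := z₂
  obtain ⟨y₂, by₂⟩ := y₂
  obtain ⟨z₁', bz₁'⟩ := z₁'
  obtain ⟨y₁', by₁'⟩ := y₁'
  obtain ⟨z₂', bz₂'⟩ := z₂'
  obtain ⟨x₁', bx₁'⟩ := x₁'
  obtain ⟨y₂', by₂'⟩ := y₂'
  obtain ⟨x₂', bx₂'⟩ := x₂'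
  simp only [Crosses, op_true_iff] at *
  obtain ⟨⟨rfl, rfl⟩, rfl, rfl⟩ := h₁
  obtain ⟨⟨rfl, rfl⟩, rfl, rfl⟩ := h₂
  obtain ⟨⟨rfl, rfl⟩, rfl, rfl⟩ := h₃
  obtain ⟨⟨rfl, rfl⟩, rfl, rfl⟩ := h₁'
  obtain ⟨⟨rfl, rfl⟩, rfl, rfl⟩ := h₂'
  obtain ⟨⟨rfl, rfl⟩, rfl, rfl⟩ := h₃'
  have hyb := VirtualBirack.yang_baxter_B (x, y, z)
  have e₁ := congrArg Prod.fst hyb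
  have e₂ := congrArg (fun p => p.2.1) hyb
  have e₃ := congrArg (fun p => p.2.2) hyb
  have r₁ := coeff_relation (IsRelator.three₁ A x y z)
  have r₂ := coeff_relation (IsRelator.three₂ A x y z)
  have r₃ := coeff_relation (IsRelator.three₃ A x y z)
  refine ⟨Prod.ext e₁ ?_, Prod.ext e₂ ?_, Prod.ext e₃ ?_⟩
  · simp only [smul_smul]
    congr 1
    exact Units.ext r₃.symm
  · simp only [smul_smul]
    congr 1
    exact Units.ext r₂.symm
  · simp only [smul_smul]
    congr 1
    exact Units.ext r₁.symm

/-- As in the classical case, but the strand of `x` passes two virtual crossings towards the right.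
Its coefficients are inverses of values of `v`, so `mixed₁` is used inverted. -/
theorem yang_baxter_mixed
    (h₁ : Crosses false (act A z.1) x y y₁ x₁) (h₂ : Crosses false A x₁ z z₁ x₂)
    (h₃ : Crosses true (act A x₂.1) y₁ z₁ z₂ y₂)
    (h₁' : Crosses true A y z z₁' y₁') (h₂' : Crosses false (act A y₁'.1) x z₁' z₂' x₁')
    (h₃' : Crosses false A x₁' y₁' y₂' x₂') : z₂ = z₂' ∧ y₂ = y₂' ∧ x₂ = x₂' := by
  obtain ⟨x, a⟩ := x
  obtain ⟨y, b⟩ := y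
  obtain ⟨z, d⟩ := z
  obtain ⟨y₁, by₁⟩ := y₁
  obtain ⟨x₁, bx₁⟩ := x₁
  obtain ⟨z₁, bz₁⟩ := z₁
  obtain ⟨x₂, bx₂⟩ := x₂
  obtain ⟨z₂, bz₂⟩ := z₂
  obtain ⟨y₂, by₂⟩ := y₂
  obtain ⟨z₁', bz₁'⟩ := z₁'
  obtain ⟨y₁', by₁'⟩ := y₁'
  obtain ⟨z₂', bz₂'⟩ := z₂'
  obtain ⟨x₁', bx₁'⟩ := x₁'
  obtain ⟨y₂', by₂'⟩ := y₂'
  obtain ⟨x₂', bx₂'⟩ := x₂'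
  simp only [Crosses, op_true_iff, op_false_iff] at *
  obtain ⟨⟨rfl, rfl⟩, rfl, rfl⟩ := h₁
  obtain ⟨⟨rfl, rfl⟩, rfl, rfl⟩ := h₂
  obtain ⟨⟨rfl, rfl⟩, rfl, rfl⟩ := h₃
  obtain ⟨⟨rfl, rfl⟩, rfl, rfl⟩ := h₁'
  obtain ⟨⟨rfl, rfl⟩, rfl, rfl⟩ := h₂'
  obtain ⟨⟨rfl, rfl⟩, rfl, rfl⟩ := h₃'
  have hyb := VirtualBirack.yang_baxter_mixed (x, y, z)
  have e₁ := congrArg Prod.fst hyb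
  have e₂ := congrArg (fun p => p.2.1) hyb
  have e₃ := congrArg (fun p => p.2.2) hyb
  have r₁ := coeff_relation (IsRelator.mixed₁ A x y z)
  have r₂ := coeff_relation (IsRelator.mixed₂ A x y z)
  have r₃ := coeff_relation (IsRelator.mixed₃ A x y z)
  refine ⟨Prod.ext e₁ ?_, Prod.ext e₂ ?_, Prod.ext e₃ ?_⟩
  · simp only [smul_smul]
    congr 1
    exact Units.ext r₃.symm
  · simp only [smul_smul]
    congr 1
    exact Units.ext r₂.symm
  · simp only [smul_smul]
    congr 1
    have : leftCoeff false (act A (dn y z)) x (up z y) *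
        leftCoeff false A (vdn x (up z y)) (dn y z) =
        leftCoeff false (act A z) x y * leftCoeff false A (vdn x y) z := Units.ext r₁
    have h : ∀ (A : S) (x y : X), rightCoeff false A x y = (leftCoeff false A x y)⁻¹ :=
      fun _ _ _ => rfl
    simp only [h, ← mul_inv_rev]
    rw [this]

/-- The strands of `z`, `y` and `x` collect coefficients of the form `v v`, `v⁻¹ v` and `v⁻¹ v⁻¹`;
each of the three relations `v_three₁`, `v_three₂`, `v_three₃` settles one strand. -/
theorem yang_baxter_virtual
    (h₁ : Crosses false (act A z.1) x y y₁ x₁) (h₂ : Crosses false A x₁ z z₁ x₂)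
    (h₃ : Crosses false (act A x₂.1) y₁ z₁ z₂ y₂)
    (h₁' : Crosses false A y z z₁' y₁') (h₂' : Crosses false (act A y₁'.1) x z₁' z₂' x₁')
    (h₃' : Crosses false A x₁' y₁' y₂' x₂') : z₂ = z₂' ∧ y₂ = y₂' ∧ x₂ = x₂' := by
  obtain ⟨x, a⟩ := x
  obtain ⟨y, b⟩ := y
  obtain ⟨z, d⟩ := z
  obtain ⟨y₁, by₁⟩ := y₁
  obtain ⟨x₁, bx₁⟩ := x₁
  obtain ⟨z₁, bz₁⟩ := z₁
  obtain ⟨x₂, bx₂⟩ := x₂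
  obtain ⟨z₂, bz₂⟩ := z₂
  obtain ⟨y₂, by₂⟩ := y₂
  obtain ⟨z₁', bz₁'⟩ := z₁'
  obtain ⟨y₁', by₁'⟩ := y₁'
  obtain ⟨z₂', bz₂'⟩ := z₂'
  obtain ⟨x₁', bx₁'⟩ := x₁'
  obtain ⟨y₂', by₂'⟩ := y₂'
  obtain ⟨x₂', bx₂'⟩ := x₂'
  simp only [Crosses, op_false_iff] at *
  obtain ⟨⟨rfl, rfl⟩, rfl, rfl⟩ := h₁
  obtain ⟨⟨rfl, rfl⟩, rfl, rfl⟩ := h₂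
  obtain ⟨⟨rfl, rfl⟩, rfl, rfl⟩ := h₃
  obtain ⟨⟨rfl, rfl⟩, rfl, rfl⟩ := h₁'
  obtain ⟨⟨rfl, rfl⟩, rfl, rfl⟩ := h₂'
  obtain ⟨⟨rfl, rfl⟩, rfl, rfl⟩ := h₃'
  have hyb := VirtualBirack.yang_baxter_V (x, y, z)
  have e₁ := congrArg Prod.fst hyb
  have e₂ := congrArg (fun p => p.2.1) hyb
  have e₃ := congrArg (fun p => p.2.2) hyb
  have r₁ : leftCoeff false (act A (vdn y z)) x (vup z y) * leftCoeff false A y z =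
      leftCoeff false (act A (vdn (vdn x y) z)) (vup y x) (vup z (vdn x y)) *
        leftCoeff false A (vdn x y) z :=
    Units.ext (coeff_relation (IsRelator.v_three₁ A x y z))
  have r₂ : leftCoeff false (act A (vdn (vdn x y) z)) (vup y x) (vup z (vdn x y)) *
      leftCoeff false A (vdn x (vup z y)) (vdn y z) =
        leftCoeff false (act A z) x y * leftCoeff false A y z :=
    Units.ext (coeff_relation (IsRelator.v_three₂ A x y z))
  have r₃ : leftCoeff false (act A z) x y * leftCoeff false A (vdn x y) z =
      leftCoeff false (act A (vdn y z)) x (vup z y) *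
        leftCoeff false A (vdn x (vup z y)) (vdn y z) :=
    Units.ext (coeff_relation (IsRelator.v_three₃ A x y z))
  have h : ∀ (A : S) (x y : X), rightCoeff false A x y = (leftCoeff false A x y)⁻¹ :=
    fun _ _ _ => rfl
  refine ⟨Prod.ext e₁ ?_, Prod.ext e₂ ?_, Prod.ext e₃ ?_⟩
  · simp only [smul_smul]
    congr 1
    exact r₁.symm
  · simp only [smul_smul, h]
    congr 1
    rw [inv_mul_eq_iff_eq_mul, ← mul_assoc, eq_mul_inv_iff_mul_eq]
    exact r₂.symm
  · simp only [smul_smul, h, ← mul_inv_rev]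
    rw [r₃]

/-- The third Reidemeister move with the classical crossing of the first two strands. -/
theorem yang_baxter_mixed'
    (h₁ : Crosses true (act A z.1) x y y₁ x₁) (h₂ : Crosses false A x₁ z z₁ x₂)
    (h₃ : Crosses false (act A x₂.1) y₁ z₁ z₂ y₂)
    (h₁' : Crosses false A y z z₁' y₁') (h₂' : Crosses false (act A y₁'.1) x z₁' z₂' x₁')
    (h₃' : Crosses true A x₁' y₁' y₂' x₂') : z₂ = z₂' ∧ y₂ = y₂' ∧ x₂ = x₂' := by
  -- Virtual crossings can be read from top to bottom. Read this way, `h₂'` and `h₁'` carry the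
  -- strand of `z` from left to right, so `z` plays the first strand of `yang_baxter_mixed`, and the
  -- classical crossing is that of the other two.
  have k₁ := h₁'.symm_virt
  have k₂ := h₂'.symm_virt
  obtain ⟨u₃, u₄, g₁⟩ := exists_out (G := G) false (act A x₂'.1) z₂' y₂'
  obtain ⟨u₅, u₆, g₂⟩ := exists_out (G := G) false A u₄ x₂'
  obtain ⟨rfl, rfl, rfl⟩ := yang_baxter_mixed k₂ k₁ h₁ h₃' g₁ g₂
  obtain ⟨rfl, rfl⟩ := h₂.out_unique g₂.symm_virt
  obtain ⟨rfl, rfl⟩ := h₃.out_unique g₁.symm_virt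
  exact ⟨rfl, rfl, rfl⟩

/-- The third Reidemeister move for those triples of crossings in which at least the last two or
the first two crossings are of the same kind. -/
theorem yang_baxter {c₁ c₂ c₃ : Bool} (hc : c₁ = c₂ ∨ c₂ = c₃) (hc' : c₂ = true → c₁ = c₃)
    (h₁ : Crosses c₁ (act A z.1) x y y₁ x₁) (h₂ : Crosses c₂ A x₁ z z₁ x₂)
    (h₃ : Crosses c₃ (act A x₂.1) y₁ z₁ z₂ y₂)
    (h₁' : Crosses c₃ A y z z₁' y₁') (h₂' : Crosses c₂ (act A y₁'.1) x z₁' z₂' x₁')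
    (h₃' : Crosses c₁ A x₁' y₁' y₂' x₂') : z₂ = z₂' ∧ y₂ = y₂' ∧ x₂ = x₂' := by
  cases c₁ <;> cases c₂ <;> cases c₃ <;> simp at hc hc'
  · exact yang_baxter_virtual h₁ h₂ h₃ h₁' h₂' h₃'
  · exact yang_baxter_mixed h₁ h₂ h₃ h₁' h₂' h₃'
  · exact yang_baxter_mixed' h₁ h₂ h₃ h₁' h₂' h₃'
  · exact yang_baxter_classical h₁ h₂ h₃ h₁' h₂' h₃'

end Crosses

end YangBaxter

/-! ### Kinks and twist bars as operators on labels with beads -/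

section Kinks

variable {X : Type u} [TwistedVirtualBirack X] {S : Type v} [TwistedShadow X S]

open TwistedShadow (act)

open TwistedVirtualBirack (T)

open VirtualBirack (B V)

variable {G : Type w} [AddCommGroup G] [Module (ShadowAlgebra X S) G]

/-- The invertible element `kinkCoeff` of the twisted virtual shadow algebra. -/
noncomputable def kinkUnit (A : S) (x : X) : (ShadowAlgebra X S)ˣ :=
  leftCoeff true (actInv A (kinkLoop X x)) x (kinkLoop X x) *
    rightCoeff true (actInv A (kinkLoop X x)) x (kinkLoop X x)

/-- Sideways, `B (x, u) = (y, u)` says `(y, x) = side⁻¹ (u, u)`. The second component on the right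
is `α⁻¹ u`, whence `u = α x`, and then the first component is `π x`. -/
theorem op_kink_iff {x y u : X} :
    op X true (x, u) = (y, u) ↔ u = kinkLoop X x ∧ y = kink X x := by
  have h : ∀ u : X, kinkLoop X ((VirtualBirack.side (X := X)).symm (u, u)).2 = u := fun u =>
    (Equiv.ofBijective _ (VirtualBirack.diag_side_symm_snd (X := X))).symm_apply_apply u
  have h' : ∀ x : X, ((VirtualBirack.side (X := X)).symm (kinkLoop X x, kinkLoop X x)).2 = x :=
    fun x => (Equiv.ofBijective _ (VirtualBirack.diag_side_symm_snd (X := X))).apply_symm_apply x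
  have hk : ∀ x : X, kink X x =
    ((VirtualBirack.side (X := X)).symm (kinkLoop X x, kinkLoop X x)).1 := fun _ => rfl
  rw [op_iff_sideOp, ← Equiv.eq_symm_apply]
  change (y, x) = VirtualBirack.side.symm (u, u) ↔ _
  constructor
  · intro e
    have e2 := congrArg Prod.snd e
    have e1 := congrArg Prod.fst e
    simp only at e1 e2
    have hu : u = kinkLoop X x := by rw [e2, h]
    subst hu
    exact ⟨rfl, by rw [hk, ← e1]⟩
  · rintro ⟨rfl, rfl⟩
    exact Prod.ext rfl (h' x).symm

/-- The region rule at the crossing of a kink: both below and above the crossing, passing the loop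
leads to `A`, so `A · x` and `A · π x` are both the region on the far left. -/
theorem act_kink (A : S) (x : X) : act A (kink X x) = act A x := by
  have h := op_region true (actInv A (kinkLoop X x)) (op_kink_iff.2 ⟨rfl, rfl⟩ :
    op X true (x, kinkLoop X x) = _)
  simpa [act_actInv] using h.symm

/-- The effect of a positive kink on a strand with region `A` on its right. -/
noncomputable def kap (A : S) : Equiv.Perm (X × G) where
  toFun p := (kink X p.1, kinkUnit A p.1 • p.2)
  invFun p := ((kink X).symm p.1, (kinkUnit A ((kink X).symm p.1))⁻¹ • p.2)
  left_inv p := by simp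
  right_inv p := by simp

theorem act_kap_zpow (A A' : S) (z : ℤ) (p : X × G) : act A ((kap A' ^ z) p).1 = act A p.1 := by
  have h : ∀ p : X × G, act A (kap A' p).1 = act A p.1 := fun p => act_kink A p.1
  induction z using Int.induction_on with
  | zero => rfl
  | succ n ih =>
    rw [add_comm, zpow_add, zpow_one, Equiv.Perm.mul_apply, h, ih]
  | pred n ih =>
    rw [sub_eq_neg_add, zpow_add, zpow_neg_one, Equiv.Perm.mul_apply, ← ih, ← h]
    congr 2
    exact Equiv.apply_symm_apply _ _

theorem kap_pow_apply (A : S) (n : ℕ) (p : X × G) :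
    (kap A ^ n) p =
      ((kink X ^ n) p.1, (∏ k ∈ Finset.range n, kinkUnit A ((kink X ^ k) p.1)) • p.2) := by
  induction n with
  | zero => simp
  | succ n ih =>
    rw [pow_succ', Equiv.Perm.mul_apply, ih, Finset.prod_range_succ, pow_succ']
    refine Prod.ext rfl ?_
    change kinkUnit A ((kink X ^ n) p.1) • _ = _
    simp only [smul_smul]
    exact congrArg (· • p.2) (Units.ext (mul_comm _ _))

/-- On labels this is `π ^ N = 1`. On beads the coefficients along the orbit of `π` multiply to the
product in the phone cord relation. This is why writhes matter only modulo `N`. -/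
theorem kap_pow_birackRank (A : S) : (kap A : Equiv.Perm (X × G)) ^ birackRank X = 1 := by
  ext1 p
  rw [kap_pow_apply]
  refine Prod.ext ?_ ?_
  · simp only [birackRank, pow_orderOf_eq_one]
    rfl
  · have h := coeff_relation (IsRelator.phone_cord A p.1)
    have : (∏ k ∈ Finset.range (birackRank X), kinkUnit A ((kink X ^ k) p.1)) = 1 := by
      refine Units.ext ?_
      rw [Units.coe_prod, Units.val_one, ← map_one (Ideal.Quotient.mk _), h, map_prod]
      rfl
    simp only [this, one_smul]
    rfl

theorem kap_zpow_congr (A : S) {z z' : ℤ} (h : (birackRank X : ℤ) ∣ z - z') :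
    (kap A : Equiv.Perm (X × G)) ^ z = kap A ^ z' := by
  obtain ⟨m, hm⟩ := h
  rw [← sub_add_cancel z z', hm, zpow_add, zpow_mul, zpow_natCast, kap_pow_birackRank, one_zpow,
    one_mul]

theorem rightCoeff_virt (A : S) (x y : X) :
    rightCoeff false A x y = (leftCoeff false A x y)⁻¹ := rfl

namespace Crosses

variable {c : Bool} {A E F : S} {x y z u v s s' x' y' : X × G}

/-- A kink with the loop on the right. -/
theorem right_loop_iff : Crosses true (actInv A u.1) x u y u ↔
    y = kap A x ∧
      u = (kinkLoop X x.1, rightCoeff true (actInv A (kinkLoop X x.1)) x.1 (kinkLoop X x.1) • x.2) := by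
  constructor
  · rintro ⟨h1, h2, h3⟩
    obtain ⟨e1, e2⟩ := op_kink_iff.1 h1
    obtain ⟨u, b⟩ := u
    simp only at e1 h2 h3
    subst e1
    refine ⟨Prod.ext e2 ?_, Prod.ext rfl h3⟩
    rw [h2, h3, smul_smul]
    rfl
  · rintro ⟨rfl, rfl⟩
    refine ⟨op_kink_iff.2 ⟨rfl, rfl⟩, ?_, rfl⟩
    change kinkUnit A x.1 • x.2 = _
    rw [smul_smul]
    rfl

theorem exists_right_loop (A : S) (x : X × G) : ∃ u, Crosses true (actInv A u.1) x u (kap A x) u :=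
  ⟨_, right_loop_iff.2 ⟨rfl, rfl⟩⟩

theorem eq_kap_of_right_loop (h : Crosses true E x u y u) (hE : act E u.1 = A) : y = kap A x := by
  rw [← hE]
  exact (right_loop_iff.1 (by rwa [actInv_act])).1

theorem exists_left_loop_out (A : S) (y : X × G) : ∃ v x, Crosses true A v x v y := by
  obtain ⟨v, hv⟩ := (VirtualBirack.diag_side_fst (X := X)).2 y.1
  obtain ⟨b, hb⟩ : ∃ b : G, y.2 = rightCoeff true A v (sideOp X true (v, v)).2 • b :=
    ⟨(rightCoeff true A v (sideOp X true (v, v)).2)⁻¹ • y.2, by simp⟩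
  refine ⟨(v, b), ((sideOp X true (v, v)).2,
    (leftCoeff true A v (sideOp X true (v, v)).2)⁻¹ • b), op_of_sideOp _ ?_, ?_, hb⟩
  · exact Prod.ext hv rfl
  · simp

/-- The label `v` of the loop solves `side (v, v) = (y, x)`. For a given incoming label `x` it
exists because the second component of `side` on the diagonal is onto; for a given outgoing label,
as in `exists_left_loop_out`, because the first one is. -/
theorem exists_left_loop (A : S) (x : X × G) : ∃ v y, Crosses true A v x v y := by
  obtain ⟨v, hv⟩ := (VirtualBirack.diag_side_snd (X := X)).2 x.1
  refine ⟨(v, leftCoeff true A v x.1 • x.2), ((sideOp X true (v, v)).1, _),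
    op_of_sideOp _ ?_, rfl, rfl⟩
  exact Prod.ext rfl hv

theorem left_loop_unique {v' : X × G} (h : Crosses true A v x v y) (h' : Crosses true A v' x v' y') :
    v = v' ∧ y = y' := by
  have e : v.1 = v'.1 := by
    apply (VirtualBirack.diag_side_snd (X := X)).1
    have h1 := sideOp_apply _ h.1
    have h2 := sideOp_apply _ h'.1
    exact (congrArg Prod.snd h1).trans (congrArg Prod.snd h2).symm
  have e' : v = v' := Prod.ext e (by rw [h.2.1, h'.2.1, e])
  subst e'
  exact ⟨rfl, (h.out_unique h').2⟩

/-- A kink with the loop on the left. -/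
theorem eq_kap_of_left_loop (h : Crosses true A v x v y) : y = kap A x := by
  -- A right loop `u` leads from `x` to `kap A x`, and a left loop `v'` leads from some `z` to the
  -- same output. The aim is `z = x`, by one third Reidemeister move on auxiliary strands `x'`, `s`,
  -- `t` that pass through both loops.
  obtain ⟨u, hu⟩ := exists_right_loop A x
  obtain ⟨v', z, hv⟩ := exists_left_loop_out A (kap A x)
  have hE := act_actInv A u.1
  set E := actInv A u.1
  obtain ⟨x', w, h₂'⟩ := exists_in true A v' x
  obtain ⟨s, t, h₁'⟩ := exists_in true E w u
  obtain ⟨m, n, h₁⟩ := exists_out true (act E t.1) x' s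
  obtain ⟨k, j, h₂⟩ := exists_out true E n t
  obtain ⟨a, b, h₃⟩ := exists_out true (act E j.1) m k
  -- The primed side ends with the crossing of the right loop. Hence the last crossing of the other
  -- side has the outputs `v'` and `kap A x` of the left loop, and so its inputs are `v'` and `z`.
  obtain ⟨ha, hb, hj⟩ := yang_baxter (.inl rfl) (fun _ => rfl) h₁ h₂ h₃ h₁' (hE.symm ▸ h₂') hu
  rw [ha, hb, hj, hE] at h₃
  rw [hj] at h₂
  obtain ⟨hm, hk⟩ := h₃.in_unique hv
  rw [hm] at h₁
  rw [hk] at h₂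
  -- Uniqueness from the left ends `x'`, `v'`, and below from the right ends `t`, `u`, yields `x =
  -- w` and `z = w`.
  obtain ⟨hs, hn, -⟩ := h₁.left_unique h₂' (by rw [h₁'.region, hE])
  rw [hn] at h₂
  rw [hs] at h₁'
  obtain ⟨e₁, e₂⟩ := h₂.right_unique h₁'
  rw [e₂, ← e₁] at hv
  exact (h.left_loop_unique hv).2

theorem left_loop_kap (A : S) (x : X × G) : ∃ v, Crosses true A v x v (kap A x) := by
  obtain ⟨v, y, h⟩ := exists_left_loop A x
  exact ⟨v, h.eq_kap_of_left_loop ▸ h⟩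

/-- A strand with a kink passes through a crossing towards the right. -/
theorem kap_left (h : Crosses c A x s s' x') :
    Crosses c A (kap (act A s.1) x) s s' (kap A x') := by
  obtain ⟨u, hu⟩ := exists_right_loop (act A s.1) x
  -- Let the transversal strand cross the loop too: it enters as `w`, leaves the loop `u` as `s`,
  -- and the loop continues as `u'`. The third move pulls it across the crossing of the kink; on the
  -- other side, `x'` meets a loop that carries `u'` at both ends.
  obtain ⟨E, w, u', h₂, hF⟩ := exists_left c (act A s.1) u s
  have hE : act E u'.1 = A := act_injective s.1 (by rw [← h₂.region, hF])
  have hE' : actInv (act A s.1) u.1 = act E w.1 := act_injective u.1 (by rw [act_actInv, hF])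
  rw [hE'] at hu
  obtain ⟨z, y, h₃⟩ := exists_out c (act E u'.1) (kap (act A s.1) x) s
  obtain ⟨y', x'', h₃'⟩ := exists_out true E x' u'
  obtain ⟨e₁, e₂, e₃⟩ := yang_baxter (by cases c <;> simp) (by cases c <;> simp) hu h₂ h₃ h₂
    (hE.symm ▸ h) h₃'
  rw [← e₃] at h₃'
  rw [hE, e₁, e₂, h₃'.eq_kap_of_right_loop hE] at h₃
  exact h₃

/-- A strand with a kink passes through a crossing towards the left. -/
theorem kap_right (h : Crosses c A s x x' s') :
    Crosses c A s (kap A x) (kap (act A s'.1) x') s' := by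
  obtain ⟨u, hu⟩ := exists_right_loop A x
  have hE := act_actInv A u.1
  set E := actInv A u.1
  obtain ⟨u', s'', h₂⟩ := exists_out c E s' u
  obtain ⟨p, q, h₃⟩ := exists_out true (act E s''.1) x' u'
  obtain ⟨p', k, h₂'⟩ := exists_out c A s (kap A x)
  obtain ⟨q', r, h₃'⟩ := exists_out c E k u
  obtain ⟨e₁, e₂, e₃⟩ := yang_baxter (by cases c <;> simp) (by cases c <;> simp) (hE.symm ▸ h) h₂ h₃
    hu (show Crosses c (act E u.1) s (kap A x) p' k by rw [hE]; exact h₂') h₃'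
  rw [← e₃] at h₃'
  -- The transversal strand crosses the loop on both sides of the move with the same right ends `u`
  -- and `s''`. So the rest agrees as well, and the loop closes up with label `u'`.
  obtain ⟨e₄, e₅⟩ := h₂.right_unique h₃'
  rw [e₂, ← e₅] at h₃
  rw [← e₄, ← e₁, h₃.eq_kap_of_right_loop (by rw [← h₂.region, hE])] at h₂'
  exact h₂'

/-- For the converse, cross with `x` first and slide the kink: the outputs are unique and `kap A` is
injective. -/
theorem kap_left_iff :
    Crosses c A x s s' x' ↔ Crosses c A (kap (act A s.1) x) s s' (kap A x') := by
  refine ⟨kap_left, fun h => ?_⟩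
  obtain ⟨t, y, h2⟩ := exists_out c A x s
  obtain ⟨e₁, e₂⟩ := h2.kap_left.out_unique h
  rw [e₁, (kap A).injective e₂] at h2
  exact h2

theorem kap_right_iff :
    Crosses c A s x x' s' ↔ Crosses c A s (kap A x) (kap (act A s'.1) x') s' := by
  refine ⟨kap_right, fun h => ?_⟩
  obtain ⟨t, y, h2⟩ := exists_out c A s x
  obtain ⟨e₁, e₂⟩ := h2.kap_right.out_unique h
  rw [e₂] at e₁ h2
  rw [(kap _).injective e₁] at h2
  exact h2

end Crosses

/-- A relation that is preserved by two permutations is preserved by their powers. -/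
theorem rel_zpow_iff {α β : Type*} {R : α → β → Prop} (f : Equiv.Perm α) (g : Equiv.Perm β)
    (h : ∀ a b, R a b ↔ R (f a) (g b)) (z : ℤ) (a : α) (b : β) :
    R a b ↔ R ((f ^ z) a) ((g ^ z) b) := by
  induction z using Int.induction_on generalizing a b with
  | zero => rfl
  | succ n ih => rw [h, ih, zpow_add_one, zpow_add_one]; rfl
  | pred n ih =>
    rw [zpow_sub_one, zpow_sub_one, Equiv.Perm.mul_apply, Equiv.Perm.mul_apply, ← ih, h (f⁻¹ a),
      show f (f⁻¹ a) = a from f.apply_symm_apply a, show g (g⁻¹ b) = b from g.apply_symm_apply b]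

namespace Crosses

variable {c : Bool} {A E F Z : S} {x y z u v s s' x' y' m n m₂ n₂ p₁ p₂ q₁ q₂ : X × G}

theorem kap_left_zpow (z : ℤ) : Crosses c A x s s' x' ↔
    Crosses c A ((kap (act A s.1) ^ z) x) s s' ((kap A ^ z) x') :=
  rel_zpow_iff (R := fun x x' => Crosses c A x s s' x') _ _ (fun _ _ => kap_left_iff) z x x'

theorem kap_right_zpow (z : ℤ) : Crosses c A s x x' s' ↔
    Crosses c A s ((kap A ^ z) x) ((kap (act A s'.1) ^ z) x') s' :=
  rel_zpow_iff (R := fun x x' => Crosses c A s x x' s') _ _ (fun _ _ => kap_right_iff) z x x'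

/-- A virtual kink with the loop on the right. -/
theorem eq_of_virt_right_loop (h : Crosses false A x u y u) : x = y := by
  refine Prod.ext ?_ ?_
  · have h1 := sideOp_apply _ h.1
    have h2 := sideOp_apply _ h.symm_virt.1
    exact (Prod.ext_iff.1 ((sideOp X false).injective (h2.trans h1.symm))).1
  · rw [h.2.1, h.2.2]
    change _ = leftCoeff false A x.1 u.1 • (leftCoeff false A x.1 u.1)⁻¹ • x.2
    simp

/-- A virtual kink with the loop on the left. -/
theorem eq_of_virt_left_loop (h : Crosses false A u x u y) : x = y := by
  refine Prod.ext ?_ ?_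
  · have h1 := sideOp_apply _ h.1
    have h2 : (sideOp X false (u.1, u.1)).1 = (sideOp X false (u.1, u.1)).2 :=
      VirtualBirack.vside_diag u.1
    rw [h1] at h2
    exact h2.symm
  · rw [h.2.2, h.2.1]
    change _ = (leftCoeff false A u.1 x.1)⁻¹ • leftCoeff false A u.1 x.1 • x.2
    simp

/-- The region to the right of the crossing depends on the label of the loop, which is only found in
the proof; hence the function `f`, which is `actInv A` for a loop to the right of a strand. -/
theorem exists_virt_right_loop (f : X → S) (x : X × G) : ∃ u, Crosses false (f u.1) x u x u := by
  have h : (sideOp X false (x.1, x.1)).1 = (sideOp X false (x.1, x.1)).2 :=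
    VirtualBirack.vside_diag x.1
  refine ⟨((sideOp X false (x.1, x.1)).1, rightCoeff false (f _) x.1 _ • x.2),
    op_of_sideOp _ (Prod.ext rfl h.symm), ?_, rfl⟩
  change _ = leftCoeff false _ _ _ • (leftCoeff false _ _ _)⁻¹ • x.2
  simp

/-- A preimage `(p, q)` of `(x, x)` under the sideways map gives `V (q, x) = (p, x)`. As `V` is an
involution, `(q, p)` is a preimage too, and `p = q`. -/
theorem exists_virt_left_loop (A : S) (x : X × G) : ∃ u, Crosses false A u x u x := by
  obtain ⟨⟨p, q⟩, h⟩ := (sideOp X false).surjective (x.1, x.1)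
  have h1 := op_of_sideOp _ h
  have h2 : op X false (p, x.1) = (q, x.1) := by
    rw [← h1]
    exact VirtualBirack.V_V _
  have h3 := (sideOp_apply _ h2).trans h.symm
  have h4 := (sideOp X false).injective h3
  obtain rfl : p = q := (congrArg Prod.fst h4).symm
  refine ⟨(p, leftCoeff false A p x.1 • x.2), h1, rfl, ?_⟩
  change _ = (leftCoeff false A p x.1)⁻¹ • leftCoeff false A p x.1 • x.2
  simp

theorem virt_right_loop_unique {f : X → S} {u' : X × G} (h : Crosses false (f u.1) x u y u)
    (h' : Crosses false (f u'.1) x u' y' u') : u = u' := by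
  have e := h.eq_of_virt_right_loop
  have e' := h'.eq_of_virt_right_loop
  subst e e'
  have h1 := (sideOp_apply _ h.1).symm.trans (sideOp_apply _ h'.1)
  have e : u.1 = u'.1 := (Prod.ext_iff.1 h1).1
  exact Prod.ext e (by rw [h.2.2, h'.2.2, e])

theorem virt_left_loop_unique {u' : X × G} (h : Crosses false A u x u y)
    (h' : Crosses false A u' x u' y') : u = u' := by
  have e := h.eq_of_virt_left_loop
  have e' := h'.eq_of_virt_left_loop
  subst e e'
  have h1 := (sideOp_apply _ h.1).trans (sideOp_apply _ h'.1).symm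
  have e : u.1 = u'.1 := (Prod.ext_iff.1 ((sideOp X false).injective h1)).1
  exact Prod.ext e (by rw [h.2.1, h'.2.1, e])

/-- A classical crossing between two virtual crossings next to it, on its left and right, is the
same as a classical crossing between virtual crossings below and above it. -/
theorem flank (h₁ : Crosses false Z x q₂ y' p₂) (h₂ : Crosses false E q₁ y p₁ x')
    (h₃ : Crosses true Z p₁ p₂ q₁ q₂) (hb : act Z q₂.1 = act E y.1) (ht : act Z p₂.1 = act E x'.1) :
    ∃ m n m₂ n₂, Crosses false E x y m n ∧ Crosses true E m n m₂ n₂ ∧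
      Crosses false E m₂ n₂ y' x' := by
  -- The auxiliary labels `c` and `P` complete `h₁`, read from top to bottom, to one side of a mixed
  -- third move whose other side begins with `h₃`. The last crossing `k₅` of that side turns out to
  -- be a virtual right loop and can be dropped.
  obtain ⟨c, P, k₁⟩ := exists_right false (act Z p₂.1) p₁ y'
  have k₂ := h₁.symm_virt
  obtain ⟨Q₁, Q₂, k₃⟩ := exists_out true (act Z q₂.1) P x
  obtain ⟨r₁, r₂, k₄⟩ := exists_out false (act Z q₂.1) c q₁
  obtain ⟨r₃, r₄, k₅⟩ := exists_out false Z r₂ q₂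
  obtain ⟨e₁, e₂, e₃⟩ := yang_baxter (.inl rfl) (by simp) k₁ k₂ k₃ h₃ k₄ k₅
  rw [← e₃] at k₅
  rw [← e₁, k₅.eq_of_virt_right_loop, ← e₂, hb] at k₄
  rw [ht] at k₁
  rw [hb] at k₃
  -- A virtual third move on the strands `Q₁`, `Q₂`, `y` produces the upper virtual crossing `l₃`
  -- with outputs `y'` and `x'`.
  obtain ⟨e, f, l₁⟩ := exists_out false E Q₂ y
  obtain ⟨P', g, l₂⟩ := exists_out false (act E f.1) Q₁ e
  obtain ⟨y'', x'', l₃⟩ := exists_out false E g f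
  obtain ⟨e₄, e₅, e₆⟩ := yang_baxter (.inl rfl) (by simp) k₄.symm_virt h₂ k₁ l₁ l₂ l₃
  rw [← e₄] at l₂
  rw [← e₅, ← e₆] at l₃
  -- A second mixed third move, on `P`, `x`, `y`, produces the lower virtual crossing `o₁`. The
  -- label `P` returns to itself, so `o₂` is a virtual left loop and can be dropped; the classical
  -- crossing `o₃` remains in the middle.
  obtain ⟨m, n, o₁⟩ := exists_out false E x y
  obtain ⟨h, i, o₂⟩ := exists_out false (act E n.1) P m
  obtain ⟨j, k, o₃⟩ := exists_out true E i n
  obtain ⟨e₇, e₈, e₉⟩ := yang_baxter (.inr rfl) (by simp) k₃ l₁ l₂ o₁ o₂ o₃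
  rw [← e₇] at o₂
  rw [← e₈, ← e₉, ← o₂.eq_of_virt_left_loop] at o₃
  exact ⟨m, n, g, f, o₁, o₃, l₃⟩

end Crosses

/-- The effect of a twist bar on a strand with region `A` on its right. -/
noncomputable def tau (A : S) (p : X × G) : X × G := (T p.1, barCoeff A p.1 • p.2)

theorem barCoeff_inv (A : S) (x : X) : (barCoeff A x)⁻¹ = barCoeff A (T x) := Units.ext rfl

theorem tau_tau (A : S) (p : X × G) : tau A (tau A p) = p := by
  refine Prod.ext (TwistedVirtualBirack.T_T _) ?_
  change barCoeff A (T p.1) • barCoeff A p.1 • p.2 = p.2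
  rw [← barCoeff_inv, inv_smul_smul]

theorem act_tau (A A' : S) (p : X × G) : act A (tau A' p).1 = act A p.1 :=
  TwistedShadow.act_T A p.1

namespace Crosses

variable {c : Bool} {A E F Z : S} {x y z u v s s' x' y' m n m₂ n₂ p₁ p₂ q₁ q₂ : X × G}

theorem tau_left (h : Crosses false A x y y' x') :
    Crosses false A (tau (act A y.1) x) y y' (tau A x') := by
  obtain ⟨x, a⟩ := x
  obtain ⟨y, b⟩ := y
  obtain ⟨y', b'⟩ := y'
  obtain ⟨x', a'⟩ := x'
  obtain ⟨h1, rfl, rfl⟩ := h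
  have e₁ : leftCoeff false A (T x) y = leftCoeff false A x y :=
    Units.ext (coeff_relation (IsRelator.v_T_left A x y))
  have e₂ : barCoeff (act A y) x * leftCoeff false A x y =
      leftCoeff false A (T x) y * barCoeff A (vdn x y) :=
    Units.ext (coeff_relation (IsRelator.v_q_left A x y))
  obtain ⟨rfl, rfl⟩ := op_false_iff.1 h1
  refine ⟨(TwistedVirtualBirack.T_V_right x y).symm, ?_, ?_⟩
  · simp [tau, e₁]
  · simp only [tau, smul_smul]
    congr 1
    change _ * (leftCoeff false A x y)⁻¹ = (leftCoeff false A (T x) y)⁻¹ * _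
    rw [mul_inv_eq_iff_eq_mul, mul_assoc, e₂, inv_mul_cancel_left]

theorem tau_right (h : Crosses false A x y y' x') :
    Crosses false A x (tau A y) (tau (act A x'.1) y') x' := by
  obtain ⟨x, a⟩ := x
  obtain ⟨y, b⟩ := y
  obtain ⟨y', b'⟩ := y'
  obtain ⟨x', a'⟩ := x'
  obtain ⟨h1, rfl, rfl⟩ := h
  have e₁ : leftCoeff false A x (T y) = leftCoeff false A x y :=
    Units.ext (coeff_relation (IsRelator.v_T_right A x y))
  have e₂ : leftCoeff false A x (T y) * barCoeff A y =
      barCoeff (act A (vdn x y)) (vup y x) * leftCoeff false A x y :=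
    Units.ext (coeff_relation (IsRelator.v_q_right A x y))
  obtain ⟨rfl, rfl⟩ := op_false_iff.1 h1
  refine ⟨(TwistedVirtualBirack.T_V_left x y).symm, ?_, ?_⟩
  · simp only [tau, smul_smul]
    rw [e₂]
  · change _ = (leftCoeff false A x (T y))⁻¹ • _
    rw [e₁]
    rfl

/-- The labels obey the axiom `(T × T) B (T × T) = V B V`, the beads of the two strands the
relations `twist₂` and `twist₁`. The bars at the upper ends have changed sides in these equations,
which is possible because a bar is its own inverse. -/
theorem tau_of_virt (h₁ : Crosses false A x y m n) (h₂ : Crosses true A m n m₂ n₂)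
    (h₃ : Crosses false A m₂ n₂ y' x') :
    Crosses true A (tau (act A y.1) x) (tau A y) (tau (act A x'.1) y') (tau A x') := by
  obtain ⟨x, a⟩ := x
  obtain ⟨y, b⟩ := y
  obtain ⟨y', b'⟩ := y'
  obtain ⟨x', a'⟩ := x'
  obtain ⟨m, d⟩ := m
  obtain ⟨n, d'⟩ := n
  obtain ⟨m₂, e⟩ := m₂
  obtain ⟨n₂, e'⟩ := n₂
  obtain ⟨g₁, rfl, rfl⟩ := h₁
  obtain ⟨g₂, rfl, rfl⟩ := h₂
  obtain ⟨g₃, rfl, rfl⟩ := h₃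
  have hT := TwistedVirtualBirack.T_B x y
  obtain ⟨rfl, rfl⟩ := op_false_iff.1 g₁
  obtain ⟨rfl, rfl⟩ := op_true_iff.1 g₂
  have hT1 : T (up (T y) (T x)) = y' := congrArg Prod.fst (hT.trans g₃)
  have hT2 : T (dn (T x) (T y)) = x' := congrArg Prod.snd (hT.trans g₃)
  have e₁ : leftCoeff false A (up (vdn x y) (vup y x)) (dn (vup y x) (vdn x y)) *
      barCoeff A (dn (T x) (T y)) * rightCoeff true A (T x) (T y) * barCoeff (act A y) x *
        leftCoeff false A x y = leftCoeff true A (vup y x) (vdn x y) :=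
    Units.ext (coeff_relation (IsRelator.twist₁ A x y))
  have e₂ : barCoeff (act A (dn (T x) (T y))) (up (T y) (T x)) * leftCoeff true A (T x) (T y) *
      barCoeff A y = leftCoeff false A (up (vdn x y) (vup y x)) (dn (vup y x) (vdn x y)) *
        rightCoeff true A (vup y x) (vdn x y) * leftCoeff false A x y :=
    Units.ext (coeff_relation (IsRelator.twist₂ A x y))
  subst hT1 hT2
  refine ⟨?_, ?_, ?_⟩
  · simp only [tau, TwistedVirtualBirack.T_T]
    rfl
  · simp only [tau, smul_smul]
    congr 1
    rw [TwistedShadow.act_T, ← barCoeff_inv]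
    refine mul_left_cancel (a := barCoeff (act A (dn (T x) (T y))) (up (T y) (T x))) ?_
    simpa only [mul_assoc, mul_inv_cancel_left] using e₂.symm
  · simp only [tau, smul_smul]
    congr 1
    rw [← barCoeff_inv, ← e₁]
    rw [rightCoeff_virt, rightCoeff_virt]
    group

end Crosses

/-- Put the kink behind the bar and apply the twisted move to its crossing. The bars on the loop
cancel, and the crossing now lies between two virtual ones. A mixed third move with an auxiliary
strand `p` turns these into virtual loops; what remains is a kink with its loop on the left, which
also acts as `kap A`. -/
theorem kap_tau (A : S) (x : X × G) : kap A (tau A x) = tau A (kap A x) := by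
  obtain ⟨u, hu⟩ := Crosses.exists_right_loop A (tau A x)
  have hE := act_actInv A u.1
  set E := actInv A u.1
  obtain ⟨m, n, h₁⟩ := Crosses.exists_out false E x (tau E u)
  obtain ⟨m₂, n₂, h₂⟩ := Crosses.exists_out true E m n
  obtain ⟨y', x', h₃⟩ := Crosses.exists_out false E m₂ n₂
  have h := Crosses.tau_of_virt h₁ h₂ h₃
  rw [act_tau, hE, tau_tau] at h
  obtain ⟨e₁, e₂⟩ := h.out_unique hu
  obtain rfl : x' = tau E u := by rw [← e₂, tau_tau]
  rw [act_tau, hE] at e₁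
  rw [← e₁]
  congr 1
  -- The virtual left loop `p` is added only to have three strands for the third move.
  obtain ⟨p, hp⟩ := Crosses.exists_virt_left_loop (act E n.1) m
  obtain ⟨q₁, q₂, k₁⟩ := Crosses.exists_out true (act E (tau E u).1) p x
  obtain ⟨e, f, k₂⟩ := Crosses.exists_out false E q₂ (tau E u)
  obtain ⟨g, h, k₃⟩ := Crosses.exists_out false (act E f.1) q₁ e
  obtain ⟨e₄, e₅, e₆⟩ := Crosses.yang_baxter (.inr rfl) (by simp) k₁ k₂ k₃ h₁ hp h₂
  rw [e₆] at k₂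
  obtain ⟨e₇, e₈⟩ := k₂.right_unique h₃.symm_virt
  rw [e₄, e₅, e₈] at k₃
  rw [k₃.eq_of_virt_right_loop, e₇, act_tau, hE] at k₁
  exact k₁.eq_kap_of_left_loop

theorem kap_tau_zpow (A : S) (z : ℤ) (x : X × G) :
    (kap A ^ z) (tau A x) = tau A ((kap A ^ z) x) :=
  (rel_zpow_iff (R := fun a b => a = tau A b) (kap A) (kap A) (fun a b => by
    rw [← kap_tau, (kap A).injective.eq_iff]) z (tau A x) x).1 rfl

end Kinks

/-! ### Crossings of strands in arbitrary directions -/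

section Oriented

variable {X : Type u} [TwistedVirtualBirack X] {S : Type v} [TwistedShadow X S]

open TwistedShadow (act)

variable {G : Type w}

/-- The region to the right of a strand that is directed upward (`o = true`) or downward, where `A`
is the region on its left. -/
noncomputable def across (o : Bool) (A : S) (p : X × G) : S :=
  match o with
  | true => actInv A p.1
  | false => act A p.1

@[simp] theorem across_true (A : S) (p : X × G) : across true A p = actInv A p.1 := rfl

@[simp] theorem across_false (A : S) (p : X × G) : across false A p = act A p.1 := rfl

@[simp] theorem act_actInv' (A : S) (x : X) : act (actInv A x) x = A := act_actInv A x

@[simp] theorem actInv_act' (A : S) (x : X) : actInv (act A x) x = A := actInv_act A x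

@[simp] theorem across_not (o : Bool) (A : S) (p : X × G) :
    across (!o) (across o A p) p = A := by
  cases o <;> simp

@[simp] theorem across_across_not (o : Bool) (A : S) (p : X × G) :
    across o (across (!o) A p) p = A := by
  cases o <;> simp

theorem eq_across_iff (o : Bool) {A A' : S} {p : X × G} :
    A' = across o A p ↔ across (!o) A' p = A := by
  constructor
  · rintro rfl
    simp
  · rintro rfl
    simp

variable [AddCommGroup G] [Module (ShadowAlgebra X S) G]

/-- The relation between the labels with beads at the incoming left, incoming right, outgoing left
and outgoing right strand of a crossing with region `E` to the right of both strands. -/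
def TypeRule (τ : CrossType) (E : S) (a b c d : X × G) : Prop :=
  match τ with
  | .pos => Crosses true E a b c d
  | .neg => Crosses true E c d a b
  | .virt => Crosses false E a b c d

/-- The type of a crossing in which the incoming and outgoing strands are exchanged. -/
def CrossType.flip : CrossType → CrossType
  | .pos => .neg
  | .neg => .pos
  | .virt => .virt

namespace TypeRule

variable {τ : CrossType} {E E' F L : S} {a b c d a' b' c' d' : X × G}

theorem region (h : TypeRule τ E a b c d) : act (act E b.1) a.1 = act (act E d.1) c.1 := by
  cases τ
  · exact Crosses.region h
  · exact (Crosses.region h).symm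
  · exact Crosses.region h

theorem flip (h : TypeRule τ E a b c d) : TypeRule τ.flip E c d a b := by
  cases τ
  · exact h
  · exact h
  · exact Crosses.symm_virt h

theorem exists_out (τ : CrossType) (E : S) (a b : X × G) : ∃ c d, TypeRule τ E a b c d := by
  cases τ
  · exact Crosses.exists_out _ _ _ _
  · exact Crosses.exists_in _ _ _ _
  · exact Crosses.exists_out _ _ _ _

theorem exists_in (τ : CrossType) (E : S) (c d : X × G) : ∃ a b, TypeRule τ E a b c d := by
  cases τ
  · exact Crosses.exists_in _ _ _ _
  · exact Crosses.exists_out _ _ _ _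
  · exact Crosses.exists_in _ _ _ _

theorem exists_right (τ : CrossType) (E : S) (b d : X × G) : ∃ a c, TypeRule τ E a b c d := by
  cases τ
  · exact Crosses.exists_right _ _ _ _
  · obtain ⟨c, a, h⟩ := Crosses.exists_right true E d b
    exact ⟨a, c, h⟩
  · exact Crosses.exists_right _ _ _ _

theorem exists_left (τ : CrossType) (F : S) (a c : X × G) :
    ∃ E b d, TypeRule τ E a b c d ∧ act (act E b.1) a.1 = F := by
  cases τ
  · exact Crosses.exists_left _ _ _ _
  · obtain ⟨E, d, b, h, hF⟩ := Crosses.exists_left true F c a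
    exact ⟨E, b, d, h, h.region ▸ hF⟩
  · exact Crosses.exists_left _ _ _ _

theorem out_unique (h : TypeRule τ E a b c d) (h' : TypeRule τ E a b c' d') : c = c' ∧ d = d' := by
  cases τ
  · exact Crosses.out_unique h h'
  · exact Crosses.in_unique h h'
  · exact Crosses.out_unique h h'

theorem in_unique (h : TypeRule τ E a b c d) (h' : TypeRule τ E a' b' c d) : a = a' ∧ b = b' := by
  cases τ
  · exact Crosses.in_unique h h'
  · exact Crosses.out_unique h h'
  · exact Crosses.in_unique h h'

theorem right_unique (h : TypeRule τ E a b c d) (h' : TypeRule τ E a' b c' d) :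
    a = a' ∧ c = c' := by
  cases τ
  · exact Crosses.right_unique h h'
  · exact (Crosses.right_unique h h').symm
  · exact Crosses.right_unique h h'

theorem left_unique (h : TypeRule τ E a b c d) (h' : TypeRule τ E' a b' c d')
    (hF : act (act E b.1) a.1 = act (act E' b'.1) a.1) : b = b' ∧ d = d' := by
  have hr := h.region
  have hr' := h'.region
  cases τ
  · obtain ⟨h1, h2, -⟩ := Crosses.left_unique h h' hF
    exact ⟨h1, h2⟩
  · obtain ⟨h1, h2, -⟩ := Crosses.left_unique h h' (by rw [← hr, ← hr', hF])
    exact ⟨h2, h1⟩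
  · obtain ⟨h1, h2, -⟩ := Crosses.left_unique h h' hF
    exact ⟨h1, h2⟩

end TypeRule

/-- The rule for a crossing of oriented strands that is drawn with `p`, `q` at the bottom and `p'`,
`q'` at the top, for its region to the right of both strands. -/
def TurnedRule (τ : CrossType) (oa ob : Bool) (L : S) (p q p' q' : X × G) : Prop :=
  match oa, ob with
  | true, true => TypeRule τ (across true (across true L p) q) p q p' q'
  | false, false => TypeRule τ L q' p' q p
  | true, false => TypeRule τ (across true L p) p' p q' q
  | false, true => TypeRule τ (across true L p') q q' p p'

/-- The relation between the labels with beads at the bottom left, bottom right, top left and top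
right of a crossing with region `L` on the left. -/
def CrossRel (k : CrossKind) (oa ob : Bool) (L : S) (p q p' q' : X × G) : Prop :=
  across ob (across oa L p) q = across oa (across ob L p') q' ∧
    TurnedRule (k.type oa ob) oa ob L p q p' q'

theorem TurnedRule.region {τ : CrossType} {oa ob : Bool} {L : S} {p q p' q' : X × G}
    (h : TurnedRule τ oa ob L p q p' q') :
    across ob (across oa L p) q = across oa (across ob L p') q' := by
  cases oa <;> cases ob <;> have hr := TypeRule.region h <;> simp at hr ⊢
  · exact hr.symm
  · rw [← hr]
    simp
  · rw [hr]
    simp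
  · conv_rhs => rw [hr]
    simp

namespace CrossRel

variable {k : CrossKind} {oa ob : Bool} {L : S} {p q p' q' p₂ q₂ : X × G}

theorem of_turned (h : TurnedRule (k.type oa ob) oa ob L p q p' q') :
    CrossRel k oa ob L p q p' q' := ⟨h.region, h⟩

/-- When the crossing is turned such that both strands go upward, its bottom ends become the
outgoing, left, right or incoming ends, in the order of the four cases. So all four ways of solving
a crossing are needed. -/
theorem exists_top (k : CrossKind) (oa ob : Bool) (L : S) (p q : X × G) :
    ∃ p' q', CrossRel k oa ob L p q p' q' := by
  suffices ∃ p' q', TurnedRule (k.type oa ob) oa ob L p q p' q' by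
    obtain ⟨p', q', h⟩ := this
    exact ⟨p', q', of_turned h⟩
  cases oa <;> cases ob
  · obtain ⟨a, b, h⟩ := TypeRule.exists_in (k.type false false) L q p
    exact ⟨b, a, h⟩
  -- The region on the far left of the turned crossing is the one below it in the drawing, which is
  -- `L · p` because the strand of `p` goes down.
  · obtain ⟨E, b, d, h, hF⟩ := TypeRule.exists_left (k.type false true) (act L p.1) q p
    have hE : act E d.1 = L := act_injective p.1 (by rw [← h.region, hF])
    refine ⟨d, b, ?_⟩
    simp only [TurnedRule, ← hE, across_true, actInv_act]
    exact h
  · obtain ⟨a, c, h⟩ := TypeRule.exists_right (k.type true false) (across true L p) p q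
    exact ⟨a, c, h⟩
  · exact TypeRule.exists_out _ _ _ _

theorem top_unique (h : CrossRel k oa ob L p q p' q') (h' : CrossRel k oa ob L p q p₂ q₂) :
    p' = p₂ ∧ q' = q₂ := by
  have h1 := h.2
  have h2 := h'.2
  cases oa <;> cases ob
  · exact (TypeRule.in_unique h1 h2).symm
  · have e1 := TypeRule.region h1
    have e2 := TypeRule.region h2
    simp only [across_true, act_actInv] at e1 e2
    exact (TypeRule.left_unique h1 h2 (by simp [e1, e2])).symm
  · exact TypeRule.right_unique h1 h2
  · exact TypeRule.out_unique h1 h2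

theorem _root_.TwistedVirtual.CrossKind.type_swap (k : CrossKind) (a b : Bool) :
    k.swap.type a b = (k.type a b).flip := by
  cases k <;> cases a <;> cases b <;> rfl

theorem _root_.TwistedVirtual.CrossKind.type_comm (k : CrossKind) (a b : Bool) :
    k.type a b = k.type b a := by
  cases k <;> cases a <;> cases b <;> rfl

theorem _root_.TwistedVirtual.CrossKind.type_rot (k : CrossKind) (a b : Bool) :
    k.swap.type b (!a) = k.type a b := by
  cases k <;> cases a <;> cases b <;> rfl

theorem _root_.TwistedVirtual.CrossKind.swap_swap (k : CrossKind) : k.swap.swap = k := by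
  cases k <;> rfl

/-- This is the crossing that cancels the given one in the second Reidemeister move. On the turned
crossing it exchanges incoming and outgoing ends and the sign. It transfers every statement about
tops to bottoms. -/
theorem conv (h : CrossRel k oa ob L p q p' q') : CrossRel k.swap ob oa L p' q' p q := by
  obtain ⟨hr, h⟩ := h
  refine ⟨hr.symm, ?_⟩
  unfold TurnedRule at h ⊢
  rw [CrossKind.type_swap, CrossKind.type_comm]
  cases oa <;> cases ob
  · exact TypeRule.flip h
  · exact TypeRule.flip h
  · exact TypeRule.flip h
  · simp only [across_true, across_true] at hr ⊢
    rw [← hr]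
    exact TypeRule.flip h

/-- A clockwise quarter turn: the end `q` moves to the bottom left, and the region below the
crossing becomes the one on its left. The strand of `p` is now drawn in the opposite direction, so
the type of the crossing does not change and neither does its rule after turning it upward. -/
theorem rot : CrossRel k oa ob L p q p' q' ↔
    CrossRel k.swap ob (!oa) (across oa L p) q q' p p' := by
  unfold CrossRel
  rw [across_not, CrossKind.type_rot, eq_comm, ← eq_across_iff, eq_comm]
  refine and_congr_right fun hr => ?_
  cases oa <;> cases ob <;> simp [TurnedRule] at hr ⊢
  rw [hr]
  simp

theorem exists_bot (k : CrossKind) (oa ob : Bool) (L : S) (p' q' : X × G) :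
    ∃ p q, CrossRel k oa ob L p q p' q' := by
  obtain ⟨p, q, h⟩ := exists_top k.swap ob oa L p' q'
  exact ⟨p, q, k.swap_swap ▸ h.conv⟩

theorem bot_unique (h : CrossRel k oa ob L p q p' q') (h' : CrossRel k oa ob L p₂ q₂ p' q') :
    p = p₂ ∧ q = q₂ :=
  h.conv.top_unique h'.conv

end CrossRel

end Oriented

/-! ### The third Reidemeister move for all directions and kinds -/

section Braid

variable {X : Type u} [TwistedVirtualBirack X] {S : Type v} [TwistedShadow X S]

open TwistedShadow (act)

variable {G : Type w} [AddCommGroup G] [Module (ShadowAlgebra X S) G]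

variable (X S G) in
/-- The third Reidemeister move for strands of given directions and crossings of given kinds. -/
def BraidRel (oa ob oc : Bool) (k₁ k₂ k₃ : CrossKind) : Prop :=
  ∀ (L : S) (a b c a' b' c' : X × G),
    (∃ b₁ a₁ c₁, CrossRel k₁ oa ob L a b b₁ a₁ ∧ CrossRel k₂ oa oc (across ob L b₁) a₁ c c₁ a' ∧
      CrossRel k₃ ob oc L b₁ c₁ c' b') ↔
    (∃ c₁ b₁ a₁, CrossRel k₃ ob oc (across oa L a) b c c₁ b₁ ∧ CrossRel k₂ oa oc L a c₁ c' a₁ ∧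
      CrossRel k₁ oa ob (across oc L c') a₁ b₁ b' a')

namespace BraidRel

variable {oa ob oc : Bool} {k₁ k₂ k₃ : CrossKind}

/-- A sixth of a turn of both sides. The strand `a` goes from the first to the last place and is
reversed, so that its two crossings make a quarter turn, while the crossing of `b` and `c` is
unchanged. The two sides of the move change places. -/
theorem rot (h : BraidRel X S G oa ob oc k₁ k₂ k₃) :
    BraidRel X S G ob oc (!oa) k₃ k₁.swap k₂.swap := by
  intro L' β γ α' β' γ' α
  obtain ⟨L, rfl⟩ : ∃ L, L' = across oa L α := ⟨across (!oa) L' α, by simp⟩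
  have h := h L α β γ α' β' γ'
  rw [across_not]
  constructor
  · rintro ⟨γ₁, β₁, α₁, h₁, h₂, h₃⟩
    have h₃ := CrossRel.rot.2 h₃
    rw [h₃.1] at h₂
    obtain ⟨b₁, a₁, c₁, g₁, g₂, g₃⟩ := h.2 ⟨γ₁, β₁, α₁, h₁, h₃, CrossRel.rot.2 h₂⟩
    exact ⟨a₁, c₁, b₁, g₁.1 ▸ CrossRel.rot.1 g₂, CrossRel.rot.1 g₁, g₃⟩
  · rintro ⟨α₁, γ₁, β₁, h₁, h₂, h₃⟩
    have h₂ := CrossRel.rot.2 h₂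
    rw [h₂.1] at h₁
    obtain ⟨c₁, b₁, a₁, g₁, g₂, g₃⟩ := h.1 ⟨β₁, α₁, γ₁, h₂, CrossRel.rot.2 h₁, h₃⟩
    exact ⟨c₁, b₁, a₁, g₁, g₂.1 ▸ CrossRel.rot.1 g₃, CrossRel.rot.1 g₂⟩

/-- Compose both sides with the inverse of the crossing of `b` and `c`, at the bottom and at the
top. On each side it cancels at one end and remains at the other. -/
theorem swap_right (h : BraidRel X S G oa ob oc k₁ k₂ k₃) :
    BraidRel X S G oa oc ob k₂ k₁ k₃.swap := by
  intro L a c b a' c' b'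
  constructor
  · rintro ⟨c₁, a₁, b₁, h₁, h₂, h₃⟩
    obtain ⟨b₀, c₀, h₀⟩ := CrossRel.exists_top k₃.swap oc ob (across oa L a) c b
    obtain ⟨b₂, a₂, c₂, g₁, g₂, g₃⟩ := (h L a b₀ c₀ a' b₁ c₁).2
      ⟨c, b, a₁, k₃.swap_swap ▸ h₀.conv, h₁, h₂⟩
    obtain ⟨rfl, rfl⟩ := g₃.bot_unique (k₃.swap_swap ▸ h₃.conv)
    exact ⟨b₀, c₀, a₂, h₀, g₁, g₂⟩
  · rintro ⟨b₁, c₁, a₁, h₁, h₂, h₃⟩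
    obtain ⟨c₀, b₀, h₀⟩ := CrossRel.exists_top k₃ ob oc L b' c'
    obtain ⟨c₂, b₂, a₂, g₁, g₂, g₃⟩ := (h L a b₁ c₁ a' b₀ c₀).1 ⟨b', a₁, c', h₂, h₃, h₀⟩
    obtain ⟨rfl, rfl⟩ := g₁.top_unique (k₃.swap_swap ▸ h₁.conv)
    exact ⟨c₀, a₂, b₀, g₂, g₃, h₀.conv⟩

theorem swap_left (h : BraidRel X S G oa ob oc k₁ k₂ k₃) :
    BraidRel X S G ob oa oc k₁.swap k₃ k₂ := by
  intro L b a c b' a' c'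
  constructor
  · rintro ⟨a₁, b₁, c₁, h₁, h₂, h₃⟩
    obtain ⟨b₀, a₀, h₀⟩ := CrossRel.exists_top k₁ oa ob (across oc L c') a' b'
    obtain ⟨b₂, a₂, c₂, g₁, g₂, g₃⟩ := (h L a₁ b₁ c a₀ b₀ c').2 ⟨c₁, b', a', h₂, h₃, h₀⟩
    obtain ⟨rfl, rfl⟩ := g₁.top_unique (k₁.swap_swap ▸ h₁.conv)
    exact ⟨c₂, a₀, b₀, g₂, g₃, h₀.conv⟩
  · rintro ⟨c₁, a₁, b₁, h₁, h₂, h₃⟩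
    obtain ⟨a₀, b₀, h₀⟩ := CrossRel.exists_bot k₁ oa ob L b a
    obtain ⟨c₂, b₂, a₂, g₁, g₂, g₃⟩ := (h L a₀ b₀ c a₁ b₁ c').1 ⟨b, a, c₁, h₀, h₁, h₂⟩
    obtain ⟨rfl, rfl⟩ := g₃.bot_unique (k₁.swap_swap ▸ h₃.conv)
    exact ⟨a₀, b₀, c₂, h₀.conv, g₁, g₂⟩

/-- A sixth of a turn reverses the first strand and makes it the last; two exchanges of neighbours
bring it back to the first place. -/
theorem not_first (h : BraidRel X S G oa ob oc k₁ k₂ k₃) :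
    BraidRel X S G (!oa) ob oc k₁ k₂ k₃ := by
  have := h.rot.swap_right.swap_left
  rwa [CrossKind.swap_swap, CrossKind.swap_swap] at this

theorem not_second (h : BraidRel X S G oa ob oc k₁ k₂ k₃) :
    BraidRel X S G oa (!ob) oc k₁ k₂ k₃ := by
  have := h.swap_left.not_first.swap_left
  rwa [CrossKind.swap_swap] at this

theorem not_third (h : BraidRel X S G oa ob oc k₁ k₂ k₃) :
    BraidRel X S G oa ob (!oc) k₁ k₂ k₃ := by
  have := h.swap_right.not_second.swap_right
  rwa [CrossKind.swap_swap] at this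

theorem of_up (h : BraidRel X S G true true true k₁ k₂ k₃) (oa ob oc : Bool) :
    BraidRel X S G oa ob oc k₁ k₂ k₃ := by
  cases oa <;> cases ob <;> cases oc
  · exact h.not_first.not_second.not_third
  · exact h.not_first.not_second
  · exact h.not_first.not_third
  · exact h.not_first
  · exact h.not_second.not_third
  · exact h.not_second
  · exact h.not_third
  · exact h

end BraidRel

/-- The kind of a crossing of strands directed upward that is positive (`true`) or virtual. -/
def kindOf : Bool → CrossKind
  | true => .leftOver
  | false => .virt

theorem crossRel_up_iff {c : Bool} {E L : S} {p q p' q' : X × G}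
    (hE : act (act E q.1) p.1 = L) :
    CrossRel (kindOf c) true true L p q p' q' ↔ Crosses c E p q p' q' := by
  have h : TurnedRule ((kindOf c).type true true) true true L p q p' q' ↔
      Crosses c E p q p' q' := by
    subst hE
    cases c <;> simp [kindOf, CrossKind.type, TurnedRule, TypeRule]
  exact ⟨fun h' => h.1 h'.2, fun h' => CrossRel.of_turned (h.2 h')⟩

/-- Both sides determine the tops from the bottoms, so the equality of the tops gives an
equivalence. `Crosses.yang_baxter` refers to the region `E` on the far right; the region rule
converts between `E` and the region on the far left. -/
theorem braidRel_up {c₁ c₂ c₃ : Bool} (hc : c₁ = c₂ ∨ c₂ = c₃) (hc' : c₂ = true → c₁ = c₃) :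
    BraidRel X S G true true true (kindOf c₁) (kindOf c₂) (kindOf c₃) := by
  intro L a b c a' b' c'
  obtain ⟨E, rfl⟩ : ∃ E, L = act (act (act E c.1) b.1) a.1 :=
    ⟨actInv (actInv (actInv L a.1) b.1) c.1, by simp⟩
  have side₁ : ∀ b₁ a₁ c₁', CrossRel (kindOf c₁) true true (act (act (act E c.1) b.1) a.1) a b b₁ a₁ ∧
      CrossRel (kindOf c₂) true true (across true (act (act (act E c.1) b.1) a.1) b₁) a₁ c c₁' a' ∧
      CrossRel (kindOf c₃) true true (act (act (act E c.1) b.1) a.1) b₁ c₁' c' b' ↔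
      Crosses c₁ (act E c.1) a b b₁ a₁ ∧ Crosses c₂ E a₁ c c₁' a' ∧
        Crosses c₃ (act E a'.1) b₁ c₁' c' b' := by
    intro b₁ a₁ c₁'
    rw [crossRel_up_iff (E := act E c.1) rfl]
    refine and_congr_right fun h₁ => ?_
    rw [h₁.region, crossRel_up_iff (E := E) (by simp)]
    refine and_congr_right fun h₂ => ?_
    rw [crossRel_up_iff]
    rw [h₂.region]
  have side₂ : ∀ c₁' b₁ a₁, CrossRel (kindOf c₃) true true
        (across true (act (act (act E c.1) b.1) a.1) a) b c c₁' b₁ ∧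
      CrossRel (kindOf c₂) true true (act (act (act E c.1) b.1) a.1) a c₁' c' a₁ ∧
      CrossRel (kindOf c₁) true true (across true (act (act (act E c.1) b.1) a.1) c') a₁ b₁ b' a' ↔
      Crosses c₃ E b c c₁' b₁ ∧ Crosses c₂ (act E b₁.1) a c₁' c' a₁ ∧
        Crosses c₁ E a₁ b₁ b' a' := by
    intro c₁' b₁ a₁
    rw [crossRel_up_iff (E := E) (by simp)]
    refine and_congr_right fun h₁ => ?_
    rw [h₁.region, crossRel_up_iff (E := act E b₁.1) rfl]
    refine and_congr_right fun h₂ => ?_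
    rw [h₂.region, crossRel_up_iff (E := E) (by simp)]
  simp only [side₁, side₂]
  constructor
  · rintro ⟨b₁, a₁, d₁, h₁, h₂, h₃⟩
    obtain ⟨d₂, b₂, g₁⟩ := Crosses.exists_out c₃ E b c
    obtain ⟨d₃, a₂, g₂⟩ := Crosses.exists_out c₂ (act E b₂.1) a d₂
    obtain ⟨b₃, a₃, g₃⟩ := Crosses.exists_out c₁ E a₂ b₂
    obtain ⟨rfl, rfl, rfl⟩ := Crosses.yang_baxter hc hc' h₁ h₂ h₃ g₁ g₂ g₃
    exact ⟨_, _, _, g₁, g₂, g₃⟩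
  · rintro ⟨d₂, b₂, a₂, g₁, g₂, g₃⟩
    obtain ⟨b₁, a₁, h₁⟩ := Crosses.exists_out c₁ (act E c.1) a b
    obtain ⟨d₁, a₃, h₂⟩ := Crosses.exists_out c₂ E a₁ c
    obtain ⟨d₃, b₃, h₃⟩ := Crosses.exists_out c₃ (act E a₃.1) b₁ d₁
    obtain ⟨rfl, rfl, rfl⟩ := Crosses.yang_baxter hc hc' h₁ h₂ h₃ g₁ g₂ g₃
    exact ⟨_, _, _, h₁, h₂, h₃⟩

/-- Three triples suffice: all classical, all virtual, and two virtual with one classical crossing.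
Exchanges of neighbouring strands lead from these to all other allowed triples. -/
theorem braidRel_of_allowed {k₁ k₂ k₃ : CrossKind} (hk : TripleAllowed k₁ k₂ k₃)
    (oa ob oc : Bool) : BraidRel X S G oa ob oc k₁ k₂ k₃ := by
  have hB : ∀ oa ob oc, BraidRel X S G oa ob oc .leftOver .leftOver .leftOver := fun oa ob oc =>
    (braidRel_up (c₁ := true) (c₂ := true) (c₃ := true) (.inl rfl) (fun _ => rfl)).of_up oa ob oc
  have hV : ∀ oa ob oc, BraidRel X S G oa ob oc .virt .virt .virt := fun oa ob oc =>
    (braidRel_up (c₁ := false) (c₂ := false) (c₃ := false) (.inl rfl) (fun _ => rfl)).of_up oa ob oc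
  have hM : ∀ oa ob oc, BraidRel X S G oa ob oc .virt .virt .leftOver := fun oa ob oc =>
    (braidRel_up (c₁ := false) (c₂ := false) (c₃ := true) (.inl rfl) (fun h => by simp at h)).of_up
      oa ob oc
  cases k₁ <;> cases k₂ <;> cases k₃ <;> simp only [TripleAllowed] at hk
  · exact hB _ _ _
  · exact (hB _ _ _).swap_right
  · exact (hB _ _ _).swap_left.swap_right
  · exact (hM _ _ _).swap_left.swap_right
  · exact (hB _ _ _).swap_left
  · exact (hB _ _ _).swap_right.swap_left
  · exact (hB _ _ _).swap_right.swap_left.swap_right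
  · exact (hM _ _ _).swap_right.swap_left.swap_right
  · exact (hM _ _ _).swap_left
  · exact (hM _ _ _).swap_right.swap_left
  · exact hM _ _ _
  · exact (hM _ _ _).swap_right
  · exact hV _ _ _

end Braid

/-! ### Sliding kinks and twist bars along oriented strands -/

section StrandMaps

variable {X : Type u} [TwistedVirtualBirack X] {S : Type v} [TwistedShadow X S]

open TwistedShadow (act)

variable {G : Type w}

/-- The region to the right of an oriented strand, where `L` is the region on the left of the strand
in the drawing. -/
noncomputable def rightOf (o : Bool) (L : S) (p : X × G) : S :=
  match o with
  | true => across true L p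
  | false => L

theorem across_eq_of_act_eq {p p' : X × G} (h : ∀ A : S, act A p'.1 = act A p.1) (o : Bool) (L : S) :
    across o L p' = across o L p := by
  cases o
  · exact h L
  · refine act_injective p.1 ?_
    rw [across_true, across_true, act_actInv, ← h, act_actInv]

variable [AddCommGroup G] [Module (ShadowAlgebra X S) G]

/-- The maps `f A` of the labels with beads of strands with region `A` on the right can be moved
through crossings of type `τ`. -/
def Slides (f : S → X × G → X × G) (τ : CrossType) : Prop :=
  (∀ E a b c d, TypeRule τ E a b c d → TypeRule τ E (f (act E b.1) a) b c (f E d)) ∧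
    ∀ E a b c d, TypeRule τ E a b c d → TypeRule τ E a (f E b) (f (act E d.1) c) d

theorem CrossType.flip_flip (τ : CrossType) : τ.flip.flip = τ := by
  cases τ <;> rfl

theorem Slides.flip {f : S → X × G → X × G} {τ : CrossType} (h : Slides f τ) : Slides f τ.flip := by
  have hf : ∀ {E a b c d}, TypeRule (X := X) (S := S) (G := G) τ.flip E a b c d →
      TypeRule τ E c d a b := fun h => τ.flip_flip ▸ h.flip
  exact ⟨fun E a b c d h' => (h.2 _ _ _ _ _ (hf h')).flip,
    fun E a b c d h' => (h.1 _ _ _ _ _ (hf h')).flip⟩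

section

variable {f : S → X × G → X × G}
  {k : CrossKind} {oa ob : Bool} {L : S} {p q p' q' : X × G}

theorem across_map (hf : ∀ (A A' : S) (p : X × G), act A (f A' p).1 = act A p.1)
    (o : Bool) (L A : S) (p : X × G) : across o L (f A p) = across o L p :=
  across_eq_of_act_eq (fun B => hf B A p) o L

/-- After turning the crossing upward, the strand of `p` runs from left to right or from right to
left; these are the two halves of `Slides`. As `f` does not affect regions, the base region of the
rule is kept. -/
theorem CrossRel.map_left (hf : ∀ (A A' : S) (p : X × G), act A (f A' p).1 = act A p.1)
    (hs : Slides f (k.type oa ob)) (h : CrossRel k oa ob L p q p' q') :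
    CrossRel k oa ob L (f (rightOf oa L p) p) q p' (f (rightOf oa (across ob L p') q') q') := by
  refine CrossRel.of_turned ?_
  obtain ⟨hr, h⟩ := h
  cases oa <;> cases ob <;> simp only [TurnedRule, rightOf, across_map hf] at h hr ⊢
  · exact hs.1 _ _ _ _ _ h
  · have := hs.2 _ _ _ _ _ h
    simpa using this
  · rw [← hr]
    exact hs.2 _ _ _ _ _ h
  · have := hs.1 _ _ _ _ _ h
    rw [← hr]
    simpa using this

/-- Reading the crossing from top to bottom makes the second strand the first one. -/
theorem CrossRel.map_right (hf : ∀ (A A' : S) (p : X × G), act A (f A' p).1 = act A p.1)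
    (hs : Slides f (k.type oa ob)) (h : CrossRel k oa ob L p q p' q') :
    CrossRel k oa ob L p (f (rightOf ob (across oa L p) q) q) (f (rightOf ob L p') p') q' := by
  have hs' : Slides f (k.swap.type ob oa) := by
    rw [CrossKind.type_swap, CrossKind.type_comm]
    exact hs.flip
  have := (CrossRel.map_left hf hs' h.conv).conv
  rwa [CrossKind.swap_swap] at this

end

/-- The effect of `z` positive kinks on an oriented strand, read from bottom to top. -/
noncomputable def dotMap (o : Bool) (z : ℤ) (L : S) (p : X × G) : X × G :=
  (kap (rightOf o L p) ^ (if o then z else -z)) p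

/-- The effect of a twist bar on an oriented strand, read from bottom to top. -/
noncomputable def barMap (o : Bool) (L : S) (p : X × G) : X × G := tau (rightOf o L p) p

theorem slides_kap (z : ℤ) (τ : CrossType) :
    Slides (X := X) (S := S) (G := G) (fun A p => (kap A ^ z) p) τ := by
  have h : ∀ c : Bool, ∀ E a b c' d, Crosses (X := X) (S := S) (G := G) c E a b c' d →
      Crosses c E ((kap (act E b.1) ^ z) a) b c' ((kap E ^ z) d) :=
    fun c E a b c' d h => (Crosses.kap_left_zpow z).1 h
  have h' : ∀ c : Bool, ∀ E a b c' d, Crosses (X := X) (S := S) (G := G) c E a b c' d →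
      Crosses c E a ((kap E ^ z) b) ((kap (act E d.1) ^ z) c') d :=
    fun c E a b c' d h => (Crosses.kap_right_zpow z).1 h
  cases τ
  · exact ⟨h true, h' true⟩
  · exact ⟨fun _ _ _ _ _ => h' true _ _ _ _ _, fun _ _ _ _ _ => h true _ _ _ _ _⟩
  · exact ⟨h false, h' false⟩

theorem slides_tau : Slides (X := X) (S := S) (G := G) tau .virt :=
  ⟨fun _ _ _ _ _ => Crosses.tau_left, fun _ _ _ _ _ => Crosses.tau_right⟩

theorem across_dotMap (o o' : Bool) (z : ℤ) (L L' : S) (p : X × G) :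
    across o L (dotMap o' z L' p) = across o L p :=
  across_eq_of_act_eq (fun B => act_kap_zpow (G := G) B (rightOf o' L' p) _ p) o L

theorem across_barMap (o o' : Bool) (L L' : S) (p : X × G) :
    across o L (barMap o' L' p) = across o L p :=
  across_eq_of_act_eq (fun B => act_tau (G := G) B (rightOf o' L' p) p) o L

theorem rightOf_dotMap (o o' : Bool) (z : ℤ) (L L' : S) (p : X × G) :
    rightOf o L (dotMap o' z L' p) = rightOf o L p := by
  cases o
  · rfl
  · exact across_dotMap true o' z L L' p

theorem rightOf_barMap (o o' : Bool) (L L' : S) (p : X × G) :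
    rightOf o L (barMap o' L' p) = rightOf o L p := by
  cases o
  · rfl
  · exact across_barMap true o' L L' p

theorem barMap_barMap (o : Bool) (L : S) (p : X × G) : barMap o L (barMap o L p) = p := by
  conv_lhs => rw [barMap]
  rw [rightOf_barMap]
  exact tau_tau _ _

theorem dotMap_dotMap (o : Bool) (y z : ℤ) (L : S) (p : X × G) :
    dotMap o z L (dotMap o y L p) = dotMap o (y + z) L p := by
  conv_lhs => rw [dotMap]
  rw [rightOf_dotMap, dotMap, dotMap, ← Equiv.Perm.mul_apply, ← zpow_add]
  congr 2
  cases o <;> simp [add_comm]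

@[simp] theorem dotMap_zero (o : Bool) (L : S) (p : X × G) : dotMap o 0 L p = p := by
  cases o <;> simp [dotMap]

theorem dotMap_congr (o : Bool) {y z : ℤ} (h : (birackRank X : ℤ) ∣ y - z) (L : S) (p : X × G) :
    dotMap o y L p = dotMap o z L p := by
  rw [dotMap, dotMap, kap_zpow_congr]
  cases o
  · simp only [Bool.false_eq_true, if_false]
    rw [neg_sub_neg, ← neg_sub]
    exact (dvd_neg).2 h
  · exact h

theorem dotMap_barMap (o : Bool) (z : ℤ) (L : S) (p : X × G) :
    dotMap o z L (barMap o L p) = barMap o L (dotMap o z L p) := by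
  rw [dotMap, rightOf_barMap, barMap, barMap, rightOf_dotMap]
  exact kap_tau_zpow _ _ _

theorem rightOf_not (o : Bool) (L : S) (p : X × G) :
    rightOf (!o) (across o L p) p = rightOf o L p := by
  cases o <;> simp [rightOf]

theorem barMap_not (o : Bool) (L : S) (p : X × G) :
    barMap (!o) (across o L p) p = barMap o L p := by
  rw [barMap, rightOf_not]
  rfl

theorem dotMap_not (o : Bool) (z : ℤ) (L : S) (p : X × G) :
    dotMap (!o) z (across o L p) p = dotMap o (-z) L p := by
  rw [dotMap, dotMap, rightOf_not]
  cases o <;> simp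

namespace CrossRel

variable {k : CrossKind} {oa ob : Bool} {L : S} {p q p' q' : X × G}

theorem dot_left (z : ℤ) (h : CrossRel k oa ob L p q p' q') :
    CrossRel k oa ob L (dotMap oa z L p) q p' (dotMap oa z (across ob L p') q') :=
  map_left (f := fun A p => (kap A ^ (if oa then z else -z)) p)
    (fun A A' p => act_kap_zpow A A' _ p) (slides_kap _ _) h

theorem dot_right (z : ℤ) (h : CrossRel k oa ob L p q p' q') :
    CrossRel k oa ob L p (dotMap ob z (across oa L p) q) (dotMap ob z L p') q' :=
  map_right (f := fun A p => (kap A ^ (if ob then z else -z)) p)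
    (fun A A' p => act_kap_zpow A A' _ p) (slides_kap _ _) h

theorem bar_left (h : CrossRel .virt oa ob L p q p' q') :
    CrossRel .virt oa ob L (barMap oa L p) q p' (barMap oa (across ob L p') q') :=
  map_left (f := tau) (fun A A' p => act_tau A A' p) slides_tau h

theorem bar_right (h : CrossRel .virt oa ob L p q p' q') :
    CrossRel .virt oa ob L p (barMap ob (across oa L p) q) (barMap ob L p') q' :=
  map_right (f := tau) (fun A A' p => act_tau A A' p) slides_tau h

end CrossRel

namespace TypeRule

variable {τ : CrossType} {A E Z : S} {a b c d u u' m n m₂ n₂ x y x' y' p₁ p₂ q₁ q₂ : X × G}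

theorem kap_zpow_sign_of_flip (h : a = kap A c) : c = (kap A ^ (-1 : ℤ)) a := by
  rw [h, zpow_neg_one]
  exact ((kap A).symm_apply_apply c).symm

theorem right_loop (h : TypeRule τ (actInv A u.1) a u c u) : c = (kap A ^ τ.sign) a := by
  cases τ
  · simpa [CrossType.sign] using (Crosses.right_loop_iff.1 h).1
  · exact kap_zpow_sign_of_flip (Crosses.right_loop_iff.1 h).1
  · exact (Crosses.eq_of_virt_right_loop h).symm

theorem exists_right_loop (τ : CrossType) (A : S) (a : X × G) :
    ∃ u, TypeRule τ (actInv A u.1) a u ((kap A ^ τ.sign) a) u := by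
  cases τ
  · simp only [CrossType.sign, zpow_one]
    exact Crosses.exists_right_loop A a
  · obtain ⟨u, h⟩ := Crosses.exists_right_loop A ((kap A ^ (-1 : ℤ)) a)
    refine ⟨u, ?_⟩
    rw [zpow_neg_one, show kap A ((kap A)⁻¹ a) = a from (kap A).apply_symm_apply a] at h
    exact h
  · exact Crosses.exists_virt_right_loop (actInv A) a

theorem right_loop_unique (h : TypeRule τ (actInv A u.1) a u c u)
    (h' : TypeRule τ (actInv A u'.1) a u' c u') : u = u' := by
  cases τ
  · exact (Crosses.right_loop_iff.1 h).2.trans (Crosses.right_loop_iff.1 h').2.symm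
  · exact (Crosses.right_loop_iff.1 h).2.trans (Crosses.right_loop_iff.1 h').2.symm
  · exact Crosses.virt_right_loop_unique h h'

theorem left_loop (h : TypeRule τ A u b u d) : d = (kap A ^ τ.sign) b := by
  cases τ
  · simpa [CrossType.sign] using Crosses.eq_kap_of_left_loop h
  · exact kap_zpow_sign_of_flip (Crosses.eq_kap_of_left_loop h)
  · exact (Crosses.eq_of_virt_left_loop h).symm

theorem exists_left_loop (τ : CrossType) (A : S) (b : X × G) :
    ∃ u, TypeRule τ A u b u ((kap A ^ τ.sign) b) := by
  cases τ
  · simp only [CrossType.sign, zpow_one]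
    exact Crosses.left_loop_kap A b
  · obtain ⟨u, h⟩ := Crosses.left_loop_kap A ((kap A ^ (-1 : ℤ)) b)
    refine ⟨u, ?_⟩
    rw [zpow_neg_one, show kap A ((kap A)⁻¹ b) = b from (kap A).apply_symm_apply b] at h
    exact h
  · exact Crosses.exists_virt_left_loop A b

theorem left_loop_unique (h : TypeRule τ A u b u d) (h' : TypeRule τ A u' b u' d) : u = u' := by
  cases τ
  · exact (Crosses.left_loop_unique h h').1
  · exact (Crosses.left_loop_unique h h').1
  · exact Crosses.virt_left_loop_unique h h'

theorem tau_of_virt (hτ : τ ≠ .virt) (h₁ : TypeRule .virt E a b m n)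
    (h₂ : TypeRule τ E m n m₂ n₂) (h₃ : TypeRule .virt E m₂ n₂ c d) :
    TypeRule τ E (tau (act E b.1) a) (tau E b) (tau (act E d.1) c) (tau E d) := by
  cases τ
  · exact Crosses.tau_of_virt h₁ h₂ h₃
  · exact Crosses.tau_of_virt (Crosses.symm_virt h₃) h₂ (Crosses.symm_virt h₁)
  · exact absurd rfl hτ

/-- Needed for strands of opposite directions: when the picture is turned such that they go upward,
the virtual crossings below and above the classical one appear on its left and right. -/
theorem tau_of_virt_sides (hτ : τ ≠ .virt) (h₁ : TypeRule .virt Z x q₂ y' p₂)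
    (h₂ : TypeRule .virt E q₁ y p₁ x') (h₃ : TypeRule τ Z p₁ p₂ q₁ q₂)
    (hb : act Z q₂.1 = act E y.1) (ht : act Z p₂.1 = act E x'.1) :
    TypeRule τ E (tau (act E y.1) x) (tau E y) (tau (act E x'.1) y') (tau E x') := by
  cases τ
  · obtain ⟨m, n, m₂, n₂, g₁, g₂, g₃⟩ := Crosses.flank h₁ h₂ h₃ hb ht
    exact Crosses.tau_of_virt g₁ g₂ g₃
  · obtain ⟨m, n, m₂, n₂, g₁, g₂, g₃⟩ :=
      Crosses.flank (Crosses.symm_virt h₁) (Crosses.symm_virt h₂) h₃ ht hb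
    exact Crosses.tau_of_virt g₁ g₂ g₃
  · exact absurd rfl hτ

end TypeRule

namespace CrossRel

variable {k : CrossKind} {o oa ob : Bool} {L : S} {u u' p q p' q' p₁ q₁ p₂ q₂ : X × G}

theorem right_kink (h : CrossRel k o o L p u q u) : q = dotMap o (k.type o o).sign L p := by
  obtain ⟨-, h⟩ := h
  cases o
  · have h' := TypeRule.left_loop h
    rw [dotMap, h']
    simp [rightOf]
  · exact TypeRule.right_loop h

theorem exists_right_kink (k : CrossKind) (o : Bool) (L : S) (p : X × G) :
    ∃ u, CrossRel k o o L p u (dotMap o (k.type o o).sign L p) u := by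
  cases o
  -- A downward strand enters the kink at the top, and its loop on the right of the drawing is on
  -- its own left.
  · obtain ⟨u, h⟩ := TypeRule.exists_left_loop (k.type false false) L
      (dotMap false (k.type false false).sign L p)
    refine ⟨u, of_turned ?_⟩
    simp only [dotMap, rightOf, Bool.false_eq_true, if_false, zpow_neg] at h ⊢
    rw [show ∀ e : Equiv.Perm (X × G), e (e⁻¹ p) = p from fun e => e.apply_symm_apply p] at h
    exact h
  · obtain ⟨u, h⟩ := TypeRule.exists_right_loop (k.type true true) (actInv L p.1) p
    exact ⟨u, of_turned h⟩

theorem right_kink_unique (h : CrossRel k o o L p u q u) (h' : CrossRel k o o L p u' q u') :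
    u = u' := by
  cases o
  · exact TypeRule.left_loop_unique h.2 h'.2
  · exact TypeRule.right_loop_unique h.2 h'.2

theorem left_kink (h : CrossRel k o o (across (!o) L u) u p u q) :
    q = dotMap o (k.type o o).sign L p := by
  obtain ⟨-, h⟩ := h
  cases o
  · have h' := TypeRule.right_loop h
    rw [dotMap, h']
    simp [rightOf]
  · simp only [TurnedRule, Bool.not_true, across_false, across_true, actInv_act] at h
    exact TypeRule.left_loop h

theorem exists_left_kink (k : CrossKind) (o : Bool) (L : S) (p : X × G) :
    ∃ u, CrossRel k o o (across (!o) L u) u p u (dotMap o (k.type o o).sign L p) := by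
  cases o
  · obtain ⟨u, h⟩ := TypeRule.exists_right_loop (k.type false false) L
      (dotMap false (k.type false false).sign L p)
    refine ⟨u, of_turned ?_⟩
    simp only [dotMap, rightOf, Bool.false_eq_true, if_false, zpow_neg] at h ⊢
    rw [show ∀ e : Equiv.Perm (X × G), e (e⁻¹ p) = p from fun e => e.apply_symm_apply p] at h
    exact h
  · obtain ⟨u, h⟩ := TypeRule.exists_left_loop (k.type true true) (actInv L p.1) p
    refine ⟨u, of_turned ?_⟩
    simp only [TurnedRule, Bool.not_true, across_false, across_true, actInv_act]
    exact h

theorem left_kink_unique (h : CrossRel k o o (across (!o) L u) u p u q)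
    (h' : CrossRel k o o (across (!o) L u') u' p u' q) : u = u' := by
  obtain ⟨-, h⟩ := h
  obtain ⟨-, h'⟩ := h'
  cases o
  · exact TypeRule.right_loop_unique h h'
  · simp only [TurnedRule, Bool.not_true, across_false, across_true, actInv_act] at h h'
    exact TypeRule.left_loop_unique h h'

/-- Strands of the same direction lead to `TypeRule.tau_of_virt`, strands of opposite directions to
`TypeRule.tau_of_virt_sides`. Everything else compares the regions around the crossings. -/
theorem bar_of_virt (hk : k ≠ .virt) (h₁ : CrossRel .virt oa ob L p q p₁ q₁)
    (h₂ : CrossRel k ob oa L p₁ q₁ p₂ q₂) (h₃ : CrossRel .virt oa ob L p₂ q₂ p' q') :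
    CrossRel k oa ob L (barMap oa L p) (barMap ob (across oa L p) q) (barMap ob L p')
      (barMap oa (across ob L p') q') := by
  obtain ⟨r₁, h₁⟩ := h₁
  obtain ⟨r₂, h₂⟩ := h₂
  obtain ⟨r₃, h₃⟩ := h₃
  have hτ : k.type oa ob ≠ .virt := by
    cases k <;> cases oa <;> cases ob <;> simp [CrossKind.type] at hk ⊢
  rw [CrossKind.type_comm] at h₂
  refine of_turned ?_
  have hv : ∀ a b, CrossKind.virt.type a b = .virt := fun _ _ => rfl
  rw [hv] at h₁ h₃
  cases oa <;> cases ob <;> simp only [TurnedRule, across_barMap] at h₁ h₂ h₃ ⊢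
  · exact TypeRule.tau_of_virt hτ h₃ h₂ h₁
  · have := TypeRule.tau_of_virt_sides hτ h₁ h₃ h₂
      (by simpa using r₂.trans r₃) (by simp)
    simp only [across_true, across_false] at r₁ r₂ r₃
    simp only [barMap, rightOf, across_true, across_false, r₁.trans (r₂.trans r₃), act_actInv] at this ⊢
    exact this
  · have := TypeRule.tau_of_virt_sides hτ h₃ h₁ h₂
      (by simp) (by simpa using (r₁.trans r₂).symm)
    simp only [across_true, across_false] at r₁ r₂ r₃
    have e := r₁.trans (r₂.trans r₃)
    simp only [barMap, rightOf, across_true, across_false, ← e, act_actInv] at this ⊢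
    exact this
  · simp only [across_true] at r₁ r₂ r₃ h₁ h₂ h₃ ⊢
    have e := r₁.trans (r₂.trans r₃)
    rw [← r₁] at h₂
    rw [← r₂, ← r₁] at h₃
    have := TypeRule.tau_of_virt hτ h₁ h₂ h₃
    simp only [barMap, rightOf, across_true]
    rw [act_actInv] at this
    rw [← e]
    have e' : act (actInv (actInv L p.1) q.1) q'.1 = actInv L p'.1 := by rw [e, act_actInv]
    rwa [e'] at this

/-- Only the forward direction is new: a path through the three crossings exists from any bottom,
and its top is the given one because tops are unique and bars can be cancelled. -/
theorem bar_iff_virt (hk : k ≠ .virt) :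
    CrossRel k oa ob L (barMap oa L p) (barMap ob (across oa L p) q) (barMap ob L p')
      (barMap oa (across ob L p') q') ↔
    ∃ p₁ q₁ p₂ q₂, CrossRel .virt oa ob L p q p₁ q₁ ∧ CrossRel k ob oa L p₁ q₁ p₂ q₂ ∧
      CrossRel .virt oa ob L p₂ q₂ p' q' := by
  constructor
  · intro h
    obtain ⟨p₁, q₁, h₁⟩ := exists_top .virt oa ob L p q
    obtain ⟨p₂, q₂, h₂⟩ := exists_top k ob oa L p₁ q₁
    obtain ⟨p₃, q₃, h₃⟩ := exists_top .virt oa ob L p₂ q₂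
    obtain ⟨e₁, e₂⟩ := (bar_of_virt hk h₁ h₂ h₃).top_unique h
    have e₁' := congrArg (barMap ob L) e₁
    rw [barMap_barMap, barMap_barMap] at e₁'
    subst e₁'
    have e₂' := congrArg (barMap oa (across ob L p₃)) e₂
    rw [barMap_barMap, barMap_barMap] at e₂'
    subst e₂'
    exact ⟨_, _, _, _, h₁, h₂, h₃⟩
  · rintro ⟨p₁, q₁, p₂, q₂, h₁, h₂, h₃⟩
    exact bar_of_virt hk h₁ h₂ h₃

end CrossRel

end StrandMaps

/-! ### Paths along words of relations -/

section Paths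

variable {σ L : Type*} {R : σ → L → L → Prop}

/-- The lists `ys` of states on the way from `x` to `z` along a word of steps. -/
def IsPath (R : σ → L → L → Prop) : List σ → L → List L → L → Prop
  | [], x, ys, z => ys = [] ∧ x = z
  | s :: W, x, ys, z => ∃ y ys', ys = y :: ys' ∧ R s x y ∧ IsPath R W y ys' z

/-- There is a path from `x` to `z` along a word of steps. -/
def Reach (R : σ → L → L → Prop) (W : List σ) (x z : L) : Prop := ∃ ys, IsPath R W x ys z

/-- There is at most one path from `x` to `z` along a word of steps. -/
def Rigid (R : σ → L → L → Prop) (W : List σ) (x z : L) : Prop :=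
  ∀ ys ys', IsPath R W x ys z → IsPath R W x ys' z → ys = ys'

theorem isPath_nil {x z : L} {ys : List L} : IsPath R [] x ys z ↔ ys = [] ∧ x = z := Iff.rfl

theorem isPath_cons {s : σ} {W : List σ} {x z : L} {ys : List L} :
    IsPath R (s :: W) x ys z ↔ ∃ y ys', ys = y :: ys' ∧ R s x y ∧ IsPath R W y ys' z := Iff.rfl

theorem reach_nil {x z : L} : Reach R [] x z ↔ x = z := by simp [Reach, isPath_nil]

theorem reach_cons {s : σ} {W : List σ} {x z : L} :
    Reach R (s :: W) x z ↔ ∃ y, R s x y ∧ Reach R W y z := by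
  constructor
  · rintro ⟨_, y, ys, rfl, h, h'⟩
    exact ⟨y, h, ys, h'⟩
  · rintro ⟨y, h, ys, h'⟩
    exact ⟨_, y, ys, rfl, h, h'⟩

theorem IsPath.length_eq : ∀ {W : List σ} {x z : L} {ys : List L}, IsPath R W x ys z →
    ys.length = W.length
  | [], _, _, _, h => by rw [h.1]; rfl
  | _ :: _, _, _, _, ⟨_, _, h, _, h'⟩ => by rw [h, List.length_cons, h'.length_eq]; rfl

theorem IsPath.target_unique : ∀ {W : List σ} {x z z' : L} {ys : List L}, IsPath R W x ys z →
    IsPath R W x ys z' → z = z'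
  | [], _, _, _, _, h, h' => h.2.symm.trans h'.2
  | _ :: _, _, _, _, _, ⟨_, _, h, _, g⟩, ⟨_, _, h', _, g'⟩ => by
    rw [h] at h'
    obtain ⟨rfl, rfl⟩ := List.cons.inj h'
    exact g.target_unique g'

theorem isPath_append {W W' : List σ} {x z : L} {ys : List L} :
    IsPath R (W ++ W') x ys z ↔
      ∃ ys₁ ys₂ y, ys = ys₁ ++ ys₂ ∧ IsPath R W x ys₁ y ∧ IsPath R W' y ys₂ z := by
  induction W generalizing x ys with
  | nil => simp [isPath_nil]
  | cons s W ih =>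
    simp only [List.cons_append, isPath_cons, ih]
    constructor
    · rintro ⟨y, _, rfl, h, ys₁, ys₂, y', rfl, h₁, h₂⟩
      exact ⟨y :: ys₁, ys₂, y', rfl, ⟨y, ys₁, rfl, h, h₁⟩, h₂⟩
    · rintro ⟨_, ys₂, y', rfl, ⟨y, ys₁, rfl, h, h₁⟩, h₂⟩
      exact ⟨y, _, rfl, h, ys₁, ys₂, y', rfl, h₁, h₂⟩

theorem rigid_nil (x z : L) : Rigid R [] x z := fun _ _ h h' => h.1.trans h'.1.symm

theorem rigid_of_det {W : List σ} (h : ∀ s ∈ W, ∀ x y y', R s x y → R s x y' → y = y') (x z : L) :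
    Rigid R W x z := by
  induction W generalizing x with
  | nil => exact rigid_nil x z
  | cons s W ih =>
    rintro _ _ ⟨y, ys, rfl, g, g'⟩ ⟨y₂, ys₂, rfl, g₂, g₂'⟩
    obtain rfl := h s (by simp) _ _ _ g g₂
    rw [ih (fun s hs => h s (by simp [hs])) _ _ _ g' g₂']

theorem rigid_of_codet {W : List σ} (h : ∀ s ∈ W, ∀ x x' y, R s x y → R s x' y → x = x')
    (x z : L) : Rigid R W x z := by
  have key : ∀ {W : List σ}, (∀ s ∈ W, ∀ x x' y, R s x y → R s x' y → x = x') →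
      ∀ x x' z ys ys', IsPath R W x ys z → IsPath R W x' ys' z → x = x' ∧ ys = ys' := by
    intro W h
    induction W with
    | nil => exact fun x x' z ys ys' g g' => ⟨g.2.trans g'.2.symm, g.1.trans g'.1.symm⟩
    | cons s W ih =>
      rintro x x' z _ _ ⟨y, ys, rfl, g, g'⟩ ⟨y₂, ys₂, rfl, g₂, g₂'⟩
      obtain ⟨rfl, rfl⟩ := ih (fun s hs => h s (by simp [hs])) _ _ _ _ _ g' g₂'
      exact ⟨h s (by simp) _ _ _ g g₂, rfl⟩
  exact fun ys ys' g g' => (key h _ _ _ _ _ g g').2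

theorem IsPath.map {σ' L' : Type*} {R' : σ' → L' → L' → Prop} {e : σ → σ'} {f : L → L'}
    (hf : ∀ s x y, R s x y → R' (e s) (f x) (f y)) : ∀ {W : List σ} {x z : L} {ys : List L},
    IsPath R W x ys z → IsPath R' (W.map e) (f x) (ys.map f) (f z)
  | [], _, _, _, h => ⟨by rw [h.1]; rfl, by rw [h.2]⟩
  | _ :: _, _, _, _, ⟨y, ys, h, g, g'⟩ => ⟨f y, ys.map f, by rw [h]; rfl, hf _ _ _ g, g'.map hf⟩

end Paths

/-! ### Colorings of pieces and slices -/

section SliceRules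

variable {ι : Type}

/-- A relation for the pieces of diagrams is extended to slices with vertical strands, where
`acr` tells how the state of the region on the left changes. -/
def SliceRule {Λ E : Type*} (acr : List (Strand ι) → E → List Λ → E)
    (rule : E → Piece ι → List Λ → List Λ → Prop) (A : E) (s : Slice ι) (x y : List Λ) : Prop :=
  ∃ xl xr p q, x = xl ++ (p ++ xr) ∧ y = xl ++ (q ++ xr) ∧ xl.length = s.left.length ∧
    xr.length = s.right.length ∧ rule (acr s.left A xl) s.piece p q

end SliceRules

section Coloring

variable {ι : Type} {X : Type u} [TwistedVirtualBirack X] {S : Type v} [TwistedShadow X S]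

open TwistedShadow (act)

variable {G : Type w}

/-- The region to the right of some strands with given labels, where `A` is the region on their
left. -/
noncomputable def acrossAll : List (Strand ι) → S → List (X × G) → S
  | a :: σ, A, p :: x => acrossAll σ (across a.up A p) x
  | _, A, _ => A

@[simp] theorem acrossAll_nil (A : S) (x : List (X × G)) :
    acrossAll ([] : List (Strand ι)) A x = A := by
  cases x <;> rfl

@[simp] theorem acrossAll_cons (a : Strand ι) (σ : List (Strand ι)) (A : S) (p : X × G)
    (x : List (X × G)) : acrossAll (a :: σ) A (p :: x) = acrossAll σ (across a.up A p) x := rfl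

theorem acrossAll_append {σ : List (Strand ι)} {x : List (X × G)} (h : x.length = σ.length)
    (τ : List (Strand ι)) (A : S) (y : List (X × G)) :
    acrossAll (σ ++ τ) A (x ++ y) = acrossAll τ (acrossAll σ A x) y := by
  induction σ generalizing A x with
  | nil =>
    obtain rfl := List.length_eq_zero_iff.1 h
    simp
  | cons a σ ih =>
    cases x with
    | nil => simp at h
    | cons p x => exact ih (by simpa using h) _

variable [AddCommGroup G] [Module (ShadowAlgebra X S) G]

/-- The effect of `n i` positive kinks on the `i`-th strand of a line. -/
noncomputable def dotLine : List (Strand ι) → (ℕ → ℤ) → S → List (X × G) → List (X × G)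
  | a :: σ, n, A, p :: x =>
    dotMap a.up (n 0) A p :: dotLine σ (fun i => n (i + 1)) (across a.up A p) x
  | _, _, _, x => x

@[simp] theorem dotLine_nil (n : ℕ → ℤ) (A : S) (x : List (X × G)) :
    dotLine ([] : List (Strand ι)) n A x = x := by
  cases x <;> rfl

@[simp] theorem dotLine_cons (a : Strand ι) (σ : List (Strand ι)) (n : ℕ → ℤ) (A : S) (p : X × G)
    (x : List (X × G)) : dotLine (a :: σ) n A (p :: x) =
      dotMap a.up (n 0) A p :: dotLine σ (fun i => n (i + 1)) (across a.up A p) x := rfl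

@[simp] theorem dotLine_empty (σ : List (Strand ι)) (n : ℕ → ℤ) (A : S) :
    dotLine (X := X) (G := G) σ n A [] = [] := by
  cases σ <;> rfl

@[simp] theorem length_dotLine (σ : List (Strand ι)) (n : ℕ → ℤ) (A : S) (x : List (X × G)) :
    (dotLine σ n A x).length = x.length := by
  induction σ generalizing n A x with
  | nil => simp
  | cons a σ ih => cases x <;> simp [ih]

theorem acrossAll_dotLine (σ : List (Strand ι)) (n : ℕ → ℤ) (A : S) (x : List (X × G)) :
    acrossAll σ A (dotLine σ n A x) = acrossAll σ A x := by
  induction σ generalizing n A x with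
  | nil => simp
  | cons a σ ih => cases x <;> simp [ih, across_dotMap]

theorem dotLine_append {σ : List (Strand ι)} {x : List (X × G)} (h : x.length = σ.length)
    (τ : List (Strand ι)) (n : ℕ → ℤ) (A : S) (y : List (X × G)) :
    dotLine (σ ++ τ) n A (x ++ y) =
      dotLine σ n A x ++ dotLine τ (fun i => n (σ.length + i)) (acrossAll σ A x) y := by
  induction σ generalizing n A x with
  | nil =>
    obtain rfl := List.length_eq_zero_iff.1 h
    simp
  | cons a σ ih =>
    cases x with
    | nil => simp at h
    | cons p x =>
      simp only [List.cons_append, dotLine_cons, acrossAll_cons]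
      rw [ih (by simpa using h)]
      congr 4
      funext i
      simp only [List.length_cons]
      congr 1
      omega

theorem dotLine_dotLine (σ : List (Strand ι)) (m n : ℕ → ℤ) (A : S) (x : List (X × G)) :
    dotLine σ n A (dotLine σ m A x) = dotLine σ (fun i => m i + n i) A x := by
  induction σ generalizing m n A x with
  | nil => simp
  | cons a σ ih => cases x <;> simp [ih, across_dotMap, dotMap_dotMap]

theorem dotLine_congr {σ : List (Strand ι)} {m n : ℕ → ℤ}
    (h : ∀ i < σ.length, (birackRank X : ℤ) ∣ m i - n i) (A : S) (x : List (X × G)) :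
    dotLine σ m A x = dotLine σ n A x := by
  induction σ generalizing m n A x with
  | nil => simp
  | cons a σ ih =>
    cases x with
    | nil => simp
    | cons p x =>
      rw [dotLine_cons, dotLine_cons, dotMap_congr _ (h 0 (by simp)),
        ih fun i hi => h (i + 1) (by simpa using hi)]

theorem dotLine_of_eq {σ : List (Strand ι)} {m n : ℕ → ℤ}
    (h : ∀ i < σ.length, m i = n i) (A : S) (x : List (X × G)) :
    dotLine σ m A x = dotLine σ n A x :=
  dotLine_congr (fun i hi => by rw [h i hi, sub_self]; exact dvd_zero _) A x

theorem dotLine_zero {σ : List (Strand ι)} {n : ℕ → ℤ} (h : ∀ i < σ.length, n i = 0) (A : S)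
    (x : List (X × G)) : dotLine σ n A x = x := by
  induction σ generalizing n A x with
  | nil => simp
  | cons a σ ih =>
    cases x with
    | nil => simp
    | cons p x =>
      rw [dotLine_cons, h 0 (by simp), dotMap_zero, ih fun i hi => h (i + 1) (by simpa using hi)]

/-- The relation between the labels with beads at the bottom and the top of a piece, where `A` is
the region on the left. -/
def PieceRule (A : S) : Piece ι → List (X × G) → List (X × G) → Prop
  | .cup _, x, y => x = [] ∧ ∃ p, y = [p, p]
  | .cap _, x, y => y = [] ∧ ∃ p, x = [p, p]
  | .cross k a b, x, y =>
    ∃ p q p' q', x = [p, q] ∧ y = [p', q'] ∧ CrossRel k a.up b.up A p q p' q'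
  | .bar a, x, y => ∃ p, x = [p] ∧ y = [barMap a.up A p]

theorem PieceRule.length_dom {A : S} {P : Piece ι} {x y : List (X × G)} (h : PieceRule A P x y) :
    x.length = P.dom.length := by
  cases P
  · rw [h.1]; rfl
  · obtain ⟨-, p, rfl⟩ := h; rfl
  · obtain ⟨p, q, p', q', rfl, -, -⟩ := h; rfl
  · obtain ⟨p, rfl, -⟩ := h; rfl

theorem PieceRule.length_cod {A : S} {P : Piece ι} {x y : List (X × G)} (h : PieceRule A P x y) :
    y.length = P.cod.length := by
  cases P
  · obtain ⟨-, p, rfl⟩ := h; rfl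
  · rw [h.1]; rfl
  · obtain ⟨p, q, p', q', -, rfl, -⟩ := h; rfl
  · obtain ⟨p, -, rfl⟩ := h; rfl

theorem PieceRule.acrossAll_eq {A : S} {P : Piece ι} {x y : List (X × G)} (h : PieceRule A P x y) :
    acrossAll P.dom A x = acrossAll P.cod A y := by
  cases P
  · obtain ⟨rfl, p, rfl⟩ := h
    simp [Piece.dom, Piece.cod, Strand.rev]
  · obtain ⟨rfl, p, rfl⟩ := h
    simp [Piece.dom, Piece.cod, Strand.rev]
  · obtain ⟨p, q, p', q', rfl, rfl, h⟩ := h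
    exact h.1
  · obtain ⟨p, rfl, rfl⟩ := h
    exact (across_barMap _ _ _ _ _).symm

theorem PieceRule.det {A : S} {P : Piece ι} (hP : ∀ a, P ≠ .cup a) {x y y' : List (X × G)}
    (h : PieceRule A P x y) (h' : PieceRule A P x y') : y = y' := by
  cases P
  · exact absurd rfl (hP _)
  · rw [h.1, h'.1]
  · obtain ⟨p, q, p', q', rfl, rfl, h⟩ := h
    obtain ⟨_, _, p₂, q₂, e, rfl, h'⟩ := h'
    simp only [List.cons.injEq, and_true] at e
    obtain ⟨rfl, rfl⟩ := e
    obtain ⟨rfl, rfl⟩ := h.top_unique h'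
    rfl
  · obtain ⟨p, rfl, rfl⟩ := h
    obtain ⟨_, e, rfl⟩ := h'
    simp only [List.cons.injEq, and_true] at e
    rw [e]

theorem PieceRule.codet {A : S} {P : Piece ι} (hP : ∀ a, P ≠ .cap a) {x x' y : List (X × G)}
    (h : PieceRule A P x y) (h' : PieceRule A P x' y) : x = x' := by
  cases P
  · rw [h.1, h'.1]
  · exact absurd rfl (hP _)
  · obtain ⟨p, q, p', q', rfl, rfl, h⟩ := h
    obtain ⟨p₂, q₂, _, _, rfl, e, h'⟩ := h'
    simp only [List.cons.injEq, and_true] at e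
    obtain ⟨rfl, rfl⟩ := e
    obtain ⟨rfl, rfl⟩ := h.bot_unique h'
    rfl
  case bar a =>
    obtain ⟨p, rfl, rfl⟩ := h
    obtain ⟨p', rfl, e⟩ := h'
    simp only [List.cons.injEq, and_true] at e
    have := congrArg (barMap a.up A) e
    rw [barMap_barMap, barMap_barMap] at this
    rw [this]

/-- Numbers of kinks on the strands at the bottom and top of a piece that can be moved through the
piece. -/
def PieceSlide (P : Piece ι) (m n : ℕ → ℤ) : Prop :=
  match P with
  | .cup _ => n 0 + n 1 = 0
  | .cap _ => m 0 + m 1 = 0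
  | .cross _ _ _ => m 0 = n 1 ∧ m 1 = n 0
  | .bar _ => m 0 = n 0

/-- At a minimum or maximum the two ends carry the same label in opposite directions, so numbers of
kinks with sum zero, read upward, have the same effect on both. At crossings and bars this is the
sliding of kinks. -/
theorem PieceRule.slide {A : S} {P : Piece ι} {m n : ℕ → ℤ} (hs : PieceSlide P m n)
    {x y : List (X × G)} (h : PieceRule A P x y) :
    PieceRule A P (dotLine P.dom m A x) (dotLine P.cod n A y) := by
  rcases P with a | a | ⟨k, a, b⟩ | a
  · obtain ⟨rfl, p, rfl⟩ := h
    have h1 : n 1 = -n 0 := by simp only [PieceSlide] at hs; omega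
    refine ⟨by simp, dotMap a.up (n 0) A p, ?_⟩
    simp only [Piece.cod, dotLine_cons, dotLine_nil, Strand.rev, dotMap_not, h1, neg_neg, zero_add]
  · obtain ⟨rfl, p, rfl⟩ := h
    have h1 : m 1 = -m 0 := by simp only [PieceSlide] at hs; omega
    refine ⟨by simp, dotMap a.up (m 0) A p, ?_⟩
    simp only [Piece.dom, dotLine_cons, dotLine_nil, Strand.rev, dotMap_not, h1, neg_neg, zero_add]
  · obtain ⟨p, q, p', q', rfl, rfl, h⟩ := h
    refine ⟨_, _, _, _, rfl, rfl, ?_⟩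
    simp only [zero_add]
    rw [hs.1, hs.2]
    have := (h.dot_left (n 1)).dot_right (n 0)
    rwa [across_dotMap] at this
  · obtain ⟨p, rfl, rfl⟩ := h
    refine ⟨_, rfl, ?_⟩
    simp only [Piece.cod, dotLine_cons, dotLine_nil]
    rw [dotMap_barMap, hs]

/-- The relation between the labels with beads at the bottom and the top of a slice, where `A` is
the leftmost region. -/
def LineRule (A : S) (s : Slice ι) (x y : List (X × G)) : Prop :=
  SliceRule acrossAll PieceRule A s x y

theorem LineRule.length_src {A : S} {s : Slice ι} {x y : List (X × G)} (h : LineRule A s x y) :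
    x.length = s.src.length := by
  obtain ⟨xl, xr, p, q, rfl, rfl, hl, hr, h⟩ := h
  simp [Slice.src, hl, hr, h.length_dom]

theorem LineRule.length_tgt {A : S} {s : Slice ι} {x y : List (X × G)} (h : LineRule A s x y) :
    y.length = s.tgt.length := by
  obtain ⟨xl, xr, p, q, rfl, rfl, hl, hr, h⟩ := h
  simp [Slice.tgt, hl, hr, h.length_cod]

theorem LineRule.det {A : S} {s : Slice ι} (hP : ∀ a, s.piece ≠ .cup a) {x y y' : List (X × G)}
    (h : LineRule A s x y) (h' : LineRule A s x y') : y = y' := by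
  obtain ⟨xl, xr, p, q, rfl, rfl, hl, hr, h⟩ := h
  obtain ⟨xl₂, xr₂, p₂, q₂, e, rfl, hl₂, hr₂, h'⟩ := h'
  obtain ⟨rfl, e'⟩ := List.append_inj e (hl.trans hl₂.symm)
  obtain ⟨rfl, rfl⟩ := List.append_inj e' (h.length_dom.trans h'.length_dom.symm)
  rw [h.det hP h']

theorem LineRule.codet {A : S} {s : Slice ι} (hP : ∀ a, s.piece ≠ .cap a) {x x' y : List (X × G)}
    (h : LineRule A s x y) (h' : LineRule A s x' y) : x = x' := by
  obtain ⟨xl, xr, p, q, rfl, rfl, hl, hr, h⟩ := h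
  obtain ⟨xl₂, xr₂, p₂, q₂, rfl, e, hl₂, hr₂, h'⟩ := h'
  obtain ⟨rfl, e'⟩ := List.append_inj e (hl.trans hl₂.symm)
  obtain ⟨rfl, rfl⟩ := List.append_inj e' (h.length_cod.trans h'.length_cod.symm)
  rw [h.codet hP h']

/-- Numbers of kinks on the strands at the bottom and top of a slice that can be moved through the
slice. -/
def Slide (s : Slice ι) (m n : ℕ → ℤ) : Prop :=
  (∀ i < s.left.length, m i = n i) ∧
  (∀ i < s.right.length, m (s.left.length + s.piece.dom.length + i)
    = n (s.left.length + s.piece.cod.length + i)) ∧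
  PieceSlide s.piece (fun i => m (s.left.length + i)) (fun i => n (s.left.length + i))

theorem LineRule.slide {A : S} {s : Slice ι} {m n : ℕ → ℤ} (hs : Slide s m n)
    {x y : List (X × G)} (h : LineRule A s x y) :
    LineRule A s (dotLine s.src m A x) (dotLine s.tgt n A y) := by
  obtain ⟨xl, xr, p, q, rfl, rfl, hl, hr, h⟩ := h
  obtain ⟨h₁, h₂, h₃⟩ := hs
  refine ⟨dotLine s.left m A xl, dotLine s.right (fun i => m (s.left.length + s.piece.dom.length + i))
    (acrossAll s.piece.dom (acrossAll s.left A xl) p) xr,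
    dotLine s.piece.dom (fun i => m (s.left.length + i)) (acrossAll s.left A xl) p,
    dotLine s.piece.cod (fun i => n (s.left.length + i)) (acrossAll s.left A xl) q,
    ?_, ?_, by simpa, by simpa, ?_⟩
  · rw [Slice.src, List.append_assoc, dotLine_append hl, dotLine_append h.length_dom]
    simp only [add_assoc]
  · rw [Slice.tgt, List.append_assoc, dotLine_append hl, dotLine_append h.length_cod,
      dotLine_of_eq h₁, h.acrossAll_eq, dotLine_of_eq h₂]
    simp only [add_assoc]
  · rw [acrossAll_dotLine]
    exact h.slide h₃

theorem lineRule_nil {A : S} {P : Piece ι} {r : List (Strand ι)} {x y : List (X × G)} :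
    LineRule A ⟨[], P, r⟩ x y ↔
      ∃ xr p q, x = p ++ xr ∧ y = q ++ xr ∧ xr.length = r.length ∧ PieceRule A P p q := by
  constructor
  · rintro ⟨xl, xr, p, q, rfl, rfl, hl, hr, h⟩
    obtain rfl := List.length_eq_zero_iff.1 hl
    exact ⟨xr, p, q, rfl, rfl, hr, by simpa using h⟩
  · rintro ⟨xr, p, q, rfl, rfl, hr, h⟩
    exact ⟨[], xr, p, q, rfl, rfl, rfl, hr, by simpa using h⟩

theorem lineRule_whisker {A : S} {l r : List (Strand ι)} {s : Slice ι} {xl xr x y : List (X × G)}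
    (hl : xl.length = l.length) (hr : xr.length = r.length) :
    LineRule A (s.whisker l r) (xl ++ (x ++ xr)) y ↔
      ∃ y', y = xl ++ (y' ++ xr) ∧ LineRule (acrossAll l A xl) s x y' := by
  constructor
  · rintro ⟨yl, yr, p, q, e, rfl, hl', hr', h⟩
    simp only [Slice.whisker, List.length_append] at hl' hr'
    obtain ⟨yl₁, yl₂, rfl, hyl⟩ : ∃ yl₁ yl₂, yl = yl₁ ++ yl₂ ∧ yl₁.length = l.length :=
      ⟨yl.take l.length, yl.drop l.length, (List.take_append_drop _ _).symm, by simp; omega⟩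
    obtain ⟨yr₁, yr₂, rfl, hyr⟩ : ∃ yr₁ yr₂, yr = yr₁ ++ yr₂ ∧ yr₁.length = s.right.length :=
      ⟨yr.take s.right.length, yr.drop s.right.length, (List.take_append_drop _ _).symm,
        by simp; omega⟩
    simp only [List.append_assoc] at e
    obtain ⟨rfl, e'⟩ := List.append_inj e (hl.trans hyl.symm)
    simp only [← List.append_assoc] at e'
    simp only [List.length_append] at hr' hl'
    obtain ⟨rfl, rfl⟩ := List.append_inj' e' (by omega)
    refine ⟨yl₂ ++ (q ++ yr₁), by simp, yl₂, yr₁, p, q, by simp, rfl, by omega, hyr, ?_⟩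
    simpa only [Slice.whisker, acrossAll_append hl] using h
  · rintro ⟨_, rfl, yl, yr, p, q, rfl, rfl, hl', hr', h⟩
    refine ⟨xl ++ yl, yr ++ xr, p, q, by simp, by simp, ?_, ?_, ?_⟩
    · simp [Slice.whisker, hl, hl']
    · simp [Slice.whisker, hr, hr']
    · simpa only [Slice.whisker, acrossAll_append hl] using h

theorem isPath_whisker {A : S} {l r : List (Strand ι)} {xl xr : List (X × G)}
    (hl : xl.length = l.length) (hr : xr.length = r.length) (W : List (Slice ι))
    {x z : List (X × G)} {ys : List (List (X × G))} :
    IsPath (LineRule A) (W.map (Slice.whisker l r)) (xl ++ (x ++ xr)) ys z ↔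
      ∃ ys' z', ys = ys'.map (fun y => xl ++ (y ++ xr)) ∧ z = xl ++ (z' ++ xr) ∧
        IsPath (LineRule (acrossAll l A xl)) W x ys' z' := by
  induction W generalizing x ys with
  | nil =>
    simp only [List.map_nil, isPath_nil]
    constructor
    · rintro ⟨rfl, rfl⟩
      exact ⟨[], x, rfl, rfl, rfl, rfl⟩
    · rintro ⟨_, _, rfl, rfl, rfl, rfl⟩
      exact ⟨rfl, rfl⟩
  | cons s W ih =>
    simp only [List.map_cons, isPath_cons, lineRule_whisker hl hr]
    constructor
    · rintro ⟨_, ys, rfl, ⟨y, rfl, h⟩, h'⟩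
      obtain ⟨ys', z', rfl, rfl, g⟩ := ih.1 h'
      exact ⟨y :: ys', z', rfl, rfl, y, ys', rfl, h, g⟩
    · rintro ⟨_, z', rfl, rfl, y, ys', rfl, h, h'⟩
      exact ⟨_, _, rfl, ⟨y, rfl, h⟩, ih.2 ⟨ys', z', rfl, rfl, h'⟩⟩

end Coloring

/-! ### Effect of the local moves on colorings -/

section LocalMoves

variable {ι : Type} {X : Type u} [TwistedVirtualBirack X] {S : Type v} [TwistedShadow X S]

open TwistedShadow (act)

variable {G : Type w} [AddCommGroup G] [Module (ShadowAlgebra X S) G]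

theorem lineRule_cons {A : S} {a : Strand ι} {l r : List (Strand ι)} {P : Piece ι} {p : X × G}
    {x y : List (X × G)} : LineRule A ⟨a :: l, P, r⟩ (p :: x) y ↔
      ∃ y', y = p :: y' ∧ LineRule (across a.up A p) ⟨l, P, r⟩ x y' := by
  have := lineRule_whisker (A := A) (l := [a]) (r := []) (s := ⟨l, P, r⟩) (xl := [p]) (xr := [])
    (x := x) (y := y) rfl rfl
  simpa [Slice.whisker] using this

theorem lineRule_cup {A : S} {a : Strand ι} {r : List (Strand ι)} {x y : List (X × G)} :
    LineRule A ⟨[], .cup a, r⟩ x y ↔ x.length = r.length ∧ ∃ p, y = p :: p :: x := by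
  rw [lineRule_nil]
  constructor
  · rintro ⟨xr, _, _, rfl, rfl, hr, rfl, p, rfl⟩
    exact ⟨hr, p, rfl⟩
  · rintro ⟨hr, p, rfl⟩
    exact ⟨x, [], [p, p], rfl, rfl, hr, rfl, p, rfl⟩

theorem lineRule_cap {A : S} {a : Strand ι} {r : List (Strand ι)} {p q : X × G}
    {x y : List (X × G)} : LineRule A ⟨[], .cap a, r⟩ (p :: q :: x) y ↔
      x.length = r.length ∧ p = q ∧ y = x := by
  rw [lineRule_nil]
  constructor
  · rintro ⟨xr, _, _, e, rfl, hr, rfl, p', rfl⟩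
    simp only [List.cons_append, List.nil_append, List.cons.injEq] at e
    obtain ⟨rfl, rfl, rfl⟩ := e
    exact ⟨hr, rfl, rfl⟩
  · rintro ⟨hr, rfl, rfl⟩
    exact ⟨y, [p, p], [], rfl, rfl, hr, rfl, p, rfl⟩

theorem lineRule_cross {A : S} {k : CrossKind} {a b : Strand ι} {r : List (Strand ι)} {p q : X × G}
    {x y : List (X × G)} : LineRule A ⟨[], .cross k a b, r⟩ (p :: q :: x) y ↔
      x.length = r.length ∧ ∃ p' q', y = p' :: q' :: x ∧ CrossRel k a.up b.up A p q p' q' := by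
  rw [lineRule_nil]
  constructor
  · rintro ⟨xr, _, _, e, rfl, hr, p₁, q₁, p', q', rfl, rfl, h⟩
    simp only [List.cons_append, List.nil_append, List.cons.injEq] at e
    obtain ⟨rfl, rfl, rfl⟩ := e
    exact ⟨hr, p', q', rfl, h⟩
  · rintro ⟨hr, p', q', rfl, h⟩
    exact ⟨x, [p, q], [p', q'], rfl, rfl, hr, p, q, p', q', rfl, rfl, h⟩

theorem lineRule_bar {A : S} {a : Strand ι} {r : List (Strand ι)} {p : X × G}
    {x y : List (X × G)} : LineRule A ⟨[], .bar a, r⟩ (p :: x) y ↔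
      x.length = r.length ∧ y = barMap a.up A p :: x := by
  rw [lineRule_nil]
  constructor
  · rintro ⟨xr, _, _, e, rfl, hr, p', rfl, rfl⟩
    simp only [List.cons_append, List.nil_append, List.cons.injEq] at e
    obtain ⟨rfl, rfl⟩ := e
    exact ⟨hr, rfl⟩
  · rintro ⟨hr, rfl⟩
    exact ⟨x, [p], _, rfl, rfl, hr, p, rfl, rfl⟩

variable (X S G) in
/-- Two words of slices with bottom strands `ρ` have the same labels with beads at the bottom and
the top, up to `e i` kinks on the `i`-th strand, and these determine all labels with beads. -/
def Thin (ρ : List (Strand ι)) (e : ℕ → ℤ) (m₁ m₂ : List (Slice ι)) : Prop :=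
  ∀ (A : S) (x z : List (X × G)), x.length = ρ.length →
    (Reach (LineRule A) m₁ x z ↔ Reach (LineRule A) m₂ (dotLine ρ e A x) z) ∧
      Rigid (LineRule A) m₁ x z ∧ Rigid (LineRule A) m₂ x z

theorem Thin.congr {ρ : List (Strand ι)} {e e' : ℕ → ℤ} {m₁ m₂ : List (Slice ι)}
    (h : Thin X S G ρ e m₁ m₂) (he : ∀ i < ρ.length, e i = e' i) : Thin X S G ρ e' m₁ m₂ := by
  intro A x z hx
  rw [← dotLine_of_eq he]
  exact h A x z hx

/-- Without minima, the bottom line determines all other lines, so rigidity is automatic. Dually,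
`thin_of_codet` is for words without maxima. -/
theorem thin_of_det {ρ : List (Strand ι)} {m₁ m₂ : List (Slice ι)}
    (h₁ : ∀ s ∈ m₁, ∀ a, s.piece ≠ .cup a) (h₂ : ∀ s ∈ m₂, ∀ a, s.piece ≠ .cup a)
    (h : ∀ (A : S) (x z : List (X × G)), x.length = ρ.length →
      (Reach (LineRule A) m₁ x z ↔ Reach (LineRule A) m₂ x z)) : Thin X S G ρ 0 m₁ m₂ := by
  refine fun A x z hx => ⟨?_,
    rigid_of_det (R := LineRule A) (fun s hs _ _ _ => LineRule.det (h₁ s hs)) _ _,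
    rigid_of_det (R := LineRule A) (fun s hs _ _ _ => LineRule.det (h₂ s hs)) _ _⟩
  rw [dotLine_zero (n := 0) (fun _ _ => rfl)]
  exact h A x z hx

theorem thin_of_codet {ρ : List (Strand ι)} {m₁ m₂ : List (Slice ι)}
    (h₁ : ∀ s ∈ m₁, ∀ a, s.piece ≠ .cap a) (h₂ : ∀ s ∈ m₂, ∀ a, s.piece ≠ .cap a)
    (h : ∀ (A : S) (x z : List (X × G)), x.length = ρ.length →
      (Reach (LineRule A) m₁ x z ↔ Reach (LineRule A) m₂ x z)) : Thin X S G ρ 0 m₁ m₂ := by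
  refine fun A x z hx => ⟨?_,
    rigid_of_codet (R := LineRule A) (fun s hs _ _ _ => LineRule.codet (h₁ s hs)) _ _,
    rigid_of_codet (R := LineRule A) (fun s hs _ _ _ => LineRule.codet (h₂ s hs)) _ _⟩
  rw [dotLine_zero (n := 0) (fun _ _ => rfl)]
  exact h A x z hx

/-- As both a minimum and a maximum occur, neither end alone need determine the line between them;
both ends together do. -/
theorem thin_zigzag_left (a : Strand ι) :
    Thin X S G [a] 0 [⟨[a], .cup a.rev, []⟩, ⟨[], .cap a, [a]⟩] [] := by
  intro A x z hx
  obtain ⟨p, rfl⟩ := List.length_eq_one_iff.1 hx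
  refine ⟨?_, ?_, rigid_nil _ _⟩
  · simp [-Prod.exists, reach_cons, reach_nil, lineRule_cons, lineRule_cup, lineRule_cap, eq_comm]
  · intro ys ys' h h'
    simp [-Prod.exists, isPath_cons, isPath_nil, lineRule_cons, lineRule_cup, lineRule_cap] at h h'
    rw [h.1, h'.1]

theorem thin_zigzag_right (a : Strand ι) :
    Thin X S G [a] 0 [⟨[], .cup a, [a]⟩, ⟨[a], .cap a.rev, []⟩] [] := by
  intro A x z hx
  obtain ⟨p, rfl⟩ := List.length_eq_one_iff.1 hx
  refine ⟨?_, ?_, rigid_nil _ _⟩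
  · simp [-Prod.exists, reach_cons, reach_nil, lineRule_cons, lineRule_cup, lineRule_cap, eq_comm]
  · intro ys ys' h h'
    simp [-Prod.exists, isPath_cons, isPath_nil, lineRule_cons, lineRule_cup, lineRule_cap] at h h'
    rw [h.1, h'.1]

theorem thin_cross_cap (k : CrossKind) (a c : Strand ι) :
    Thin X S G [a, c, a.rev] 0
      [⟨[], .cross k a c, [a.rev]⟩, ⟨[c], .cap a, []⟩]
      [⟨[a], .cross k.swap c a.rev, []⟩, ⟨[], .cap a, [c]⟩] := by
  refine thin_of_det (by simp) (by simp) fun A x z hx => ?_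
  obtain ⟨p, q, r, rfl⟩ := List.length_eq_three.1 hx
  simp [-Prod.exists, Strand.rev, reach_cons, reach_nil, lineRule_cons, lineRule_cup, lineRule_cap,
    lineRule_cross, lineRule_bar]
  refine exists_congr fun p' => and_congr_left fun _ => CrossRel.rot

theorem thin_cross_cup (k : CrossKind) (a c : Strand ι) :
    Thin X S G [c] 0
      [⟨[c], .cup a, []⟩, ⟨[], .cross k c a, [a.rev]⟩]
      [⟨[], .cup a, [c]⟩, ⟨[a], .cross k.swap a.rev c, []⟩] := by
  refine thin_of_codet (by simp) (by simp) fun A x z hx => ?_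
  obtain ⟨p, rfl⟩ := List.length_eq_one_iff.1 hx
  simp [-Prod.exists, Strand.rev, reach_cons, reach_nil, lineRule_cons, lineRule_cup, lineRule_cap,
    lineRule_cross, lineRule_bar]
  constructor
  · rintro ⟨u, p', q', rfl, h⟩
    -- A minimum is a maximum upside down, so the quarter turn is conjugated by `conv`.
    have h := (CrossRel.rot.1 h.conv).conv
    rw [k.swap_swap] at h
    exact ⟨p', q', u, rfl, h⟩
  · rintro ⟨p', q', u, rfl, h⟩
    have h := h.conv
    rw [k.swap_swap] at h
    have hr := CrossRel.rot (k := k.swap) (oa := a.up) (ob := c.up) (L := A) (p := p') (q := q')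
      (p' := p) (q' := u)
    rw [k.swap_swap] at hr
    have h := (hr.2 h).conv
    rw [k.swap_swap] at h
    exact ⟨u, p', q', rfl, h⟩

theorem thin_bar_cap (a : Strand ι) :
    Thin X S G [a, a.rev] 0
      [⟨[], .bar a, [a.rev]⟩, ⟨[], .cap a, []⟩]
      [⟨[a], .bar a.rev, []⟩, ⟨[], .cap a, []⟩] := by
  refine thin_of_det (by simp) (by simp) fun A x z hx => ?_
  obtain ⟨p, q, rfl⟩ := List.length_eq_two.1 hx
  simp [-Prod.exists, Strand.rev, reach_cons, reach_nil, lineRule_cons, lineRule_cup, lineRule_cap,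
    lineRule_cross, lineRule_bar]
  rintro -
  constructor
  · rintro rfl
    rw [← across_barMap a.up a.up A A p, barMap_not, barMap_barMap]
  · intro h
    have := congrArg (barMap (!a.up) (across a.up A p)) h
    rwa [barMap_barMap, barMap_not] at this

theorem thin_bar_cup (a : Strand ι) :
    Thin X S G [] 0
      [⟨[], .cup a, []⟩, ⟨[], .bar a, [a.rev]⟩]
      [⟨[], .cup a, []⟩, ⟨[a], .bar a.rev, []⟩] := by
  refine thin_of_codet (by simp) (by simp) fun A x z hx => ?_
  obtain rfl := List.length_eq_zero_iff.1 hx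
  simp [-Prod.exists, Strand.rev, reach_cons, reach_nil, lineRule_cons, lineRule_cup, lineRule_cap,
    lineRule_cross, lineRule_bar]
  constructor
  · rintro ⟨p, rfl⟩
    refine ⟨barMap a.up A p, ?_⟩
    rw [barMap_not, barMap_barMap]
  · rintro ⟨p, rfl⟩
    refine ⟨barMap a.up A p, ?_⟩
    rw [barMap_not, barMap_barMap]

theorem thin_two (k : CrossKind) (a b : Strand ι) :
    Thin X S G [a, b] 0
      [⟨[], .cross k a b, []⟩, ⟨[], .cross k.swap b a, []⟩]
      [] := by
  refine thin_of_det (by simp) (by simp) fun A x z hx => ?_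
  obtain ⟨p, q, rfl⟩ := List.length_eq_two.1 hx
  simp [-Prod.exists, Strand.rev, reach_cons, reach_nil, lineRule_cons, lineRule_cup, lineRule_cap,
    lineRule_cross, lineRule_bar]
  constructor
  · rintro ⟨p', q', h, p₁, q₁, rfl, h'⟩
    obtain ⟨rfl, rfl⟩ := h.conv.top_unique h'
    rfl
  · rintro rfl
    obtain ⟨p', q', h⟩ := CrossRel.exists_top k a.up b.up A p q
    exact ⟨p', q', h, p, q, rfl, h.conv⟩

theorem thin_three (k₁ k₂ k₃ : CrossKind) (hk : TripleAllowed k₁ k₂ k₃) (a b c : Strand ι) :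
    Thin X S G [a, b, c] 0
      [⟨[], .cross k₁ a b, [c]⟩, ⟨[b], .cross k₂ a c, []⟩, ⟨[], .cross k₃ b c, [a]⟩]
      [⟨[a], .cross k₃ b c, []⟩, ⟨[], .cross k₂ a c, [b]⟩, ⟨[c], .cross k₁ a b, []⟩] := by
  refine thin_of_det (by simp) (by simp) fun A x z hx => ?_
  obtain ⟨p, q, r, rfl⟩ := List.length_eq_three.1 hx
  simp [-Prod.exists, Strand.rev, reach_cons, reach_nil, lineRule_cons, lineRule_cup, lineRule_cap,
    lineRule_cross, lineRule_bar]
  have key := braidRel_of_allowed (X := X) (S := S) (G := G) hk a.up b.up c.up A p q r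
  constructor
  · rintro ⟨b₁, a₁, h₁, c₁, a', h₂, c', b', rfl, h₃⟩
    obtain ⟨c₂, b₂, a₂, g₁, g₂, g₃⟩ := (key a' b' c').1 ⟨b₁, a₁, c₁, h₁, h₂, h₃⟩
    exact ⟨c₂, b₂, g₁, c', a₂, g₂, b', a', rfl, g₃⟩
  · rintro ⟨c₂, b₂, g₁, c', a₂, g₂, b', a', rfl, g₃⟩
    obtain ⟨b₁, a₁, c₁, h₁, h₂, h₃⟩ := (key a' b' c').2 ⟨c₂, b₂, a₂, g₁, g₂, g₃⟩
    exact ⟨b₁, a₁, h₁, c₁, a', h₂, c', b', rfl, h₃⟩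

theorem thin_bar_bar (a : Strand ι) :
    Thin X S G [a] 0
      [⟨[], .bar a, []⟩, ⟨[], .bar a, []⟩]
      [] := by
  refine thin_of_det (by simp) (by simp) fun A x z hx => ?_
  obtain ⟨p, rfl⟩ := List.length_eq_one_iff.1 hx
  simp [-Prod.exists, Strand.rev, reach_cons, reach_nil, lineRule_cons, lineRule_cup, lineRule_cap,
    lineRule_cross, lineRule_bar]
  rw [barMap_barMap, eq_comm]

theorem thin_bar_virt_left (a b : Strand ι) :
    Thin X S G [a, b] 0
      [⟨[], .bar a, [b]⟩, ⟨[], .cross .virt a b, []⟩]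
      [⟨[], .cross .virt a b, []⟩, ⟨[b], .bar a, []⟩] := by
  refine thin_of_det (by simp) (by simp) fun A x z hx => ?_
  obtain ⟨p, q, rfl⟩ := List.length_eq_two.1 hx
  simp [-Prod.exists, Strand.rev, reach_cons, reach_nil, lineRule_cons, lineRule_cup, lineRule_cap,
    lineRule_cross, lineRule_bar]
  constructor
  · rintro ⟨p', q', rfl, h⟩
    have h := h.bar_left
    rw [barMap_barMap] at h
    refine ⟨_, _, h, ?_⟩
    rw [barMap_barMap]
  · rintro ⟨p', q', h, rfl⟩
    exact ⟨_, _, rfl, h.bar_left⟩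

theorem thin_bar_virt_right (a b : Strand ι) :
    Thin X S G [a, b] 0
      [⟨[a], .bar b, []⟩, ⟨[], .cross .virt a b, []⟩]
      [⟨[], .cross .virt a b, []⟩, ⟨[], .bar b, [a]⟩] := by
  refine thin_of_det (by simp) (by simp) fun A x z hx => ?_
  obtain ⟨p, q, rfl⟩ := List.length_eq_two.1 hx
  simp [-Prod.exists, Strand.rev, reach_cons, reach_nil, lineRule_cons, lineRule_cup, lineRule_cap,
    lineRule_cross, lineRule_bar]
  constructor
  · rintro ⟨p', q', rfl, h⟩
    have h := h.bar_right
    rw [barMap_barMap] at h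
    refine ⟨_, _, h, ?_⟩
    rw [barMap_barMap]
  · rintro ⟨p', q', h, rfl⟩
    exact ⟨_, _, rfl, h.bar_right⟩

theorem thin_bars_cross (k : CrossKind) (hk : k ≠ .virt) (a b : Strand ι) :
    Thin X S G [a, b] 0
      [⟨[], .bar a, [b]⟩, ⟨[a], .bar b, []⟩, ⟨[], .cross k a b, []⟩,
        ⟨[], .bar b, [a]⟩, ⟨[b], .bar a, []⟩]
      [⟨[], .cross .virt a b, []⟩, ⟨[], .cross k b a, []⟩, ⟨[], .cross .virt a b, []⟩] := by
  refine thin_of_det (by simp) (by simp) fun A x z hx => ?_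
  obtain ⟨p, q, rfl⟩ := List.length_eq_two.1 hx
  simp [-Prod.exists, Strand.rev, reach_cons, reach_nil, lineRule_cons, lineRule_cup, lineRule_cap,
    lineRule_cross, lineRule_bar]
  simp only [across_barMap]
  constructor
  · rintro ⟨p', q', h, rfl⟩
    have e : p' = barMap b.up A (barMap b.up A p') := (barMap_barMap _ _ _).symm
    have e' : q' = barMap a.up (across b.up A (barMap b.up A p'))
      (barMap a.up (across b.up A p') q') := by rw [across_barMap, barMap_barMap]
    rw [e, e'] at h
    obtain ⟨p₁, q₁, p₂, q₂, h₁, h₂, h₃⟩ := (CrossRel.bar_iff_virt hk).1 h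
    exact ⟨p₁, q₁, h₁, p₂, q₂, h₂, _, _, rfl, h₃⟩
  · rintro ⟨p₁, q₁, h₁, p₂, q₂, h₂, p', q', rfl, h₃⟩
    refine ⟨_, _, (CrossRel.bar_iff_virt hk).2 ⟨p₁, q₁, p₂, q₂, h₁, h₂, h₃⟩, ?_⟩
    rw [across_barMap, barMap_barMap, barMap_barMap]

/-- The curl acts like as many formal kinks as the sign of its crossing says, none if it is virtual.
Its loop contains a minimum and a maximum, but `right_kink_unique` shows that the labels at the two
ends determine it. -/
theorem thin_kink_right (k : CrossKind) (a : Strand ι) :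
    Thin X S G [a] (fun _ => (k.type a.up a.up).sign)
      [⟨[a], .cup a, []⟩, ⟨[], .cross k a a, [a.rev]⟩, ⟨[a], .cap a, []⟩] [] := by
  intro A x z hx
  obtain ⟨p, rfl⟩ := List.length_eq_one_iff.1 hx
  refine ⟨?_, ?_, rigid_nil _ _⟩
  · simp [-Prod.exists, Strand.rev, reach_cons, reach_nil, lineRule_cons, lineRule_cup,
      lineRule_cap, lineRule_cross]
    constructor
    · rintro ⟨u, q, h, rfl⟩
      rw [h.right_kink]
    · rintro rfl
      obtain ⟨u, h⟩ := CrossRel.exists_right_kink k a.up A p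
      exact ⟨u, _, h, rfl⟩
  · intro ys ys' h h'
    simp [-Prod.exists, Strand.rev, isPath_cons, isPath_nil, lineRule_cons, lineRule_cup,
      lineRule_cap, lineRule_cross] at h h'
    obtain ⟨u, q, rfl, g, rfl⟩ := h
    obtain ⟨u', q', rfl, g', e⟩ := h'
    simp only [List.cons.injEq, and_true] at e
    subst e
    rw [g.right_kink_unique g']

theorem thin_kink_left (k : CrossKind) (a : Strand ι) :
    Thin X S G [a] (fun _ => (k.type a.up a.up).sign)
      [⟨[], .cup a.rev, [a]⟩, ⟨[a.rev], .cross k a a, []⟩, ⟨[], .cap a.rev, [a]⟩] [] := by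
  intro A x z hx
  obtain ⟨p, rfl⟩ := List.length_eq_one_iff.1 hx
  refine ⟨?_, ?_, rigid_nil _ _⟩
  · simp [-Prod.exists, Strand.rev, reach_cons, reach_nil, lineRule_cons, lineRule_cup,
      lineRule_cap, lineRule_cross]
    constructor
    · rintro ⟨u, q, h, rfl⟩
      rw [h.left_kink]
    · rintro rfl
      obtain ⟨u, h⟩ := CrossRel.exists_left_kink k a.up A p
      exact ⟨u, _, h, rfl⟩
  · intro ys ys' h h'
    simp [-Prod.exists, Strand.rev, isPath_cons, isPath_nil, lineRule_cons, lineRule_cup,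
      lineRule_cap, lineRule_cross] at h h'
    obtain ⟨u, q, rfl, g, rfl⟩ := h
    obtain ⟨u', q', rfl, g', e⟩ := h'
    simp only [List.cons.injEq, and_true] at e
    subst e
    rw [g.left_kink_unique g']

theorem lineRule_concat {A : S} {P : Piece ι} {m : List (Strand ι)} {xl x y : List (X × G)}
    (hl : xl.length = m.length) (hx : x.length = P.dom.length) :
    LineRule A ⟨m, P, []⟩ (xl ++ x) y ↔
      ∃ q, y = xl ++ q ∧ PieceRule (acrossAll m A xl) P x q := by
  constructor
  · rintro ⟨xl', xr, p, q, e, rfl, hl', hr, h⟩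
    obtain rfl := List.length_eq_zero_iff.1 hr
    obtain ⟨rfl, rfl⟩ := List.append_inj e (hl.trans hl'.symm)
    exact ⟨q, by simp, by simpa using h⟩
  · rintro ⟨q, rfl, h⟩
    exact ⟨xl, [], x, q, by simp, by simp, hl, rfl, h⟩

theorem lineRule_prepend {A : S} {P : Piece ι} {r : List (Strand ι)} {x xr y : List (X × G)}
    (hx : x.length = P.dom.length) (hr : xr.length = r.length) :
    LineRule A ⟨[], P, r⟩ (x ++ xr) y ↔ ∃ q, y = q ++ xr ∧ PieceRule A P x q := by
  rw [lineRule_nil]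
  constructor
  · rintro ⟨xr', p, q, e, rfl, hr', h⟩
    obtain ⟨rfl, rfl⟩ := List.append_inj e (hx.trans h.length_dom.symm)
    exact ⟨q, rfl, h⟩
  · rintro ⟨q, rfl, h⟩
    exact ⟨xr, x, q, rfl, rfl, hr, h⟩

/-- The pieces act on disjoint groups of strands, and `P` does not change the region to the left of
`Q`. The middle line is composed of parts of the bottom and top lines, which gives rigidity also for
a minimum next to a maximum. -/
theorem thin_interchange (P Q : Piece ι) (m : List (Strand ι)) :
    Thin X S G (P.dom ++ m ++ Q.dom) 0 [⟨[], P, m ++ Q.dom⟩, ⟨P.cod ++ m, Q, []⟩]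
      [⟨P.dom ++ m, Q, []⟩, ⟨[], P, m ++ Q.cod⟩] := by
  intro A x z hx
  rw [dotLine_zero (n := 0) (fun _ _ => rfl)]
  obtain ⟨p, xm, q, rfl, hp, hm, hq⟩ : ∃ p xm q, x = p ++ (xm ++ q) ∧ p.length = P.dom.length ∧
      xm.length = m.length ∧ q.length = Q.dom.length := by
    simp only [List.length_append] at hx
    refine ⟨x.take P.dom.length, (x.drop P.dom.length).take m.length,
      (x.drop P.dom.length).drop m.length, by simp, ?_, ?_, ?_⟩ <;> simp <;> omega
  have h₁ : ∀ ys, IsPath (LineRule A) [⟨[], P, m ++ Q.dom⟩, ⟨P.cod ++ m, Q, []⟩] (p ++ (xm ++ q)) ys z ↔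
      ∃ p' q', ys = [p' ++ (xm ++ q), z] ∧ z = p' ++ (xm ++ q') ∧ PieceRule A P p p' ∧
        PieceRule (acrossAll (P.dom ++ m) A (p ++ xm)) Q q q' := by
    intro ys
    simp only [isPath_cons, isPath_nil]
    constructor
    · rintro ⟨_, _, rfl, g, y, _, rfl, g', rfl, rfl⟩
      obtain ⟨p', rfl, h⟩ := (lineRule_prepend hp (by simp [hm, hq])).1 g
      rw [← List.append_assoc] at g'
      obtain ⟨q', rfl, h'⟩ := (lineRule_concat (by simp [hm, h.length_cod]) hq).1 g'
      refine ⟨p', q', rfl, by simp, h, ?_⟩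
      rw [acrossAll_append h.length_dom, h.acrossAll_eq, ← acrossAll_append h.length_cod]
      exact h'
    · rintro ⟨p', q', rfl, rfl, h, h'⟩
      refine ⟨_, _, rfl, (lineRule_prepend hp (by simp [hm, hq])).2 ⟨p', rfl, h⟩, _, _, rfl, ?_,
        rfl, rfl⟩
      rw [← List.append_assoc, lineRule_concat (by simp [hm, h.length_cod]) hq]
      refine ⟨q', by simp, ?_⟩
      rw [acrossAll_append h.length_dom, h.acrossAll_eq, ← acrossAll_append h.length_cod] at h'
      exact h'
  have h₂ : ∀ ys, IsPath (LineRule A) [⟨P.dom ++ m, Q, []⟩, ⟨[], P, m ++ Q.cod⟩] (p ++ (xm ++ q)) ys z ↔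
      ∃ p' q', ys = [p ++ (xm ++ q'), z] ∧ z = p' ++ (xm ++ q') ∧ PieceRule A P p p' ∧
        PieceRule (acrossAll (P.dom ++ m) A (p ++ xm)) Q q q' := by
    intro ys
    simp only [isPath_cons, isPath_nil]
    constructor
    · rintro ⟨_, _, rfl, g, y, _, rfl, g', rfl, rfl⟩
      rw [← List.append_assoc] at g
      obtain ⟨q', rfl, h⟩ := (lineRule_concat (by simp [hm, hp]) hq).1 g
      rw [List.append_assoc] at g'
      obtain ⟨p', rfl, h'⟩ := (lineRule_prepend hp (by simp [hm, h.length_cod])).1 g'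
      exact ⟨p', q', by simp, rfl, h', h⟩
    · rintro ⟨p', q', rfl, rfl, h, h'⟩
      refine ⟨_, _, rfl, ?_, _, _, rfl,
        (lineRule_prepend hp (by simp [hm, h'.length_cod])).2 ⟨p', rfl, h⟩, rfl, rfl⟩
      rw [← List.append_assoc, lineRule_concat (by simp [hm, hp]) hq]
      exact ⟨q', by simp, h'⟩
  refine ⟨?_, ?_, ?_⟩
  · simp only [Reach, h₁, h₂]
    constructor
    · rintro ⟨_, p', q', -, h⟩
      exact ⟨_, p', q', rfl, h⟩
    · rintro ⟨_, p', q', -, h⟩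
      exact ⟨_, p', q', rfl, h⟩
  · intro ys ys' f f'
    obtain ⟨p', q', rfl, e, h, h'⟩ := (h₁ _).1 f
    obtain ⟨p₂, q₂, rfl, e', g, g'⟩ := (h₁ _).1 f'
    obtain ⟨rfl, -⟩ := List.append_inj (e.symm.trans e') (h.length_cod.trans g.length_cod.symm)
    rfl
  · intro ys ys' f f'
    obtain ⟨p', q', rfl, e, h, h'⟩ := (h₂ _).1 f
    obtain ⟨p₂, q₂, rfl, e', g, g'⟩ := (h₂ _).1 f'
    obtain ⟨-, e⟩ := List.append_inj (e.symm.trans e') (h.length_cod.trans g.length_cod.symm)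
    obtain ⟨-, rfl⟩ := List.append_inj e rfl
    rfl

/-- The contribution of a slice to the writhe of a component. -/
def Slice.writhe [DecidableEq ι] (i : ι) (s : Slice ι) : ℤ :=
  match s.piece with
  | .cross k a b => if a.comp = i ∧ b.comp = i then (k.type a.up b.up).sign else 0
  | _ => 0

/-- The sum of the contributions of the slices of a word to the writhe of a component. -/
def wordWrithe [DecidableEq ι] (i : ι) (W : List (Slice ι)) : ℤ := (W.map (Slice.writhe i)).sum

theorem CrossType.sign_flip (τ : CrossType) : τ.flip.sign = -τ.sign := by
  cases τ <;> rfl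

/-- A word of slices fits together with the strands `ρ` at the bottom and `τ` at the top. -/
def Chain : List (Strand ι) → List (Slice ι) → List (Strand ι) → Prop
  | ρ, [], τ => ρ = τ
  | ρ, s :: W, τ => s.src = ρ ∧ Chain s.tgt W τ

variable (X S) in
/-- Both sides of a local move have the same strands at the bottom and the top.  Either the move
removes its left side, which amounts to some kinks on the first strand; or both sides have the same
writhes and the same labels with beads at the bottom and the top, and all components on the left
side reach the bottom or the top. -/
theorem LocalMove.thin [DecidableEq ι] {m₁ m₂ : List (Slice ι)}
    (h : LocalMove m₁ m₂) : ∃ ρ τ, Chain ρ m₁ τ ∧ Chain ρ m₂ τ ∧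
      ((m₂ = [] ∧ ∃ a ρ' ε, ρ = a :: ρ' ∧ (∀ (G : Type w) [AddCommGroup G]
          [Module (ShadowAlgebra X S) G], Thin X S G ρ (Pi.single 0 ε) m₁ []) ∧
        ∀ i, wordWrithe i m₁ = if a.comp = i then ε else 0) ∨
      (m₁ ≠ [] ∧ m₂ ≠ [] ∧ (∀ (G : Type w) [AddCommGroup G]
          [Module (ShadowAlgebra X S) G], Thin X S G ρ 0 m₁ m₂) ∧ (∀ i, wordWrithe i m₁ = wordWrithe i m₂) ∧
        ∀ s ∈ m₁, ∀ a ∈ s.src, ∃ b ∈ ρ ++ τ, b.comp = a.comp)) := by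
  cases h
  case interchange P Q m =>
    refine ⟨_, P.cod ++ m ++ Q.cod, ?_, ?_, .inr ⟨by simp, by simp, fun G _ _ => thin_interchange P Q m, ?_, ?_⟩⟩
    · simp [Chain, Slice.src, Slice.tgt]
    · simp [Chain, Slice.src, Slice.tgt]
    · intro i
      simp [wordWrithe, Slice.writhe, add_comm]
    · intro s hs a ha
      refine ⟨a, ?_, rfl⟩
      simp only [List.mem_cons, List.not_mem_nil, or_false] at hs
      rcases hs with rfl | rfl <;> simp only [Slice.src, List.mem_append] at ha ⊢ <;> tauto
  case zigzag_left a =>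
    refine ⟨[a], [a], ?_, rfl, .inl ⟨rfl, a, [], 0, rfl, ?_, ?_⟩⟩
    · simp [Chain, Slice.src, Slice.tgt, Piece.dom, Piece.cod, Strand.rev]
    · rw [Pi.single_zero]
      exact fun G _ _ => thin_zigzag_left a
    · simp [wordWrithe, Slice.writhe]
  case zigzag_right a =>
    refine ⟨[a], [a], ?_, rfl, .inl ⟨rfl, a, [], 0, rfl, ?_, ?_⟩⟩
    · simp [Chain, Slice.src, Slice.tgt, Piece.dom, Piece.cod, Strand.rev]
    · rw [Pi.single_zero]
      exact fun G _ _ => thin_zigzag_right a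
    · simp [wordWrithe, Slice.writhe]
  case two k a b =>
    refine ⟨[a, b], [a, b], ?_, rfl, .inl ⟨rfl, a, [b], 0, rfl, ?_, ?_⟩⟩
    · simp [Chain, Slice.src, Slice.tgt, Piece.dom, Piece.cod, Strand.rev]
    · rw [Pi.single_zero]
      exact fun G _ _ => thin_two k a b
    · intro i
      simp [wordWrithe, Slice.writhe, CrossKind.type_swap, CrossType.sign_flip,
        k.type_comm b.up a.up, and_comm (a := b.comp = i)]
      split_ifs <;> simp
  case bar_bar a =>
    refine ⟨[a], [a], ?_, rfl, .inl ⟨rfl, a, [], 0, rfl, ?_, ?_⟩⟩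
    · simp [Chain, Slice.src, Slice.tgt, Piece.dom, Piece.cod, Strand.rev]
    · rw [Pi.single_zero]
      exact fun G _ _ => thin_bar_bar a
    · simp [wordWrithe, Slice.writhe]
  case kink_right k a =>
    refine ⟨[a], [a], ?_, rfl, .inl ⟨rfl, a, [], (k.type a.up a.up).sign, rfl, ?_, ?_⟩⟩
    · simp [Chain, Slice.src, Slice.tgt, Piece.dom, Piece.cod, Strand.rev]
    · exact fun G _ _ => (thin_kink_right k a).congr (by simp)
    · simp [wordWrithe, Slice.writhe]
  case kink_left k a =>
    refine ⟨[a], [a], ?_, rfl, .inl ⟨rfl, a, [], (k.type a.up a.up).sign, rfl, ?_, ?_⟩⟩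
    · simp [Chain, Slice.src, Slice.tgt, Piece.dom, Piece.cod, Strand.rev]
    · exact fun G _ _ => (thin_kink_left k a).congr (by simp)
    · simp [wordWrithe, Slice.writhe]
  case cross_cap k a c =>
    refine ⟨_, [c], ?_, ?_, .inr ⟨by simp, by simp, fun G _ _ => thin_cross_cap k a c, ?_, ?_⟩⟩
    · simp [Chain, Slice.src, Slice.tgt, Piece.dom, Piece.cod, Strand.rev]
    · simp [Chain, Slice.src, Slice.tgt, Piece.dom, Piece.cod, Strand.rev]
    · intro i
      simp [wordWrithe, Slice.writhe, CrossKind.type_rot, and_comm (a := c.comp = i), Strand.rev]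
    · simp [Slice.src, Piece.dom, Strand.rev]
      rintro _ ((rfl | rfl) | rfl) <;> simp
  case cross_cup k a c =>
    refine ⟨[c], [a, c, a.rev], ?_, ?_, .inr ⟨by simp, by simp, fun G _ _ => thin_cross_cup k a c, ?_, ?_⟩⟩
    · simp [Chain, Slice.src, Slice.tgt, Piece.dom, Piece.cod, Strand.rev]
    · simp [Chain, Slice.src, Slice.tgt, Piece.dom, Piece.cod, Strand.rev]
    · intro i
      simp [wordWrithe, Slice.writhe, Strand.rev, and_comm (a := c.comp = i), k.swap.type_comm (!a.up) c.up, CrossKind.type_rot, k.type_comm c.up a.up]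
    · simp [Slice.src, Piece.dom, Strand.rev]
      rintro _ ((rfl | rfl) | rfl) <;> simp
  case bar_cap a =>
    refine ⟨_, [], ?_, ?_, .inr ⟨by simp, by simp, fun G _ _ => thin_bar_cap a, ?_, ?_⟩⟩
    · simp [Chain, Slice.src, Slice.tgt, Piece.dom, Piece.cod, Strand.rev]
    · simp [Chain, Slice.src, Slice.tgt, Piece.dom, Piece.cod, Strand.rev]
    · intro i
      simp [wordWrithe, Slice.writhe]
    · simp [Slice.src, Piece.dom, Strand.rev]
  case bar_cup a =>
    refine ⟨[], [a, a.rev], ?_, ?_, .inr ⟨by simp, by simp, fun G _ _ => thin_bar_cup a, ?_, ?_⟩⟩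
    · simp [Chain, Slice.src, Slice.tgt, Piece.dom, Piece.cod, Strand.rev]
    · simp [Chain, Slice.src, Slice.tgt, Piece.dom, Piece.cod, Strand.rev]
    · intro i
      simp [wordWrithe, Slice.writhe]
    · simp [Slice.src, Piece.dom, Strand.rev]
  case three k₁ k₂ k₃ hk a b c =>
    refine ⟨_, [c, b, a], ?_, ?_, .inr ⟨by simp, by simp, fun G _ _ => thin_three k₁ k₂ k₃ hk a b c, ?_, ?_⟩⟩
    · simp [Chain, Slice.src, Slice.tgt, Piece.dom, Piece.cod, Strand.rev]
    · simp [Chain, Slice.src, Slice.tgt, Piece.dom, Piece.cod, Strand.rev]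
    · intro i
      simp only [wordWrithe, Slice.writhe, List.map_cons, List.map_nil, List.sum_cons, List.sum_nil]
      ring
    · simp [Slice.src, Piece.dom, Strand.rev]
      constructor <;> rintro _ ((rfl | rfl) | rfl) <;> simp
  case bar_virt_left a b =>
    refine ⟨_, [b, a], ?_, ?_, .inr ⟨by simp, by simp, fun G _ _ => thin_bar_virt_left a b, ?_, ?_⟩⟩
    · simp [Chain, Slice.src, Slice.tgt, Piece.dom, Piece.cod, Strand.rev]
    · simp [Chain, Slice.src, Slice.tgt, Piece.dom, Piece.cod, Strand.rev]
    · intro i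
      simp [wordWrithe, Slice.writhe]
    · simp [Slice.src, Piece.dom, Strand.rev]
  case bar_virt_right a b =>
    refine ⟨_, [b, a], ?_, ?_, .inr ⟨by simp, by simp, fun G _ _ => thin_bar_virt_right a b, ?_, ?_⟩⟩
    · simp [Chain, Slice.src, Slice.tgt, Piece.dom, Piece.cod, Strand.rev]
    · simp [Chain, Slice.src, Slice.tgt, Piece.dom, Piece.cod, Strand.rev]
    · intro i
      simp [wordWrithe, Slice.writhe]
    · simp [Slice.src, Piece.dom, Strand.rev]
  case bars_cross k hk a b =>
    refine ⟨_, [b, a], ?_, ?_, .inr ⟨by simp, by simp, fun G _ _ => thin_bars_cross k hk a b, ?_, ?_⟩⟩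
    · simp [Chain, Slice.src, Slice.tgt, Piece.dom, Piece.cod, Strand.rev]
    · simp [Chain, Slice.src, Slice.tgt, Piece.dom, Piece.cod, Strand.rev]
    · intro i
      have hv : (CrossKind.virt.type a.up b.up).sign = 0 := rfl
      simp [wordWrithe, Slice.writhe, hv, k.type_comm b.up a.up, and_comm (a := b.comp = i)]
    · simp [Slice.src, Piece.dom, Strand.rev]

end LocalMoves

/-! ### Naturality of the rules in the module of beads -/

section MapBeads

variable {ι : Type} {X : Type u} [TwistedVirtualBirack X] {S : Type v} [TwistedShadow X S]

open TwistedShadow (act)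

variable {G H : Type w} [AddCommGroup G] [Module (ShadowAlgebra X S) G]
  [AddCommGroup H] [Module (ShadowAlgebra X S) H]

/-- Apply a linear map to the bead. -/
noncomputable def mapBead (φ : G →ₗ[ShadowAlgebra X S] H) (p : X × G) : X × H := (p.1, φ p.2)

variable (φ : G →ₗ[ShadowAlgebra X S] H)

theorem map_unit_smul (c : (ShadowAlgebra X S)ˣ) (g : G) : φ (c • g) = c • φ g := by
  rw [Units.smul_def, map_smul, Units.smul_def]

theorem across_mapBead (o : Bool) (A : S) (p : X × G) :
    across o A (mapBead φ p) = across o A p := by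
  cases o <;> rfl

theorem rightOf_mapBead (o : Bool) (A : S) (p : X × G) :
    rightOf o A (mapBead φ p) = rightOf o A p := by
  cases o <;> rfl

theorem mapBead_kap (A : S) (p : X × G) : mapBead φ (kap A p) = kap A (mapBead φ p) :=
  Prod.ext rfl (map_unit_smul φ _ _)

theorem mapBead_kap_zpow (A : S) (z : ℤ) (p : X × G) :
    mapBead φ ((kap A ^ z) p) = (kap A ^ z) (mapBead φ p) := by
  have h : ∀ (n : ℕ) (p : X × G), mapBead φ ((kap A ^ n) p) = (kap A ^ n) (mapBead φ p) := by
    intro n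
    induction n with
    | zero => exact fun p => rfl
    | succ n ih =>
      intro p
      rw [pow_succ, pow_succ, Equiv.Perm.mul_apply, Equiv.Perm.mul_apply, ih, mapBead_kap]
  obtain ⟨n, rfl | rfl⟩ := z.eq_nat_or_neg
  · exact h n p
  · rw [zpow_neg, zpow_neg, Equiv.Perm.eq_inv_iff_eq, zpow_natCast, zpow_natCast, ← h,
      ← Equiv.Perm.mul_apply, mul_inv_cancel, Equiv.Perm.one_apply]

theorem mapBead_tau (A : S) (p : X × G) : mapBead φ (tau A p) = tau A (mapBead φ p) :=
  Prod.ext rfl (map_unit_smul φ _ _)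

theorem mapBead_dotMap (o : Bool) (z : ℤ) (A : S) (p : X × G) :
    mapBead φ (dotMap o z A p) = dotMap o z A (mapBead φ p) := by
  rw [dotMap, dotMap, mapBead_kap_zpow, rightOf_mapBead]

theorem mapBead_barMap (o : Bool) (A : S) (p : X × G) :
    mapBead φ (barMap o A p) = barMap o A (mapBead φ p) := by
  rw [barMap, barMap, mapBead_tau, rightOf_mapBead]

theorem Crosses.map {c : Bool} {A : S} {x y y' x' : X × G} (h : Crosses c A x y y' x') :
    Crosses c A (mapBead φ x) (mapBead φ y) (mapBead φ y') (mapBead φ x') := by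
  obtain ⟨h₁, h₂, h₃⟩ := h
  refine ⟨h₁, ?_, ?_⟩
  · rw [mapBead, h₂, map_unit_smul]; rfl
  · rw [mapBead, h₃, map_unit_smul]; rfl

theorem TypeRule.map {τ : CrossType} {A : S} {a b c d : X × G} (h : TypeRule τ A a b c d) :
    TypeRule τ A (mapBead φ a) (mapBead φ b) (mapBead φ c) (mapBead φ d) := by
  cases τ
  · exact Crosses.map φ h
  · exact Crosses.map φ h
  · exact Crosses.map φ h

theorem CrossRel.map {k : CrossKind} {oa ob : Bool} {L : S} {p q p' q' : X × G}
    (h : CrossRel k oa ob L p q p' q') :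
    CrossRel k oa ob L (mapBead φ p) (mapBead φ q) (mapBead φ p') (mapBead φ q') := by
  refine CrossRel.of_turned ?_
  obtain ⟨-, h⟩ := h
  cases oa <;> cases ob <;> exact TypeRule.map φ h

theorem acrossAll_mapBead (σ : List (Strand ι)) (A : S) (x : List (X × G)) :
    acrossAll σ A (x.map (mapBead φ)) = acrossAll σ A x := by
  induction σ generalizing A x with
  | nil => simp
  | cons a σ ih =>
    cases x with
    | nil => rfl
    | cons p x => rw [List.map_cons, acrossAll_cons, acrossAll_cons, ih, across_mapBead]

theorem map_dotLine (σ : List (Strand ι)) (n : ℕ → ℤ) (A : S) (x : List (X × G)) :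
    (dotLine σ n A x).map (mapBead φ) = dotLine σ n A (x.map (mapBead φ)) := by
  induction σ generalizing n A x with
  | nil => simp
  | cons a σ ih =>
    cases x with
    | nil => rfl
    | cons p x =>
      rw [List.map_cons, dotLine_cons, dotLine_cons, List.map_cons, ih, across_mapBead,
        mapBead_dotMap]

theorem PieceRule.map {A : S} {P : Piece ι} {x y : List (X × G)} (h : PieceRule A P x y) :
    PieceRule A P (x.map (mapBead φ)) (y.map (mapBead φ)) := by
  cases P
  · obtain ⟨rfl, p, rfl⟩ := h
    exact ⟨rfl, _, rfl⟩
  · obtain ⟨rfl, p, rfl⟩ := h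
    exact ⟨rfl, _, rfl⟩
  · obtain ⟨p, q, p', q', rfl, rfl, h⟩ := h
    exact ⟨_, _, _, _, rfl, rfl, h.map φ⟩
  · obtain ⟨p, rfl, rfl⟩ := h
    exact ⟨_, rfl, by rw [List.map_singleton, mapBead_barMap]⟩

theorem LineRule.map {A : S} {s : Slice ι} {x y : List (X × G)} (h : LineRule A s x y) :
    LineRule A s (x.map (mapBead φ)) (y.map (mapBead φ)) := by
  obtain ⟨xl, xr, p, q, rfl, rfl, hl, hr, h⟩ := h
  refine ⟨xl.map (mapBead φ), xr.map (mapBead φ), p.map (mapBead φ), q.map (mapBead φ), by simp,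
    by simp, by simpa, by simpa, ?_⟩
  rw [acrossAll_mapBead]
  exact h.map φ

end MapBeads

/-! ### Natural bijections between colorings of words -/

section DottedWords

variable {ι : Type} {X : Type u} [TwistedVirtualBirack X] {S : Type v} [TwistedShadow X S]

open TwistedShadow (act)

section

variable {G H : Type w} [AddCommGroup G] [Module (ShadowAlgebra X S) G]
  [AddCommGroup H] [Module (ShadowAlgebra X S) H]

/-- The rule for a slice with `s.1 i` positive kinks on the `i`-th strand below it. -/
def DotRule (A : S) (s : (ℕ → ℤ) × Slice ι) (x y : List (X × G)) : Prop :=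
  LineRule A s.2 (dotLine s.2.src s.1 A x) y

theorem DotRule.map (φ : G →ₗ[ShadowAlgebra X S] H) {A : S} {s : (ℕ → ℤ) × Slice ι}
    {x y : List (X × G)} (h : DotRule A s x y) :
    DotRule A s (x.map (mapBead φ)) (y.map (mapBead φ)) := by
  have := LineRule.map φ h
  rwa [map_dotLine] at this

theorem isPath_map (φ : G →ₗ[ShadowAlgebra X S] H) {A : S} {W : List ((ℕ → ℤ) × Slice ι)}
    {x z : List (X × G)} {ys : List (List (X × G))} (h : IsPath (DotRule A) W x ys z) :
    IsPath (DotRule A) W (x.map (mapBead φ)) (ys.map (List.map (mapBead φ)))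
      (z.map (mapBead φ)) := by
  have := IsPath.map (R' := DotRule (X := X) (S := S) (G := H) A) (e := id)
    (f := List.map (mapBead φ)) (fun s x y => DotRule.map φ) h
  rwa [List.map_id] at this

end

variable (X S) in
/-- The colorings of a word of slices with kinks by labels with beads: the region on the left, and
the labels with beads on the lines above the slices. -/
def Col (G : Type w) [AddCommGroup G] [Module (ShadowAlgebra X S) G]
    (W : List ((ℕ → ℤ) × Slice ι)) : Type (max u v w) :=
  {c : S × List (List (X × G)) // IsPath (DotRule c.1) W [] c.2 []}

/-- Apply a linear map to the beads of a coloring. -/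
noncomputable def Col.map {G H : Type w} [AddCommGroup G] [Module (ShadowAlgebra X S) G]
    [AddCommGroup H] [Module (ShadowAlgebra X S) H] (φ : G →ₗ[ShadowAlgebra X S] H)
    {W : List ((ℕ → ℤ) × Slice ι)} (c : Col X S G W) : Col X S H W :=
  ⟨(c.1.1, c.1.2.map (List.map (mapBead φ))), isPath_map φ c.2⟩

variable (X S) in
/-- Two words have equivalent colorings, naturally in the module of beads. -/
def Sim (W W' : List ((ℕ → ℤ) × Slice ι)) : Prop :=
  ∃ e : ∀ (G : Type w) [AddCommGroup G] [Module (ShadowAlgebra X S) G], Col X S G W ≃ Col X S G W',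
    ∀ (G H : Type w) [AddCommGroup G] [Module (ShadowAlgebra X S) G]
      [AddCommGroup H] [Module (ShadowAlgebra X S) H] (φ : G →ₗ[ShadowAlgebra X S] H)
      (c : Col X S G W), e H (c.map φ) = (e G c).map φ

namespace Sim

variable {W W' W'' : List ((ℕ → ℤ) × Slice ι)}

theorem refl (W : List ((ℕ → ℤ) × Slice ι)) : Sim.{u, v, w} X S W W :=
  ⟨fun _ _ _ => Equiv.refl _, fun _ _ _ _ _ _ _ _ => rfl⟩

theorem symm (h : Sim.{u, v, w} X S W W') : Sim.{u, v, w} X S W' W := by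
  obtain ⟨e, he⟩ := h
  refine ⟨fun G _ _ => (e G).symm, fun G H _ _ _ _ φ c => ?_⟩
  rw [Equiv.symm_apply_eq, he, Equiv.apply_symm_apply]

theorem trans (h : Sim.{u, v, w} X S W W') (h' : Sim.{u, v, w} X S W' W'') :
    Sim.{u, v, w} X S W W'' := by
  obtain ⟨e, he⟩ := h
  obtain ⟨e', he'⟩ := h'
  refine ⟨fun G _ _ => (e G).trans (e' G), fun G H _ _ _ _ φ c => ?_⟩
  simp [he, he']

/-- Paths with the required ends are only known to exist, so the bijections are described by
relations: one that is total and single-valued in both directions is the graph of a bijection, and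
its compatibility with linear maps gives naturality. -/
theorem of_rel
    (R : ∀ (G : Type w) [AddCommGroup G] [Module (ShadowAlgebra X S) G],
      Col X S G W → Col X S G W' → Prop)
    (h₁ : ∀ (G : Type w) [AddCommGroup G] [Module (ShadowAlgebra X S) G] (c : Col X S G W),
      ∃ c', R G c c')
    (h₂ : ∀ (G : Type w) [AddCommGroup G] [Module (ShadowAlgebra X S) G] (c : Col X S G W')
      , ∃ c', R G c' c)
    (h₃ : ∀ (G : Type w) [AddCommGroup G] [Module (ShadowAlgebra X S) G] (c : Col X S G W)
      (c' c'' : Col X S G W'), R G c c' → R G c c'' → c' = c'')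
    (h₄ : ∀ (G : Type w) [AddCommGroup G] [Module (ShadowAlgebra X S) G] (c c' : Col X S G W)
      (c'' : Col X S G W'), R G c c'' → R G c' c'' → c = c')
    (h₅ : ∀ (G H : Type w) [AddCommGroup G] [Module (ShadowAlgebra X S) G]
      [AddCommGroup H] [Module (ShadowAlgebra X S) H] (φ : G →ₗ[ShadowAlgebra X S] H)
      (c : Col X S G W) (c' : Col X S G W'), R G c c' → R H (c.map φ) (c'.map φ)) :
    Sim.{u, v, w} X S W W' := by
  choose f hf using h₁
  have hb : ∀ (G : Type w) [AddCommGroup G] [Module (ShadowAlgebra X S) G],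
      Function.Bijective (f G) := by
    intro G _ _
    refine ⟨fun c c' h => h₄ G c c' (f G c) (hf G c) (h ▸ hf G c'), fun c' => ?_⟩
    obtain ⟨c, hc⟩ := h₂ G c'
    exact ⟨c, h₃ G c _ _ (hf G c) hc⟩
  refine ⟨fun G _ _ => Equiv.ofBijective _ (hb G), fun G H _ _ _ _ φ c => ?_⟩
  exact h₃ H (c.map φ) _ _ (hf H _) (h₅ G H φ c _ (hf G c))

theorem of_iff (h : ∀ (G : Type w) [AddCommGroup G] [Module (ShadowAlgebra X S) G] (A : S)
    (ys : List (List (X × G))), IsPath (DotRule A) W [] ys [] ↔ IsPath (DotRule A) W' [] ys []) :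
    Sim.{u, v, w} X S W W' :=
  ⟨fun G _ _ => Equiv.subtypeEquivRight fun c => h G c.1 c.2, fun _ _ _ _ _ _ _ _ => rfl⟩

end Sim

variable (X S) in
/-- The paths along two words that start with `n` letters are in bijection, naturally in the module
of beads. -/
def LocalSim (n : ℕ) (M M' : List ((ℕ → ℤ) × Slice ι)) : Prop :=
  ∃ r : ∀ (G : Type w) [AddCommGroup G] [Module (ShadowAlgebra X S) G],
      S → List (List (X × G)) → List (List (X × G)) → Prop,
    (∀ (G : Type w) [AddCommGroup G] [Module (ShadowAlgebra X S) G] (A : S) (x z : List (X × G))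
      (ys : List (List (X × G))), x.length = n → IsPath (DotRule A) M x ys z →
      ∃ ys', IsPath (DotRule A) M' x ys' z ∧ r G A ys ys') ∧
    (∀ (G : Type w) [AddCommGroup G] [Module (ShadowAlgebra X S) G] (A : S) (x z : List (X × G))
      (ys' : List (List (X × G))), x.length = n → IsPath (DotRule A) M' x ys' z →
      ∃ ys, IsPath (DotRule A) M x ys z ∧ r G A ys ys') ∧
    (∀ (G : Type w) [AddCommGroup G] [Module (ShadowAlgebra X S) G] (A : S) (x z : List (X × G))
      (ys ys' ys'' : List (List (X × G))), x.length = n → IsPath (DotRule A) M x ys z →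
      IsPath (DotRule A) M' x ys' z → IsPath (DotRule A) M' x ys'' z → r G A ys ys' → r G A ys ys'' →
      ys' = ys'') ∧
    (∀ (G : Type w) [AddCommGroup G] [Module (ShadowAlgebra X S) G] (A : S) (x z : List (X × G))
      (ys ys' ys'' : List (List (X × G))), x.length = n → IsPath (DotRule A) M x ys z →
      IsPath (DotRule A) M x ys' z → IsPath (DotRule A) M' x ys'' z → r G A ys ys'' → r G A ys' ys'' →
      ys = ys') ∧
    (∀ (G H : Type w) [AddCommGroup G] [Module (ShadowAlgebra X S) G]
      [AddCommGroup H] [Module (ShadowAlgebra X S) H] (φ : G →ₗ[ShadowAlgebra X S] H)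
      (A : S) (ys ys' : List (List (X × G))), r G A ys ys' →
      r H A (ys.map (List.map (mapBead φ))) (ys'.map (List.map (mapBead φ))))

/-- Cut a coloring at both ends of the local word, exchange the middle part and keep the rest. `hn`
supplies the length of the line below the local word. -/
theorem LocalSim.sim {n : ℕ} {M M' : List ((ℕ → ℤ) × Slice ι)} (h : LocalSim.{u, v, w} X S n M M')
    {pre post : List ((ℕ → ℤ) × Slice ι)}
    (hn : ∀ (G : Type w) [AddCommGroup G] [Module (ShadowAlgebra X S) G] (A : S) (z : List (X × G))
      (ys : List (List (X × G))), IsPath (DotRule A) pre [] ys z → z.length = n) :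
    Sim.{u, v, w} X S (pre ++ M ++ post) (pre ++ M' ++ post) := by
  obtain ⟨r, h₁, h₂, h₃, h₄, h₅⟩ := h
  refine Sim.of_rel (fun G _ _ c c' => c.1.1 = c'.1.1 ∧ ∃ ys₁ ys ys' ys₃ y z,
      c.1.2 = ys₁ ++ ys ++ ys₃ ∧ c'.1.2 = ys₁ ++ ys' ++ ys₃ ∧ IsPath (DotRule c.1.1) pre [] ys₁ y ∧
      IsPath (DotRule c.1.1) M y ys z ∧ IsPath (DotRule c.1.1) M' y ys' z ∧
      IsPath (DotRule c.1.1) post z ys₃ [] ∧ r G c.1.1 ys ys') ?_ ?_ ?_ ?_ ?_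
  · rintro G _ _ ⟨⟨A, _⟩, h⟩
    obtain ⟨_, ys₃, z, rfl, h, g₃⟩ := isPath_append.1 h
    obtain ⟨ys₁, ys₂, y, rfl, g₁, g₂⟩ := isPath_append.1 h
    obtain ⟨ys', g, hr⟩ := h₁ G A y z ys₂ (hn G A y ys₁ g₁) g₂
    exact ⟨⟨(A, ys₁ ++ ys' ++ ys₃), isPath_append.2 ⟨_, _, z, rfl,
      isPath_append.2 ⟨_, _, y, rfl, g₁, g⟩, g₃⟩⟩, rfl, _, _, _, _, y, z, rfl, rfl, g₁, g₂, g, g₃, hr⟩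
  · rintro G _ _ ⟨⟨A, _⟩, h⟩
    obtain ⟨_, ys₃, z, rfl, h, g₃⟩ := isPath_append.1 h
    obtain ⟨ys₁, ys₂, y, rfl, g₁, g₂⟩ := isPath_append.1 h
    obtain ⟨ys', g, hr⟩ := h₂ G A y z ys₂ (hn G A y ys₁ g₁) g₂
    exact ⟨⟨(A, ys₁ ++ ys' ++ ys₃), isPath_append.2 ⟨_, _, z, rfl,
      isPath_append.2 ⟨_, _, y, rfl, g₁, g⟩, g₃⟩⟩, rfl, _, _, _, _, y, z, rfl, rfl, g₁, g, g₂, g₃, hr⟩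
  · rintro G _ _ ⟨⟨A, c⟩, hc⟩ ⟨⟨A', c'⟩, hc'⟩ ⟨⟨A'', c''⟩, hc''⟩
      ⟨eA, ys₁, ys, ys', ys₃, y, z, e₁, e₂, g₁, g₂, g, g₃, hr⟩
      ⟨eA', ys₁', zs, zs', ys₃', y', z', e₁', e₂', g₁', g₂', g', g₃', hr'⟩
    dsimp only at eA eA' e₁ e₂ e₁' e₂' g₁ g₂ g g₃ hr g₁' g₂' g' g₃' hr'
    -- The cut is unique: a path has one line for each letter, and these lines and its start
    -- determine its end.
    have e := e₁.symm.trans e₁'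
    rw [List.append_assoc, List.append_assoc] at e
    obtain ⟨rfl, f⟩ := List.append_inj e (g₁.length_eq.trans g₁'.length_eq.symm)
    obtain ⟨rfl, rfl⟩ := List.append_inj f (g₂.length_eq.trans g₂'.length_eq.symm)
    obtain rfl := g₁.target_unique g₁'
    obtain rfl := g₂.target_unique g₂'
    obtain rfl := h₃ G _ y z ys ys' zs' (hn G _ y _ g₁) g₂ g g' hr hr'
    exact Subtype.ext (Prod.ext (eA.symm.trans eA') (e₂.trans e₂'.symm))
  · rintro G _ _ ⟨⟨A, c⟩, hc⟩ ⟨⟨A', c'⟩, hc'⟩ ⟨⟨A'', c''⟩, hc''⟩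
      ⟨eA, ys₁, ys, ys', ys₃, y, z, e₁, e₂, g₁, g₂, g, g₃, hr⟩
      ⟨eA', ys₁', zs, zs', ys₃', y', z', e₁', e₂', g₁', g₂', g', g₃', hr'⟩
    dsimp only at eA eA' e₁ e₂ e₁' e₂' g₁ g₂ g g₃ hr g₁' g₂' g' g₃' hr'
    subst eA
    subst eA'
    have e := e₂.symm.trans e₂'
    rw [List.append_assoc, List.append_assoc] at e
    obtain ⟨rfl, f⟩ := List.append_inj e (g₁.length_eq.trans g₁'.length_eq.symm)
    obtain ⟨rfl, rfl⟩ := List.append_inj f (g.length_eq.trans g'.length_eq.symm)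
    obtain rfl := g₁.target_unique g₁'
    obtain rfl := g.target_unique g'
    obtain rfl := h₄ G _ y z ys zs ys' (hn G _ y _ g₁) g₂ g₂' g hr hr'
    exact Subtype.ext (Prod.ext rfl (e₁.trans e₁'.symm))
  · rintro G H _ _ _ _ φ ⟨⟨A, c⟩, hc⟩ ⟨⟨A', c'⟩, hc'⟩
      ⟨eA, ys₁, ys, ys', ys₃, y, z, e₁, e₂, g₁, g₂, g, g₃, hr⟩
    dsimp only at eA e₁ e₂ g₁ g₂ g g₃ hr
    exact ⟨eA, ys₁.map (List.map (mapBead φ)), ys.map (List.map (mapBead φ)),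
      ys'.map (List.map (mapBead φ)), ys₃.map (List.map (mapBead φ)), y.map (mapBead φ),
      z.map (mapBead φ), by simp [Col.map, e₁], by simp [Col.map, e₂], isPath_map φ g₁,
      isPath_map φ g₂, isPath_map φ g, isPath_map φ g₃, h₅ G H φ _ _ _ hr⟩

end DottedWords

/-! ### Words of slices that fit together -/

section Chains

variable {ι : Type}

theorem chain_append {ρ τ : List (Strand ι)} {W W' : List (Slice ι)} :
    Chain ρ (W ++ W') τ ↔ ∃ υ, Chain ρ W υ ∧ Chain υ W' τ := by
  induction W generalizing ρ with
  | nil => simp [Chain]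
  | cons s W ih => simp [Chain, ih, and_assoc]

theorem Chain.map_whisker (l r : List (Strand ι)) {ρ τ : List (Strand ι)} {W : List (Slice ι)}
    (h : Chain ρ W τ) : Chain (l ++ ρ ++ r) (W.map (Slice.whisker l r)) (l ++ τ ++ r) := by
  induction W generalizing ρ with
  | nil => exact congrArg (fun ρ => l ++ ρ ++ r) h
  | cons s W ih =>
    obtain ⟨rfl, h⟩ := h
    refine ⟨by simp [Slice.src, Slice.whisker], ?_⟩
    have := ih h
    simpa [Slice.tgt, Slice.whisker] using this

theorem chain_unique {ρ τ τ' : List (Strand ι)} {W : List (Slice ι)} (h : Chain ρ W τ)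
    (h' : Chain ρ W τ') : τ = τ' := by
  induction W generalizing ρ with
  | nil => exact h.symm.trans h'
  | cons s W ih => exact ih h.2 h'.2

theorem chain_of_tgt_eq {W : List (Slice ι)}
    (h : ∀ k s, W[k]? = some s → s.tgt = level W (k + 1)) : Chain (level W 0) W [] := by
  induction W with
  | nil => rfl
  | cons s W ih =>
    refine ⟨rfl, ?_⟩
    rw [h 0 s rfl]
    exact ih fun k s hs => h (k + 1) s hs

theorem Diagram.chain (D : Diagram ι) : Chain [] D.word [] := by
  have := chain_of_tgt_eq D.tgt_eq
  rwa [D.level_zero] at this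

theorem Chain.level_zero {ρ : List (Strand ι)} {W : List (Slice ι)} (h : Chain ρ W []) :
    level W 0 = ρ := by
  cases W with
  | nil => exact h.symm
  | cons s W => exact h.1

theorem Chain.tgt_eq {ρ : List (Strand ι)} {W : List (Slice ι)} (h : Chain ρ W []) :
    ∀ k s, W[k]? = some s → s.tgt = level W (k + 1) := by
  induction W generalizing ρ with
  | nil => simp
  | cons s W ih =>
    intro k t ht
    cases k with
    | zero =>
      obtain rfl : s = t := by simpa using ht
      exact h.2.level_zero.symm
    | succ k => exact ih h.2 k t ht

/-- The diagram of a word of slices that fits together. -/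
def Chain.diagram {W : List (Slice ι)} (h : Chain [] W []) : Diagram ι :=
  ⟨W, h.level_zero, h.tgt_eq⟩

theorem level_append_right (W W' : List (Slice ι)) (k : ℕ) :
    level (W ++ W') (W.length + k) = level W' k := by
  rw [level, level, List.getElem?_append_right (by omega), Nat.add_sub_cancel_left]

theorem level_append_left {W W' : List (Slice ι)} {k : ℕ} (h : k < W.length) :
    level (W ++ W') k = level W k := by
  rw [level, level, List.getElem?_append_left h]

end Chains

/-! ### Local changes of words with formal kinks -/

section Dotted

variable {ι : Type}

/-- A word of slices with `d k i` kinks on the `i`-th strand below the `k`-th slice. -/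
def dotted : List (Slice ι) → (ℕ → ℕ → ℤ) → List ((ℕ → ℤ) × Slice ι)
  | [], _ => []
  | s :: W, d => (d 0, s) :: dotted W fun k => d (k + 1)

theorem dotted_append (W W' : List (Slice ι)) (d : ℕ → ℕ → ℤ) :
    dotted (W ++ W') d = dotted W d ++ dotted W' fun k => d (W.length + k) := by
  induction W generalizing d with
  | nil => simp [dotted]
  | cons s W ih =>
    simp only [List.cons_append, dotted, ih, List.length_cons]
    congr 3
    funext k
    congr 1
    omega

theorem dotted_congr {W : List (Slice ι)} {d d' : ℕ → ℕ → ℤ} (h : ∀ k < W.length, d k = d' k) :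
    dotted W d = dotted W d' := by
  induction W generalizing d d' with
  | nil => rfl
  | cons s W ih =>
    rw [dotted, dotted, h 0 (by simp), ih fun k hk => h (k + 1) (by simpa using hk)]

variable {X : Type u} [TwistedVirtualBirack X] {S : Type v} [TwistedShadow X S]

section

variable {G : Type w} [AddCommGroup G] [Module (ShadowAlgebra X S) G]

theorem isPath_dotted_iff {W : List (Slice ι)} {d d' : ℕ → ℕ → ℤ}
    (h : ∀ k s, W[k]? = some s → ∀ i < s.src.length, (birackRank X : ℤ) ∣ d k i - d' k i)
    {A : S} {x z : List (X × G)} {ys : List (List (X × G))} :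
    IsPath (DotRule A) (dotted W d) x ys z ↔ IsPath (DotRule A) (dotted W d') x ys z := by
  induction W generalizing d d' x ys with
  | nil => rfl
  | cons s W ih =>
    simp only [dotted, isPath_cons, DotRule]
    simp only [dotLine_congr (h 0 s rfl), ih fun k t ht => h (k + 1) t ht]

theorem isPath_dotted_zero {W : List (Slice ι)} {d : ℕ → ℕ → ℤ} (h : ∀ k < W.length, d k = 0)
    {A : S} {x z : List (X × G)} {ys : List (List (X × G))} :
    IsPath (DotRule A) (dotted W d) x ys z ↔ IsPath (LineRule A) W x ys z := by
  induction W generalizing d x ys with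
  | nil => rfl
  | cons s W ih =>
    have h0 : ∀ x : List (X × G), dotLine s.src (d 0) A x = x := fun x =>
      dotLine_zero (fun i _ => by rw [h 0 (by simp)]; rfl) A x
    simp only [dotted, isPath_cons, DotRule, h0, ih fun k hk => h (k + 1) (by simpa using hk)]

theorem isPath_dotted_cons {s : Slice ι} {W : List (Slice ι)} {d : ℕ → ℕ → ℤ}
    (h : ∀ k < W.length, d (k + 1) = 0) {A : S} {x z : List (X × G)} {ys : List (List (X × G))} :
    IsPath (DotRule A) (dotted (s :: W) d) x ys z ↔
      IsPath (LineRule A) (s :: W) (dotLine s.src (d 0) A x) ys z := by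
  simp only [dotted, isPath_cons, DotRule, isPath_dotted_zero h]

theorem length_of_chain {ρ τ : List (Strand ι)} {W : List (Slice ι)} (hW : Chain ρ W τ)
    {d : ℕ → ℕ → ℤ} {A : S} {x z : List (X × G)} {ys : List (List (X × G))}
    (hx : x.length = ρ.length) (h : IsPath (DotRule A) (dotted W d) x ys z) :
    z.length = τ.length := by
  induction W generalizing d ρ x ys with
  | nil => rw [← h.2, hx, hW]
  | cons s W ih =>
    obtain ⟨y, ys, rfl, h, h'⟩ := h
    exact ih hW.2 h.length_tgt h'

theorem reach_whisker {A : S} {l r : List (Strand ι)} {xl xr : List (X × G)}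
    (hl : xl.length = l.length) (hr : xr.length = r.length) (W : List (Slice ι))
    {x z : List (X × G)} :
    Reach (LineRule A) (W.map (Slice.whisker l r)) (xl ++ (x ++ xr)) z ↔
      ∃ z', z = xl ++ (z' ++ xr) ∧ Reach (LineRule (acrossAll l A xl)) W x z' := by
  simp only [Reach, isPath_whisker hl hr]
  constructor
  · rintro ⟨_, ys, z', rfl, rfl, h⟩
    exact ⟨z', rfl, ys, h⟩
  · rintro ⟨z', rfl, ys, h⟩
    exact ⟨_, ys, z', rfl, rfl, h⟩

theorem rigid_whisker {A : S} {l r : List (Strand ι)} {xl xr : List (X × G)}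
    (hl : xl.length = l.length) (hr : xr.length = r.length) {W : List (Slice ι)}
    {x : List (X × G)} (h : ∀ z, Rigid (LineRule (acrossAll l A xl)) W x z) (z : List (X × G)) :
    Rigid (LineRule A) (W.map (Slice.whisker l r)) (xl ++ (x ++ xr)) z := by
  intro _ _ f f'
  obtain ⟨ys, z', rfl, rfl, g⟩ := (isPath_whisker hl hr W).1 f
  obtain ⟨ys', z'', rfl, e, g'⟩ := (isPath_whisker hl hr W).1 f'
  obtain rfl := List.append_cancel_right (List.append_cancel_left e)
  rw [h z' ys ys' g g']

theorem Thin.whisker {ρ : List (Strand ι)} {e e' : ℕ → ℤ} {m₁ m₂ : List (Slice ι)}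
    (h : Thin X S G ρ e m₁ m₂) (l r : List (Strand ι)) (hl : ∀ i < l.length, e' i = 0)
    (hρ : ∀ i < ρ.length, e' (l.length + i) = e i)
    (hr : ∀ i < r.length, e' (l.length + ρ.length + i) = 0) :
    Thin X S G (l ++ ρ ++ r) e' (m₁.map (Slice.whisker l r)) (m₂.map (Slice.whisker l r)) := by
  intro A x z hx
  obtain ⟨xl, x, xr, rfl, hxl, hx, hxr⟩ : ∃ xl y xr, x = xl ++ (y ++ xr) ∧
      xl.length = l.length ∧ y.length = ρ.length ∧ xr.length = r.length := by
    simp only [List.length_append] at hx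
    refine ⟨x.take l.length, (x.drop l.length).take ρ.length,
      (x.drop l.length).drop ρ.length, by simp, ?_, ?_, ?_⟩ <;> simp <;> omega
  refine ⟨?_, rigid_whisker hxl hxr (fun z => (h _ x z hx).2.1) z, ?_⟩
  · rw [List.append_assoc, dotLine_append hxl, dotLine_append hx, dotLine_zero hl,
      dotLine_of_eq hρ, dotLine_zero (σ := r) (fun i hi => by simpa [add_assoc] using hr i hi),
      reach_whisker hxl hxr, reach_whisker hxl hxr]
    simp only [fun z => (h (acrossAll l A xl) x z hx).1]
  · exact rigid_whisker hxl hxr (fun z => (h _ x z hx).2.2) z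

end

/-- Formal kinks occur only on the bottom line, the same ones for both words, so both words act on
the same modified line. By rigidity a path is determined by its ends; hence the relation that always
holds is enough. -/
theorem localSim_of_thin {σ : List (Strand ι)} {s₁ s₂ : Slice ι} {t₁ t₂ : List (Slice ι)}
    (h : ∀ (G : Type w) [AddCommGroup G] [Module (ShadowAlgebra X S) G],
      Thin X S G σ 0 (s₁ :: t₁) (s₂ :: t₂)) (h₁ : s₁.src = σ) (h₂ : s₂.src = σ)
    {d₁ d₂ : ℕ → ℕ → ℤ} (hd : d₁ 0 = d₂ 0) (hd₁ : ∀ k < t₁.length, d₁ (k + 1) = 0)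
    (hd₂ : ∀ k < t₂.length, d₂ (k + 1) = 0) :
    LocalSim.{u, v, w} X S σ.length (dotted (s₁ :: t₁) d₁) (dotted (s₂ :: t₂) d₂) := by
  refine ⟨fun _ _ _ _ _ _ => True, ?_, ?_, ?_, ?_, fun _ _ _ _ _ _ _ _ _ _ _ => trivial⟩
  · intro G _ _ A x z ys hx g
    rw [isPath_dotted_cons hd₁] at g
    have := (h G A (dotLine s₁.src (d₁ 0) A x) z (by simpa)).1.1 ⟨ys, g⟩
    rw [dotLine_zero (n := 0) (fun _ _ => rfl), h₁, ← h₂, hd] at this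
    obtain ⟨ys', g'⟩ := this
    exact ⟨ys', (isPath_dotted_cons hd₂).2 g', trivial⟩
  · intro G _ _ A x z ys hx g
    rw [isPath_dotted_cons hd₂, ← hd, h₂, ← h₁] at g
    have hr := (h G A (dotLine s₁.src (d₁ 0) A x) z (by simpa)).1
    rw [dotLine_zero (n := 0) (fun _ _ => rfl)] at hr
    obtain ⟨ys', g'⟩ := hr.2 ⟨ys, g⟩
    exact ⟨ys', (isPath_dotted_cons hd₁).2 g', trivial⟩
  · intro G _ _ A x z _ ys ys' hx _ g g' _ _
    rw [isPath_dotted_cons hd₂] at g g'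
    exact (h G A _ z (by simpa)).2.2 _ _ g g'
  · intro G _ _ A x z ys ys' _ hx g g' _ _ _
    rw [isPath_dotted_cons hd₁] at g g'
    exact (h G A _ z (by simpa)).2.1 _ _ g g'

/-- Formal kinks sit below slices. The kinks `e` that replace the removed word therefore need the
next slice `s`, which is made part of the local word. -/
theorem localSim_remove {σ : List (Strand ι)} {e : ℕ → ℤ} {m : List (Slice ι)} {s : Slice ι}
    (h : ∀ (G : Type w) [AddCommGroup G] [Module (ShadowAlgebra X S) G], Thin X S G σ e m [])
    (hs : s.src = σ) {d : ℕ → ℕ → ℤ} (hd : ∀ k < m.length, d k = 0) (n : ℕ → ℤ) :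
    LocalSim.{u, v, w} X S σ.length (dotted m d ++ [(n, s)]) [(fun i => e i + n i, s)] := by
  have hM : ∀ (G : Type w) [AddCommGroup G] [Module (ShadowAlgebra X S) G] (A : S)
      (x z : List (X × G)) (ys : List (List (X × G))), x.length = σ.length →
      (IsPath (DotRule A) (dotted m d ++ [(n, s)]) x ys z ↔ ∃ ys', ys = ys' ++ [z] ∧
        IsPath (LineRule A) m x ys' (dotLine σ e A x) ∧
        DotRule A (fun i => e i + n i, s) x z) := by
    intro G _ _ A x z ys hx
    simp only [isPath_append, isPath_dotted_zero hd, isPath_cons, isPath_nil]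
    constructor
    · rintro ⟨ys₁, _, y, rfl, g, _, _, rfl, g', rfl, rfl⟩
      have hy := (h G A x y hx).1.1 ⟨_, g⟩
      rw [reach_nil] at hy
      subst hy
      refine ⟨ys₁, rfl, g, ?_⟩
      rw [DotRule, hs, dotLine_dotLine] at g'
      rwa [DotRule, hs]
    · rintro ⟨ys', rfl, g, g'⟩
      refine ⟨ys', _, _, rfl, g, _, _, rfl, ?_, rfl, rfl⟩
      rw [DotRule, hs] at g'
      rwa [DotRule, hs, dotLine_dotLine]
  refine ⟨fun _ _ _ _ _ _ => True, ?_, ?_, ?_, ?_, fun _ _ _ _ _ _ _ _ _ _ _ => trivial⟩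
  · intro G _ _ A x z ys hx g
    obtain ⟨ys', rfl, g, g'⟩ := (hM G A x z ys hx).1 g
    exact ⟨[z], ⟨z, [], rfl, g', rfl, rfl⟩, trivial⟩
  · rintro G _ _ A x z _ hx ⟨_, _, rfl, g, rfl, rfl⟩
    obtain ⟨ys, g'⟩ := (h G A x (dotLine σ e A x) hx).1.2 (reach_nil.2 rfl)
    exact ⟨ys ++ [_], (hM G A x _ _ hx).2 ⟨ys, rfl, g', g⟩, trivial⟩
  · rintro G _ _ A x z _ _ _ hx - ⟨_, _, rfl, -, rfl, rfl⟩ ⟨_, _, rfl, -, rfl, rfl⟩ - -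
    rfl
  · intro G _ _ A x z ys ys' _ hx g g' _ _ _
    obtain ⟨ys, rfl, g, -⟩ := (hM G A x z _ hx).1 g
    obtain ⟨ys', rfl, g', -⟩ := (hM G A x z _ hx).1 g'
    rw [(h G A x _ hx).2.1 _ _ g g']

theorem Slide.neg {s : Slice ι} {m n : ℕ → ℤ} (h : Slide s m n) :
    Slide s (fun i => -m i) (fun i => -n i) := by
  obtain ⟨h₁, h₂, h₃⟩ := h
  refine ⟨fun i hi => congrArg Neg.neg (h₁ i hi), fun i hi => congrArg Neg.neg (h₂ i hi), ?_⟩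
  cases hP : s.piece <;> rw [hP] at h₃ <;> simp only [PieceSlide] at h₃ ⊢ <;> omega

/-- Colorings record each line before the formal kinks on it act. Moving kinks from below `s` to
below `t` thus changes exactly the line between the two slices, by `dotLine`. -/
theorem localSim_slide {s t : Slice ι} {e g : ℕ → ℤ} (h : Slide s e g) (hst : t.src = s.tgt)
    (l : ℕ) (n₁ n₂ : ℕ → ℤ) :
    LocalSim.{u, v, w} X S l [(n₁ + e, s), (n₂, t)] [(n₁, s), (n₂ + g, t)] := by
  have hc : ∀ (G : Type w) [AddCommGroup G] [Module (ShadowAlgebra X S) G] (A : S) (m : ℕ → ℤ)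
      (σ : List (Strand ι)) (x : List (X × G)),
      dotLine σ (fun i => -m i) A (dotLine σ m A x) = x ∧
        dotLine σ m A (dotLine σ (fun i => -m i) A x) = x := by
    intro G _ _ A m σ x
    rw [dotLine_dotLine, dotLine_dotLine]
    exact ⟨dotLine_zero (by simp) _ _, dotLine_zero (by simp) _ _⟩
  refine ⟨fun G _ _ A ys ys' => ∃ y y₂, ys = [dotLine s.tgt g A y, y₂] ∧ ys' = [y, y₂],
    ?_, ?_, ?_, ?_, ?_⟩
  · rintro G _ _ A x z _ - ⟨y, _, rfl, h₁, y₂, _, rfl, h₂, rfl, rfl⟩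
    obtain ⟨y, rfl⟩ : ∃ y', y = dotLine s.tgt g A y' := ⟨_, (hc G A g s.tgt y).2.symm⟩
    refine ⟨_, ⟨y, _, rfl, ?_, y₂, _, rfl, ?_, rfl, rfl⟩, _, _, rfl, rfl⟩
    · have h₁' : LineRule A s (dotLine s.src (n₁ + e) A x) (dotLine s.tgt g A y) := h₁
      have := h₁'.slide h.neg
      rw [(hc G A g s.tgt y).1, dotLine_dotLine] at this
      rw [DotRule]
      simpa using this
    · have h₂' : LineRule A t (dotLine t.src n₂ A (dotLine s.tgt g A y)) y₂ := h₂
      rw [hst, dotLine_dotLine] at h₂'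
      rw [DotRule, hst]
      refine cast (congrArg (fun f => LineRule A t (dotLine s.tgt f A y) y₂) ?_) h₂'
      funext i
      simp [add_comm]
  · rintro G _ _ A x z _ - ⟨y, _, rfl, h₁, y₂, _, rfl, h₂, rfl, rfl⟩
    refine ⟨_, ⟨dotLine s.tgt g A y, _, rfl, ?_, y₂, _, rfl, ?_, rfl, rfl⟩, _, _, rfl, rfl⟩
    · have h₁' : LineRule A s (dotLine s.src n₁ A x) y := h₁
      have := h₁'.slide h
      rw [dotLine_dotLine] at this
      exact this
    · have h₂' : LineRule A t (dotLine t.src (n₂ + g) A y) y₂ := h₂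
      rw [DotRule]
      dsimp only
      rw [hst, dotLine_dotLine]
      rw [hst] at h₂'
      refine cast (congrArg (fun f => LineRule A t (dotLine s.tgt f A y) y₂) ?_) h₂'
      funext i
      simp [add_comm]
  · rintro G _ _ A x z _ _ _ - - - - ⟨y, y₂, rfl, rfl⟩ ⟨y', y₂', e, rfl⟩
    simp only [List.cons.injEq, and_true] at e
    obtain ⟨e, rfl⟩ := e
    rw [← (hc G A g s.tgt y).1, e, (hc G A g s.tgt y').1]
  · rintro G _ _ A x z _ _ _ - - - - ⟨y, y₂, rfl, rfl⟩ ⟨y', y₂', rfl, e⟩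
    simp only [List.cons.injEq, and_true] at e
    obtain ⟨rfl, rfl⟩ := e
    rfl
  · rintro G H _ _ _ _ φ A _ _ ⟨y, y₂, rfl, rfl⟩
    exact ⟨y.map (mapBead φ), y₂.map (mapBead φ), by simp [map_dotLine], rfl⟩

/-- If `e` slides to no kinks at all, like opposite kinks at a maximum, it has no effect. No slice
above `s` is needed, so this also covers the last slice of a diagram. -/
theorem localSim_cap {s : Slice ι} {e : ℕ → ℤ} (h : Slide s e 0) (l : ℕ) (n : ℕ → ℤ) :
    LocalSim.{u, v, w} X S l [(n + e, s)] [(n, s)] := by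
  have hc : ∀ (G : Type w) [AddCommGroup G] [Module (ShadowAlgebra X S) G] (A : S)
      (x z : List (X × G)), DotRule A (n + e, s) x z ↔ DotRule A (n, s) x z := by
    intro G _ _ A x z
    have h0 : ∀ (σ : List (Strand ι)) (z : List (X × G)), dotLine σ 0 A z = z :=
      fun σ z => dotLine_zero (n := 0) (fun _ _ => rfl) A z
    have h0' : ∀ (σ : List (Strand ι)) (z : List (X × G)),
        dotLine σ (fun i => -(0 : ℕ → ℤ) i) A z = z := fun σ z => dotLine_zero (by simp) A z
    constructor
    · intro g
      have := LineRule.slide h.neg g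
      rw [dotLine_dotLine, h0'] at this
      rw [DotRule]
      simpa using this
    · intro g
      have := LineRule.slide h g
      rw [dotLine_dotLine, h0] at this
      exact this
  have hc' : ∀ (G : Type w) [AddCommGroup G] [Module (ShadowAlgebra X S) G] (A : S)
      (x z : List (X × G)) (ys : List (List (X × G))),
      IsPath (DotRule A) [(n + e, s)] x ys z ↔ IsPath (DotRule A) [(n, s)] x ys z := by
    intro G _ _ A x z ys
    simp only [isPath_cons, hc]
  refine ⟨fun _ _ _ _ ys ys' => ys = ys', ?_, ?_, ?_, ?_, ?_⟩
  · exact fun G _ _ A x z ys _ g => ⟨ys, (hc' G A x z ys).1 g, rfl⟩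
  · exact fun G _ _ A x z ys _ g => ⟨ys, (hc' G A x z ys).2 g, rfl⟩
  · exact fun G _ _ A x z ys ys' ys'' _ _ _ _ h h' => h.symm.trans h'
  · exact fun G _ _ A x z ys ys' ys'' _ _ _ _ h h' => h.trans h'.symm
  · rintro G H _ _ _ _ φ A _ _ rfl
    rfl

end Dotted

/-! ### Moving formal kinks along components -/

section MoveDots

variable {ι : Type} {X : Type u} [TwistedVirtualBirack X] {S : Type v} [TwistedShadow X S]

/-- `z` kinks at the point `p.2` of the line `p.1`. -/
def dot (p : ℕ × ℕ) (z : ℤ) : ℕ → ℕ → ℤ := Pi.single p.1 (Pi.single p.2 z)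

theorem dot_add (p : ℕ × ℕ) (y z : ℤ) : dot p (y + z) = dot p y + dot p z := by
  rw [dot, Pi.single_add, Pi.single_add]
  rfl

theorem dot_of_ne {p : ℕ × ℕ} {k : ℕ} (h : k ≠ p.1) (z : ℤ) : dot p z k = 0 :=
  Pi.single_eq_of_ne h _

theorem Sim.of_localSim {ρ : List (Strand ι)} {pre : List (Slice ι)} (hpre : Chain [] pre ρ)
    {M M' : List ((ℕ → ℤ) × Slice ι)} (h : LocalSim.{u, v, w} X S ρ.length M M') (d : ℕ → ℕ → ℤ)
    (Q : List ((ℕ → ℤ) × Slice ι)) :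
    Sim.{u, v, w} X S (dotted pre d ++ M ++ Q) (dotted pre d ++ M' ++ Q) :=
  h.sim fun _ _ _ _ _ _ g => length_of_chain hpre (by simp) g

theorem Sim.slide {W : List (Slice ι)} {τ : List (Strand ι)} (hW : Chain [] W τ) {k : ℕ}
    {s t : Slice ι} (hs : W[k]? = some s) (ht : W[k + 1]? = some t) {e g : ℕ → ℤ}
    (h : Slide s e g) (d : ℕ → ℕ → ℤ) :
    Sim.{u, v, w} X S (dotted W (d + Pi.single k e)) (dotted W (d + Pi.single (k + 1) g)) := by
  obtain ⟨hk, hs⟩ := List.getElem?_eq_some_iff.1 hs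
  obtain ⟨hk', ht⟩ := List.getElem?_eq_some_iff.1 ht
  obtain ⟨pre, post, rfl, rfl⟩ : ∃ pre post, W = pre ++ ([s, t] ++ post) ∧ pre.length = k := by
    refine ⟨W.take k, W.drop (k + 2), ?_, by simp; omega⟩
    conv_lhs => rw [← List.take_append_drop k W, List.drop_eq_getElem_cons hk,
      List.drop_eq_getElem_cons hk', hs, ht]
    simp
  obtain ⟨ρ, hpre, hW⟩ := chain_append.1 hW
  have hst : t.src = s.tgt := hW.2.1
  have := Sim.of_localSim (d := d) hpre (localSim_slide.{u, v, w} (X := X) (S := S) h hst _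
    (d pre.length) (d (pre.length + 1))) (dotted post fun k => d (pre.length + (k + 2)))
  convert this using 1
  · rw [dotted_append, dotted_append, List.append_assoc]
    congr 1
    · refine dotted_congr fun k hk => ?_
      simp [hk.ne]
    · simp only [dotted, Pi.add_apply, List.cons_append, List.nil_append]
      refine congrArg₂ _ (by simp) (congrArg₂ _ (by simp) ?_)
      refine dotted_congr fun k _ => ?_
      have hne : pre.length + ([s, t].length + k) ≠ pre.length := by simp
      rw [Pi.single_eq_of_ne hne, add_zero]
      congr 1
      simp [add_comm]
  · rw [dotted_append, dotted_append, List.append_assoc]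
    congr 1
    · refine dotted_congr fun k hk => ?_
      simp [show k ≠ pre.length + 1 by omega]
    · simp only [dotted, Pi.add_apply, List.cons_append, List.nil_append]
      refine congrArg₂ _ (by simp) (congrArg₂ _ (by simp) ?_)
      refine dotted_congr fun k _ => ?_
      have hne : pre.length + ([s, t].length + k) ≠ pre.length + 1 := by
        simp only [List.length_cons, List.length_nil]
        omega
      rw [Pi.single_eq_of_ne hne, add_zero]
      congr 1
      simp [add_comm]

theorem Sim.slide_cap {W : List (Slice ι)} {τ : List (Strand ι)} (hW : Chain [] W τ) {k : ℕ}
    {s : Slice ι} (hs : W[k]? = some s) {e : ℕ → ℤ} (h : Slide s e 0) (d : ℕ → ℕ → ℤ) :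
    Sim.{u, v, w} X S (dotted W (d + Pi.single k e)) (dotted W d) := by
  obtain ⟨hk, hs⟩ := List.getElem?_eq_some_iff.1 hs
  obtain ⟨pre, post, rfl, rfl⟩ : ∃ pre post, W = pre ++ ([s] ++ post) ∧ pre.length = k := by
    refine ⟨W.take k, W.drop (k + 1), ?_, by simp; omega⟩
    conv_lhs => rw [← List.take_append_drop k W, List.drop_eq_getElem_cons hk, hs]
    simp
  obtain ⟨ρ, hpre, hW⟩ := chain_append.1 hW
  have := Sim.of_localSim (d := d) hpre (localSim_cap.{u, v, w} (X := X) (S := S) h _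
    (d pre.length)) (dotted post fun k => d (pre.length + (k + 1)))
  convert this using 1
  · rw [dotted_append, dotted_append, List.append_assoc]
    congr 1
    · refine dotted_congr fun k hk => ?_
      simp [hk.ne]
    · simp only [dotted, Pi.add_apply, List.cons_append, List.nil_append]
      refine congrArg₂ _ (by simp) ?_
      refine dotted_congr fun k _ => ?_
      simp [add_comm k 1]
  · rw [dotted_append, dotted_append, List.append_assoc]
    congr 1
    simp only [dotted, List.cons_append, List.nil_append]
    refine congrArg₂ _ (by simp) ?_
    refine dotted_congr fun k _ => ?_
    simp [add_comm k 1]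

variable {D : Diagram ι}

theorem Diagram.exists_slice (p : D.Pt) : ∃ s, D.word[p.1.1]? = some s ∧ s.src = level D.word p.1.1 := by
  have h := p.2
  rw [level] at h
  cases hs : D.word[p.1.1]? with
  | none => rw [hs] at h; simp at h
  | some s => exact ⟨s, rfl, by rw [level, hs]⟩

theorem Sim.slide_dot {k : ℕ} {s : Slice ι} (h : D.Occurs k s) {i j : ℕ} {z : ℤ} {p q : D.Pt}
    (hp : p.1 = (k, i)) (hq : q.1 = (k + 1, j))
    (hs : Slide s (Pi.single i z) (Pi.single j z)) (d : ℕ → ℕ → ℤ) :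
    Sim.{u, v, w} X S (dotted D.word (d + dot p.1 z)) (dotted D.word (d + dot q.1 z)) := by
  obtain ⟨t, ht, -⟩ := D.exists_slice q
  rw [hq] at ht
  rw [hp, hq]
  exact Sim.slide D.chain h ht hs d

theorem Sim.move_dot {p q : D.Pt} (h : D.CompRel p q) (d : ℕ → ℕ → ℤ) (z : ℤ) :
    Sim.{u, v, w} X S (dotted D.word (d + dot p.1 z)) (dotted D.word (d + dot q.1 z)) := by
  cases h
  case arc h =>
    cases h
    case left k s h i hi =>
      refine Sim.slide_dot h rfl rfl ⟨fun _ _ => rfl, fun j hj => ?_, ?_⟩ d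
      · rw [Pi.single_eq_of_ne (by omega), Pi.single_eq_of_ne (by omega)]
      · have h0 : ∀ j, (Pi.single i z : ℕ → ℤ) (s.left.length + j) = 0 :=
          fun j => Pi.single_eq_of_ne (by omega) _
        have h00 : (Pi.single i z : ℕ → ℤ) s.left.length = 0 := h0 0
        cases hP : s.piece <;> simp only [PieceSlide, h0, h00, add_zero, and_self]
    case right k s h i hi =>
      refine Sim.slide_dot h rfl rfl ⟨fun j hj => ?_, fun j hj => ?_, ?_⟩ d
      · rw [Pi.single_eq_of_ne (by omega), Pi.single_eq_of_ne (by omega)]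
      · simp only [Pi.single_apply]
        congr 1
        simp
      · have h0 : ∀ j, j < s.piece.dom.length → (Pi.single
            (s.left.length + s.piece.dom.length + i) z : ℕ → ℤ) (s.left.length + j) = 0 :=
          fun j hj => Pi.single_eq_of_ne (by omega) _
        have h0' : ∀ j, j < s.piece.cod.length → (Pi.single
            (s.left.length + s.piece.cod.length + i) z : ℕ → ℤ) (s.left.length + j) = 0 :=
          fun j hj => Pi.single_eq_of_ne (by omega) _
        cases hP : s.piece <;> rw [hP] at h0 h0' <;> simp only [PieceSlide]
        · rw [h0' 0 (by simp [Piece.cod]), h0' 1 (by simp [Piece.cod])]; rfl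
        · rw [h0 0 (by simp [Piece.dom]), h0 1 (by simp [Piece.dom])]; rfl
        · rw [h0 0 (by simp [Piece.dom]), h0 1 (by simp [Piece.dom]), h0' 0 (by simp [Piece.cod]),
            h0' 1 (by simp [Piece.cod])]
          exact ⟨rfl, rfl⟩
        · rw [h0 0 (by simp [Piece.dom]), h0' 0 (by simp [Piece.cod])]
    case cup k l r a h =>
      obtain ⟨t, ht, -⟩ := D.exists_slice (h.top 0 (by simp [Piece.cod]))
      -- No kinks below a minimum slide to opposite kinks on its two ends. Added to `z` kinks at the
      -- left end, these carry them to the right end.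
      have := Sim.slide.{u, v, w} (X := X) (S := S) D.chain h ht (e := 0)
        (g := Pi.single (l.length + 1) z - Pi.single (l.length + 0) z)
        ⟨fun j hj => ?_, fun j hj => ?_, ?_⟩ (d + dot (k + 1, l.length + 0) z)
      · convert this using 2
        · simp
          rfl
        · change d + dot (k + 1, l.length + 1) z = _
          rw [Pi.single_sub, add_sub, add_assoc, add_comm (dot _ z), ← add_assoc]
          exact (add_sub_cancel_right _ _).symm
      · simp only at hj
        simp [Pi.single_apply]
        split_ifs <;> omega
      · simp [Pi.single_apply, Piece.cod]
        split_ifs <;> omega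
      · simp [PieceSlide, Pi.single_apply]
    case cap k l r a h =>
      -- Opposite kinks below a maximum vanish. Added to `z` kinks at the right end, they carry them
      -- to the left end.
      have := Sim.slide_cap.{u, v, w} (X := X) (S := S) D.chain h
        (e := Pi.single (l.length + 0) z - Pi.single (l.length + 1) z)
        ⟨fun j hj => ?_, fun j hj => ?_, ?_⟩ (d + dot (k, l.length + 1) z)
      · convert this using 2
        · change d + dot (k, l.length + 0) z = _
          rw [Pi.single_sub, add_sub, add_assoc, add_comm (dot _ z), ← add_assoc]
          exact (add_sub_cancel_right _ _).symm
        · rfl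
      · simp only at hj
        simp [Pi.single_apply]
        split_ifs <;> omega
      · simp [Pi.single_apply, Piece.dom]
        split_ifs <;> omega
      · simp [PieceSlide, Pi.single_apply]
  case bar k l r a h =>
    refine Sim.slide_dot h rfl rfl ⟨fun j hj => rfl, fun j hj => ?_, rfl⟩ d
    simp [Piece.dom, Piece.cod]
  case cross_left k l r c a b h =>
    refine Sim.slide_dot h rfl rfl ⟨fun j hj => ?_, fun j hj => ?_, ?_⟩ d
    · simp only at hj
      rw [Pi.single_eq_of_ne (by simp; omega), Pi.single_eq_of_ne (by simp; omega)]
    · simp only [Piece.dom, Piece.cod]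
      rw [Pi.single_eq_of_ne (by simp; omega), Pi.single_eq_of_ne (by simp; omega)]
    · simp [PieceSlide, Pi.single_apply]
  case cross_right k l r c a b h =>
    refine Sim.slide_dot h rfl rfl ⟨fun j hj => ?_, fun j hj => ?_, ?_⟩ d
    · simp only at hj
      rw [Pi.single_eq_of_ne (by simp; omega), Pi.single_eq_of_ne (by simp; omega)]
    · simp only [Piece.dom, Piece.cod]
      rw [Pi.single_eq_of_ne (by simp; omega), Pi.single_eq_of_ne (by simp; omega)]
    · simp [PieceSlide, Pi.single_apply]

theorem Sim.move_dot_of_connected {p q : D.Pt} (h : Relation.EqvGen D.CompRel p q)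
    (d : ℕ → ℕ → ℤ) (z : ℤ) :
    Sim.{u, v, w} X S (dotted D.word (d + dot p.1 z)) (dotted D.word (d + dot q.1 z)) := by
  induction h with
  | rel p q h => exact Sim.move_dot h d z
  | refl => exact Sim.refl _
  | symm p q _ ih => exact ih.symm
  | trans p q r _ _ ih ih' => exact ih.trans ih'

/-- There is a point of the component `i` at the given position. -/
def HasComp (W : List (Slice ι)) (p : ℕ × ℕ) (i : ι) : Prop :=
  ((level W p.1)[p.2]?).map Strand.comp = some i

theorem HasComp.exists_pt {p : ℕ × ℕ} {i : ι} (h : HasComp D.word p i) :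
    ∃ q : D.Pt, q.1 = p ∧ (D.strand q).comp = i := by
  obtain ⟨a, ha, rfl⟩ := Option.map_eq_some_iff.1 h
  obtain ⟨hp, rfl⟩ := List.getElem?_eq_some_iff.1 ha
  exact ⟨⟨p, hp⟩, rfl, rfl⟩

theorem hasComp_pt (q : D.Pt) : HasComp D.word q.1 (D.strand q).comp := by
  rw [HasComp, List.getElem?_eq_getElem q.2]
  rfl

theorem HasComp.of_mem {W : List (Slice ι)} {k : ℕ} {a : Strand ι} (h : a ∈ level W k) :
    ∃ j, HasComp W (k, j) a.comp := by
  obtain ⟨j, hj, rfl⟩ := List.getElem_of_mem h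
  exact ⟨j, by simp [HasComp, hj]⟩

/-- Numbers of kinks at one point of each component. -/
def place [Fintype ι] (P : ι → ℕ × ℕ) (n : ι → ℤ) : ℕ → ℕ → ℤ := ∑ i, dot (P i) (n i)

/-- One component at a time: its kinks are carried along it, which is possible because it is
connected, while all other kinks stay where they are. -/
theorem Sim.place_congr [Fintype ι] (L : LinkDiagram ι) {P Q : ι → ℕ × ℕ}
    (hP : ∀ i, HasComp L.word (P i) i) (hQ : ∀ i, HasComp L.word (Q i) i) (n : ι → ℤ) :
    Sim.{u, v, w} X S (dotted L.word (place P n)) (dotted L.word (place Q n)) := by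
  classical
  have key : ∀ (s : Finset ι) (d : ℕ → ℕ → ℤ), Sim.{u, v, w} X S
      (dotted L.word (d + ∑ i ∈ s, dot (P i) (n i)))
      (dotted L.word (d + ∑ i ∈ s, dot (Q i) (n i))) := by
    intro s
    induction s using Finset.induction_on with
    | empty => exact fun d => Sim.refl _
    | insert i s hi ih =>
      intro d
      rw [Finset.sum_insert hi, Finset.sum_insert hi, add_comm (dot (P i) _), ← add_assoc]
      obtain ⟨p, hp, hpi⟩ := (hP i).exists_pt
      obtain ⟨q, hq, hqi⟩ := (hQ i).exists_pt
      have := Sim.move_dot_of_connected.{u, v, w} (X := X) (S := S)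
        (L.connected p q (hpi.trans hqi.symm)) (d + ∑ i ∈ s, dot (P i) (n i)) (n i)
      rw [hp, hq] at this
      refine this.trans ?_
      rw [add_right_comm]
      exact (ih _).trans (by rw [add_assoc]; exact Sim.refl _)
  have := key Finset.univ 0
  rwa [zero_add, zero_add] at this

end MoveDots

/-! ### Invariance of colorings with given framing -/

section MoveInvariance

variable {ι : Type} {X : Type u} [TwistedVirtualBirack X] {S : Type v} [TwistedShadow X S]

/-- Insert `m` lines without kinks before the line `c`. -/
def spread (c m : ℕ) (d : ℕ → ℕ → ℤ) (k : ℕ) : ℕ → ℤ :=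
  if k < c then d k else if k < c + m then 0 else d (k - m)

/-- The new place of a point when `m` lines are inserted before the line `c`. -/
def shift (c m : ℕ) (p : ℕ × ℕ) : ℕ × ℕ := if p.1 < c then p else (p.1 + m, p.2)

theorem spread_dot (c m : ℕ) (p : ℕ × ℕ) (z : ℤ) : spread c m (dot p z) = dot (shift c m p) z := by
  funext k
  rw [spread, shift]
  by_cases hp : p.1 < c
  · rw [if_pos hp]
    split_ifs with h₁ h₂
    · rfl
    · rw [dot_of_ne (by omega)]
    · rw [dot_of_ne (by omega), dot_of_ne (by omega)]
  · rw [if_neg hp]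
    split_ifs with h₁ h₂
    · rw [dot_of_ne (by omega), dot_of_ne (show k ≠ p.1 + m by omega)]
    · rw [dot_of_ne (show k ≠ p.1 + m by omega)]
    · by_cases h : k = p.1 + m
      · subst h
        simp [dot]
      · rw [dot_of_ne (p := (p.1 + m, p.2)) h, dot_of_ne (show k - m ≠ p.1 by omega)]

theorem spread_add (c m : ℕ) (d d' : ℕ → ℕ → ℤ) :
    spread c m (d + d') = spread c m d + spread c m d' := by
  funext k
  simp only [spread, Pi.add_apply]
  split_ifs <;> simp

theorem spread_place [Fintype ι] (c m : ℕ) (P : ι → ℕ × ℕ) (n : ι → ℤ) :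
    spread c m (place P n) = place (fun i => shift c m (P i)) n := by
  have h := map_sum (AddMonoidHom.mk' (spread c m) (spread_add c m)) (fun i => dot (P i) (n i))
    Finset.univ
  simp only [AddMonoidHom.mk'_apply, spread_dot] at h
  exact h

theorem spread_of_lt {c m k : ℕ} (h : k < c) (d : ℕ → ℕ → ℤ) : spread c m d k = d k := if_pos h

theorem spread_of_mem {c m k : ℕ} (h : c ≤ k) (h' : k < c + m) (d : ℕ → ℕ → ℤ) :
    spread c m d k = 0 := by
  rw [spread, if_neg (by omega), if_pos h']

theorem spread_of_le {c m k : ℕ} (h : c ≤ k) (d : ℕ → ℕ → ℤ) : spread c m d (k + m) = d k := by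
  rw [spread, if_neg (by omega), if_neg (by omega), Nat.add_sub_cancel]

section Writhe

variable [DecidableEq ι]

theorem writhe_eq (D : Diagram ι) (i : ι) : D.writhe i = wordWrithe i D.word := rfl

theorem wordWrithe_append (i : ι) (W W' : List (Slice ι)) :
    wordWrithe i (W ++ W') = wordWrithe i W + wordWrithe i W' := by
  simp [wordWrithe]

theorem wordWrithe_whisker (i : ι) (l r : List (Strand ι)) (W : List (Slice ι)) :
    wordWrithe i (W.map (Slice.whisker l r)) = wordWrithe i W := by
  rw [wordWrithe, wordWrithe, List.map_map]
  rfl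

end Writhe

theorem sim_remove {pre post m : List (Slice ι)} {s : Slice ι} {σ : List (Strand ι)} {e : ℕ → ℤ}
    (hpre : Chain [] pre σ) (h : ∀ (G : Type w) [AddCommGroup G] [Module (ShadowAlgebra X S) G],
      Thin X S G σ e m []) (hs : s.src = σ) (d : ℕ → ℕ → ℤ) :
    Sim.{u, v, w} X S (dotted (pre ++ m ++ s :: post) (spread pre.length m.length d))
      (dotted (pre ++ s :: post) (d + Pi.single pre.length e)) := by
  have := Sim.of_localSim (d := d) hpre (localSim_remove.{u, v, w} (X := X) (S := S) h hs
    (d := fun _ => 0) (fun _ _ => rfl) (d pre.length)) (dotted post fun k => d (pre.length + (k + 1)))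
  convert this using 1
  · rw [List.append_assoc, dotted_append, dotted_append, dotted, List.append_assoc, List.append_assoc]
    refine congrArg₂ _ (dotted_congr fun k hk => spread_of_lt hk d) (congrArg₂ _ ?_ ?_)
    · exact dotted_congr fun k hk => spread_of_mem (by omega) (by omega) d
    · simp only [List.cons_append, List.nil_append]
      congr 1
      · rw [Nat.add_zero, spread_of_le le_rfl]
      · refine dotted_congr fun k _ => ?_
        rw [show pre.length + (m.length + (k + 1)) = pre.length + (k + 1) + m.length by omega,
          spread_of_le (by omega)]
  · rw [dotted_append, dotted, List.append_assoc]
    refine congrArg₂ _ (dotted_congr fun k hk => ?_) ?_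
    · simp [hk.ne]
    · simp only [List.cons_append, List.nil_append]
      congr 1
      · congr 1
        funext i
        simp [add_comm]
      · refine dotted_congr fun k _ => ?_
        simp

/-- The distribution `d` belongs to a common skeleton in which only the bottom line of the replaced
word is kept. `spread` gives no kinks to the lines inside either word. -/
theorem sim_replace {pre post t₁ t₂ : List (Slice ι)} {s₁ s₂ : Slice ι} {σ : List (Strand ι)}
    (hpre : Chain [] pre σ) (h : ∀ (G : Type w) [AddCommGroup G] [Module (ShadowAlgebra X S) G],
      Thin X S G σ 0 (s₁ :: t₁) (s₂ :: t₂)) (h₁ : s₁.src = σ) (h₂ : s₂.src = σ) (d : ℕ → ℕ → ℤ) :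
    Sim.{u, v, w} X S
      (dotted (pre ++ s₁ :: t₁ ++ post) (spread (pre.length + 1) t₁.length d))
      (dotted (pre ++ s₂ :: t₂ ++ post) (spread (pre.length + 1) t₂.length d)) := by
  have hd : ∀ (s : Slice ι) (t : List (Slice ι)), dotted (pre ++ s :: t ++ post)
      (spread (pre.length + 1) t.length d) = dotted pre d ++
        dotted (s :: t) (fun k => if k = 0 then d pre.length else 0) ++
        dotted post fun k => d (pre.length + (k + 1)) := by
    intro s t
    rw [dotted_append, dotted_append]
    refine congrArg₂ _ (congrArg₂ _ (dotted_congr fun k hk => spread_of_lt (by omega) d)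
      (dotted_congr fun k hk => ?_)) (dotted_congr fun k hk => ?_)
    · cases k with
      | zero =>
        rw [spread_of_lt (by omega), if_pos rfl]
        rfl
      | succ k =>
        rw [List.length_cons] at hk
        rw [spread_of_mem (by omega) (by omega), if_neg (by omega)]
    · rw [List.length_append, List.length_cons,
        show pre.length + (t.length + 1) + k = pre.length + (k + 1) + t.length by omega,
        spread_of_le (by omega)]
  rw [hd, hd]
  exact Sim.of_localSim hpre (localSim_of_thin h h₁ h₂ rfl (fun _ _ => rfl) fun _ _ => rfl) d _

theorem hasComp_append_left {W W' : List (Slice ι)} {p : ℕ × ℕ} {i : ι} (h : p.1 < W.length) :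
    HasComp (W ++ W') p i ↔ HasComp W p i := by
  rw [HasComp, HasComp, level_append_left h]

theorem hasComp_append_right {W W' : List (Slice ι)} {p : ℕ × ℕ} {i : ι} (h : W.length ≤ p.1) :
    HasComp (W ++ W') p i ↔ HasComp W' (p.1 - W.length, p.2) i := by
  obtain ⟨k, hk⟩ := Nat.exists_eq_add_of_le h
  rw [HasComp, HasComp, hk, level_append_right, Nat.add_sub_cancel_left]

variable [Fintype ι] [DecidableEq ι]

theorem LinkDiagram.exists_placement (D : LinkDiagram ι) :
    ∃ P : ι → ℕ × ℕ, ∀ i, HasComp D.word (P i) i := by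
  choose p hp using D.surjective
  exact ⟨fun i => (p i).1, fun i => by
    have := hasComp_pt (p i)
    rwa [hp] at this⟩

theorem place_add_single (P : ι → ℕ × ℕ) (n : ι → ℤ) (i : ι) (ε : ℤ) :
    place P (fun j => n j + if i = j then ε else 0) = place P n + dot (P i) ε := by
  simp only [place, dot_add, Finset.sum_add_distrib]
  congr 1
  rw [Finset.sum_eq_single i]
  · rw [if_pos rfl]
  · intro j _ hj
    rw [if_neg hj.symm]
    simp [dot]
  · simp

variable (X S) in
/-- The colorings of two diagrams with given numbers of kinks on their components are in bijection,
naturally in the module of beads. -/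
def FramedSim (D D' : LinkDiagram ι) : Prop :=
  ∀ n n' : ι → ℤ, (∀ i, n i + D.writhe i = n' i + D'.writhe i) →
    ∀ P P' : ι → ℕ × ℕ, (∀ i, HasComp D.word (P i) i) → (∀ i, HasComp D'.word (P' i) i) →
      Sim.{u, v, w} X S (dotted D.word (place P n)) (dotted D'.word (place P' n'))

/-- Kinks can be carried to any place on their component, so one convenient choice of places is
enough. -/
theorem FramedSim.of_exists {D D' : LinkDiagram ι}
    (h : ∀ n n' : ι → ℤ, (∀ i, n i + D.writhe i = n' i + D'.writhe i) →
      ∃ P P' : ι → ℕ × ℕ, (∀ i, HasComp D.word (P i) i) ∧ (∀ i, HasComp D'.word (P' i) i) ∧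
        Sim.{u, v, w} X S (dotted D.word (place P n)) (dotted D'.word (place P' n'))) :
    FramedSim.{u, v, w} X S D D' := by
  intro n n' hn P P' hP hP'
  obtain ⟨Q, Q', hQ, hQ', hs⟩ := h n n' hn
  exact (Sim.place_congr D hP hQ n).trans (hs.trans (Sim.place_congr D' hQ' hP' n'))

theorem FramedSim.symm {D D' : LinkDiagram ι} (h : FramedSim.{u, v, w} X S D D') :
    FramedSim.{u, v, w} X S D' D :=
  fun n n' hn P P' hP hP' => (h n' n (fun i => (hn i).symm) P' P hP' hP).symm

theorem FramedSim.refl (D : LinkDiagram ι) : FramedSim.{u, v, w} X S D D := by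
  intro n n' hn P P' hP hP'
  obtain rfl : n = n' := funext fun i => add_right_cancel (hn i)
  exact Sim.place_congr D hP hP' n

theorem FramedSim.trans {D D' D'' : LinkDiagram ι} (h : FramedSim.{u, v, w} X S D D')
    (h' : FramedSim.{u, v, w} X S D' D'') : FramedSim.{u, v, w} X S D D'' := by
  intro n n' hn P P' hP hP'
  obtain ⟨Q, hQ⟩ := D'.exists_placement
  -- The number of kinks in between is forced, since kinks plus writhe is the conserved quantity.
  exact (h n (fun i => n i + D.writhe i - D'.writhe i) (fun i => by omega) P Q hP hQ).trans
    (h' _ n' (fun i => by rw [← hn]; omega) Q P' hQ hP')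

theorem LocalMove.ne_nil {m₁ m₂ : List (Slice ι)} (h : LocalMove m₁ m₂) : m₁ ≠ [] := by
  cases h <;> simp

/-- A removed word is traded for formal kinks, as many as it contributed to the writhe; a replaced
word leaves the writhes alone. In either case the kinks are first put on lines that both diagrams
share. -/
theorem framedSim_of_move {D D' : LinkDiagram ι} (h : Move D.word D'.word) :
    FramedSim.{u, v, w} X S D D' := by
  obtain ⟨pre, post, l, r, m₁, m₂, hm, hD, hD'⟩ := h
  obtain ⟨ρ, τ, hc₁, hc₂, hcase⟩ := hm.thin.{u, v, w} X S
  have hch := D.chain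
  rw [hD] at hch
  obtain ⟨σ', hch, hpost⟩ := chain_append.1 hch
  obtain ⟨σ, hpre, hmid⟩ := chain_append.1 hch
  have hch' := D'.chain
  rw [hD'] at hch'
  have hw : ∀ i, D.writhe i = wordWrithe i pre + wordWrithe i m₁ + wordWrithe i post := by
    intro i
    rw [writhe_eq, hD, wordWrithe_append, wordWrithe_append, wordWrithe_whisker]
  have hw' : ∀ i, D'.writhe i = wordWrithe i pre + wordWrithe i m₂ + wordWrithe i post := by
    intro i
    rw [writhe_eq, hD', wordWrithe_append, wordWrithe_append, wordWrithe_whisker]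
  have hσ : m₁ ≠ [] → σ = l ++ ρ ++ r ∧ σ' = l ++ τ ++ r := by
    intro hne
    obtain ⟨s, t, rfl⟩ := List.exists_cons_of_ne_nil hne
    obtain rfl : l ++ ρ ++ r = σ := by
      rw [← hmid.1, ← hc₁.1]
      simp [Slice.src, Slice.whisker]
    exact ⟨rfl, chain_unique hmid (hc₁.map_whisker l r)⟩
  refine FramedSim.of_exists fun n n' hn => ?_
  rcases hcase with ⟨rfl, a, ρ', ε, rfl, hthin, hwr⟩ | ⟨hne₁, hne₂, hthin, hwr, hcomp⟩
  · obtain ⟨rfl, rfl⟩ := hσ hm.ne_nil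
    rw [List.map_nil, List.append_nil] at hD' hch'
    obtain ⟨σ, hpre', hpost'⟩ := chain_append.1 hch'
    obtain rfl := chain_unique hpre hpre'
    -- The strand `a` leaves the removed word at the top, so the diagram cannot end there: some
    -- slice `s` follows and can carry kinks.
    obtain ⟨s, post, rfl⟩ : ∃ s t, post = s :: t := by
      cases post with
      | nil => simp [Chain] at hpost'
      | cons s t => exact ⟨s, t, rfl⟩
    obtain ⟨P, hP⟩ := D'.exists_placement
    obtain rfl : n' = fun i => n i + if a.comp = i then ε else 0 := funext fun i => by
      have := hn i
      rw [hw, hw', hwr] at this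
      simp only [wordWrithe, List.map_nil, List.sum_nil] at this
      omega
    have ha : HasComp D'.word (pre.length, l.length) a.comp := by
      rw [hD', hasComp_append_right le_rfl, Nat.sub_self, HasComp, hpost'.level_zero]
      simp
    obtain ⟨p, hp, hpa⟩ := ha.exists_pt
    obtain ⟨q, hq, hqa⟩ := (hP a.comp).exists_pt
    -- Places are chosen in the smaller diagram and shifted past the inserted lines.
    refine ⟨fun i => shift pre.length (m₁.map (Slice.whisker l r)).length (P i), P,
      fun i => ?_, hP, ?_⟩
    · have hPi := hP i
      rw [hD'] at hPi
      rw [hD]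
      dsimp only [shift]
      split_ifs with hlt
      · rw [List.append_assoc, hasComp_append_left hlt]
        rwa [hasComp_append_left hlt] at hPi
      · rw [hasComp_append_right (by simp; omega)]
        rw [hasComp_append_right (by omega)] at hPi
        convert hPi using 2
        simp only [List.length_append, List.length_map]
        omega
    · rw [← spread_place, place_add_single]
      -- The `ε` kinks appear on the first bottom strand of the removed word and are then carried to
      -- the place that was chosen for its component.
      have hs := Sim.move_dot_of_connected.{u, v, w} (X := X) (S := S)
        (D'.connected p q (hpa.trans hqa.symm)) (place P n) ε
      rw [hp, hq] at hs
      refine Sim.trans ?_ hs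
      rw [hD, hD']
      refine sim_remove hpre (e := Pi.single l.length ε) (fun G _ _ => ?_) hpost'.1 (place P n)
      refine (hthin G).whisker l r (fun i hi => Pi.single_eq_of_ne hi.ne _) (fun i hi => ?_)
        fun i hi => Pi.single_eq_of_ne (by simp; omega) _
      simp [Pi.single_apply]
  · obtain ⟨s₁, t₁, rfl⟩ := List.exists_cons_of_ne_nil hne₁
    obtain ⟨s₂, t₂, rfl⟩ := List.exists_cons_of_ne_nil hne₂
    obtain ⟨rfl, rfl⟩ := hσ hne₁
    have hsrc : ∀ {s : Slice ι} {t : List (Slice ι)}, Chain ρ (s :: t) τ →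
        (s.whisker l r).src = l ++ ρ ++ r := by
      intro s t h
      rw [← h.1]
      simp [Slice.src, Slice.whisker]
    have hlev : ∀ {s : Slice ι} {t : List (Slice ι)} (p : ℕ × ℕ) (i : ι), Chain ρ (s :: t) τ →
        p.1 ≤ pre.length →
        (HasComp (pre ++ (s :: t).map (Slice.whisker l r) ++ post) (shift (pre.length + 1) t.length p) i ↔
        HasComp (pre ++ s₁.whisker l r :: post) p i) := by
      intro s t p i hc hp
      rw [shift, if_pos (by omega)]
      rcases hp.lt_or_eq with hp | hp
      · rw [List.append_assoc, hasComp_append_left hp, hasComp_append_left hp]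
      · rw [List.append_assoc, hasComp_append_right hp.ge, hasComp_append_right hp.ge, hp,
          Nat.sub_self]
        simp only [HasComp, level, List.map_cons, List.cons_append, List.getElem?_cons_zero, hsrc hc,
          hsrc hc₁]
    have hlev' : ∀ {s : Slice ι} {t : List (Slice ι)} (p : ℕ × ℕ) (i : ι), pre.length < p.1 →
        (HasComp (pre ++ (s :: t).map (Slice.whisker l r) ++ post) (shift (pre.length + 1) t.length p) i ↔
        HasComp post (p.1 - (pre.length + 1), p.2) i) := by
      intro s t p i hp
      rw [shift, if_neg (by omega), hasComp_append_right (by simp; omega)]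
      simp only [List.length_append, List.length_map, List.length_cons]
      rw [show p.1 + t.length - (pre.length + (t.length + 1)) = p.1 - (pre.length + 1) by omega]
    -- Every component can be found on a shared line: if one of its points lies inside the replaced
    -- word, then `hcomp` or the vertical strands beside the word give a strand of the same
    -- component at its bottom or top.
    have hP : ∀ i, ∃ p, HasComp D.word (shift (pre.length + 1) t₁.length p) i ∧
        HasComp D'.word (shift (pre.length + 1) t₂.length p) i := by
      intro i
      suffices h : (∃ p : ℕ × ℕ, p.1 ≤ pre.length ∧ HasComp (pre ++ s₁.whisker l r :: post) p i) ∨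
          ∃ p : ℕ × ℕ, pre.length < p.1 ∧ HasComp post (p.1 - (pre.length + 1), p.2) i by
        rw [hD, hD']
        rcases h with ⟨p, hp, hpi⟩ | ⟨p, hp, hpi⟩
        · exact ⟨p, (hlev p i hc₁ hp).2 hpi, (hlev p i hc₂ hp).2 hpi⟩
        · exact ⟨p, (hlev' p i hp).2 hpi, (hlev' p i hp).2 hpi⟩
      have hbot : ∀ a ∈ l ++ ρ ++ r, a.comp = i →
          ∃ p : ℕ × ℕ, p.1 ≤ pre.length ∧ HasComp (pre ++ s₁.whisker l r :: post) p i := by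
        rintro a ha rfl
        rw [← hsrc hc₁] at ha
        obtain ⟨j, hj⟩ := HasComp.of_mem (W := s₁.whisker l r :: post) (k := 0) ha
        exact ⟨(pre.length, j), le_rfl, by
          rwa [hasComp_append_right le_rfl, Nat.sub_self]⟩
      have htop : ∀ a ∈ l ++ τ ++ r, a.comp = i →
          ∃ p : ℕ × ℕ, pre.length < p.1 ∧ HasComp post (p.1 - (pre.length + 1), p.2) i := by
        rintro a ha rfl
        rw [← hpost.level_zero] at ha
        obtain ⟨j, hj⟩ := HasComp.of_mem ha
        exact ⟨(pre.length + 1, j), Nat.lt_succ_self _, by rwa [Nat.sub_self]⟩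
      obtain ⟨Q, hQ⟩ := D.exists_placement
      obtain ⟨⟨k, j⟩, hq⟩ : ∃ p, HasComp D.word p i := ⟨_, hQ i⟩
      rw [hD, List.append_assoc] at hq
      by_cases h₁ : k < pre.length
      · exact .inl ⟨(k, j), h₁.le, (hasComp_append_left h₁).2 ((hasComp_append_left h₁).1 hq)⟩
      rw [hasComp_append_right (not_lt.1 h₁)] at hq
      by_cases h₂ : k - pre.length < ((s₁ :: t₁).map (Slice.whisker l r)).length
      · rw [hasComp_append_left h₂] at hq
        obtain ⟨b, hb, hbi⟩ := Option.map_eq_some_iff.1 hq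
        have hb' := List.mem_of_getElem? hb
        simp only [level, List.getElem?_eq_getElem h₂, List.getElem_map] at hb'
        have hmem : (s₁ :: t₁)[k - pre.length]'(by simpa using h₂) ∈ s₁ :: t₁ :=
          List.getElem_mem _
        generalize (s₁ :: t₁)[k - pre.length]'(by simpa using h₂) = s at hb' hmem
        simp only [Slice.src, Slice.whisker, List.mem_append] at hb'
        have hb'' : b ∈ l ∨ b ∈ s.src ∨ b ∈ r := by
          simp only [Slice.src, List.mem_append]
          tauto
        rcases hb'' with h | h | h
        · exact .inl (hbot b (by simp [h]) hbi)
        · obtain ⟨b', hb', hbb⟩ := hcomp s hmem b h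
          rcases List.mem_append.1 hb' with h | h
          · exact .inl (hbot b' (by simp [h]) (hbb.trans hbi))
          · exact .inr (htop b' (by simp [h]) (hbb.trans hbi))
        · exact .inl (hbot b (by simp [h]) hbi)
      · rw [hasComp_append_right (not_lt.1 h₂)] at hq
        simp only [List.length_map, List.length_cons] at hq h₂
        exact .inr ⟨(k - t₁.length, j), by simp only; omega, by
          convert hq using 2
          simp only
          omega⟩
    choose P hP hP' using hP
    refine ⟨_, _, hP, hP', ?_⟩
    obtain rfl : n = n' := funext fun i => by
      have := hn i
      rw [hw, hw', hwr] at this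
      omega
    rw [← spread_place, ← spread_place, hD, hD']
    have := sim_replace.{u, v, w} (X := X) (S := S) (post := post) hpre (fun G _ _ => (hthin G).whisker l r
      (e' := 0) (fun _ _ => rfl) (fun _ _ => rfl) fun _ _ => rfl) (hsrc hc₁) (hsrc hc₂) (place P n)
    simpa using this

theorem framedSim_of_isotopic {D D' : LinkDiagram ι} (h : Isotopic D D') :
    FramedSim.{u, v, w} X S D D' := by
  induction h with
  | rel D D' h => exact framedSim_of_move h
  | refl D => exact FramedSim.refl D
  | symm D D' _ ih => exact ih.symm
  | trans D D' D'' _ _ ih ih' => exact ih.trans ih'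

/-- By the phone cord relation, formal kinks in multiples of the rank act trivially. -/
theorem sim_place_zero {n : ι → ℤ} (hn : ∀ i, (birackRank X : ℤ) ∣ n i) (W : List (Slice ι))
    (P : ι → ℕ × ℕ) : Sim.{u, v, w} X S (dotted W (place P n)) (dotted W 0) := by
  refine Sim.of_iff fun G _ _ A ys => isPath_dotted_iff fun k s _ i _ => ?_
  simp only [place, Finset.sum_apply, Pi.zero_apply, sub_zero]
  refine Finset.dvd_sum fun j _ => ?_
  simp only [dot, Pi.single_apply]
  split_ifs
  · rw [Pi.single_apply]
    split_ifs
    · exact hn j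
    · exact dvd_zero _
  · exact dvd_zero _

end MoveInvariance

/-! ### Functions on the points of a diagram as paths of lines -/

section States

variable {σ L : Type*} {R : σ → L → L → Prop}

theorem isPath_states {W : List σ} {st : ℕ → L} :
    IsPath R W (st 0) ((List.range W.length).map fun k => st (k + 1)) (st W.length) ↔
      ∀ k s, W[k]? = some s → R s (st k) (st (k + 1)) := by
  induction W generalizing st with
  | nil => simp [isPath_nil]
  | cons s W ih =>
    have hr : (List.range (s :: W).length).map (fun k => st (k + 1)) =
        st 1 :: (List.range W.length).map fun k => st (k + 1 + 1) := by
      rw [List.length_cons, List.range_succ_eq_map, List.map_cons, List.map_map]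
      rfl
    rw [hr, isPath_cons]
    have ih' := ih (st := fun k => st (k + 1))
    constructor
    · rintro ⟨y, ys, e, h, h'⟩
      obtain ⟨rfl, rfl⟩ := List.cons.inj e
      intro k t ht
      cases k with
      | zero =>
        obtain rfl : s = t := by simpa using ht
        exact h
      | succ k => exact ih'.1 h' k t ht
    · exact fun h => ⟨_, _, rfl, h 0 s rfl, ih'.2 fun k t ht => h (k + 1) t ht⟩

theorem IsPath.exists_states {W : List σ} {x z : L} {ys : List L} (h : IsPath R W x ys z) :
    ∃ st : ℕ → L, st 0 = x ∧ st W.length = z ∧ ys = (List.range W.length).map fun k => st (k + 1) := by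
  induction W generalizing x ys with
  | nil => exact ⟨fun _ => x, rfl, h.2, h.1⟩
  | cons s W ih =>
    obtain ⟨y, ys, rfl, -, h⟩ := h
    obtain ⟨st, rfl, h₁, rfl⟩ := ih h
    refine ⟨fun k => Nat.casesOn k x st, rfl, h₁, ?_⟩
    rw [List.length_cons, List.range_succ_eq_map, List.map_cons, List.map_map]
    rfl

end States

section Lines

variable {ι : Type} {Λ : Type*}

/-- For lines of the right lengths the decomposition in `SliceRule` is forced, so the rule can be
tested position by position. -/
theorem sliceRule_iff {E : Type*} {acr : List (Strand ι) → E → List Λ → E}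
    {rule : E → Piece ι → List Λ → List Λ → Prop} {A : E} {s : Slice ι} {x y : List Λ}
    (hx : x.length = s.src.length) (hy : y.length = s.tgt.length) :
    SliceRule acr rule A s x y ↔ (∀ i < s.left.length, x[i]? = y[i]?) ∧
      (∀ i < s.right.length, x[s.left.length + s.piece.dom.length + i]? =
        y[s.left.length + s.piece.cod.length + i]?) ∧
      rule (acr s.left A (x.take s.left.length)) s.piece
        ((x.drop s.left.length).take s.piece.dom.length)
        ((y.drop s.left.length).take s.piece.cod.length) := by
  have hx' : x.length = s.left.length + s.piece.dom.length + s.right.length := by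
    rw [hx]
    simp [Slice.src]
    omega
  have hy' : y.length = s.left.length + s.piece.cod.length + s.right.length := by
    rw [hy]
    simp [Slice.tgt]
    omega
  constructor
  · rintro ⟨xl, xr, p, q, rfl, rfl, hl, hr, h⟩
    have hp : p.length = s.piece.dom.length := by
      simp only [List.length_append] at hx'
      omega
    have hq : q.length = s.piece.cod.length := by
      simp only [List.length_append] at hy'
      omega
    rw [← hl, ← hp, ← hq]
    refine ⟨fun i hi => ?_, fun i hi => ?_, ?_⟩
    · rw [List.getElem?_append_left hi, List.getElem?_append_left hi]
    · rw [add_assoc, add_assoc, List.getElem?_append_right (by omega),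
        List.getElem?_append_right (by omega), Nat.add_sub_cancel_left, Nat.add_sub_cancel_left,
        List.getElem?_append_right (by omega), List.getElem?_append_right (by omega),
        Nat.add_sub_cancel_left, Nat.add_sub_cancel_left]
    · simpa using h
  · rintro ⟨h₁, h₂, h₃⟩
    refine ⟨x.take s.left.length, x.drop (s.left.length + s.piece.dom.length), _, _, ?_, ?_, ?_, ?_,
      h₃⟩
    · rw [← List.drop_drop, List.take_append_drop, List.take_append_drop]
    · have e₁ : x.take s.left.length = y.take s.left.length := by
        refine List.ext_getElem? fun i => ?_
        rw [List.getElem?_take, List.getElem?_take]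
        split_ifs with hi
        · exact h₁ i hi
        · rfl
      have e₂ : x.drop (s.left.length + s.piece.dom.length) =
          y.drop (s.left.length + s.piece.cod.length) := by
        refine List.ext_getElem? fun i => ?_
        rw [List.getElem?_drop, List.getElem?_drop]
        by_cases hi : i < s.right.length
        · exact h₂ i hi
        · rw [List.getElem?_eq_none (by omega), List.getElem?_eq_none (by omega)]
      rw [e₁, e₂, ← List.drop_drop, List.take_append_drop, List.take_append_drop]
    · simp
      omega
    · simp
      omega

namespace Diagram

variable (D : Diagram ι)

/-- The values of a function on the points of a line. -/
def line (β : D.Pt → Λ) (k : ℕ) : List Λ :=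
  List.ofFn fun j : Fin (level D.word k).length => β ⟨(k, j), j.2⟩

variable {D}

@[simp] theorem length_line (β : D.Pt → Λ) (k : ℕ) : (D.line β k).length = (level D.word k).length := by
  simp [line]

theorem getElem?_line (β : D.Pt → Λ) (p : D.Pt) : (D.line β p.1.1)[p.1.2]? = some (β p) := by
  rw [List.getElem?_eq_getElem (by simpa using p.2)]
  simp [line]
  rfl

theorem line_injective {β β' : D.Pt → Λ} (h : ∀ k, D.line β k = D.line β' k) : β = β' := by
  funext p
  have := getElem?_line β p
  rw [h, getElem?_line] at this
  exact (Option.some.inj this).symm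

theorem exists_line {st : ℕ → List Λ} (h : ∀ k, (st k).length = (level D.word k).length) :
    ∃ β : D.Pt → Λ, ∀ k, D.line β k = st k := by
  refine ⟨fun p => (st p.1.1)[p.1.2]'((h _).symm ▸ p.2), fun k => ?_⟩
  refine List.ext_getElem (by simp [h]) fun i h₁ h₂ => ?_
  simp [line]

theorem map_line {Λ' : Type*} (g : Λ → Λ') (β : D.Pt → Λ) (k : ℕ) :
    (D.line β k).map g = D.line (fun p => g (β p)) k := by
  simp [line, List.map_ofFn]
  rfl

theorem Occurs.level_eq {k : ℕ} {s : Slice ι} (h : D.Occurs k s) : level D.word k = s.src := by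
  have h' : D.word[k]? = some s := h
  rw [level, h']

theorem line_bot {k : ℕ} {s : Slice ι} (h : D.Occurs k s) (β : D.Pt → Λ) :
    ((D.line β k).drop s.left.length).take s.piece.dom.length =
      List.ofFn fun i : Fin s.piece.dom.length => β (h.bot i i.2) := by
  refine List.ext_getElem (by simp [h.length_src]; omega) fun i h₁ h₂ => ?_
  simp [line]
  rfl

theorem line_top {k : ℕ} {s : Slice ι} (h : D.Occurs k s) (β : D.Pt → Λ) :
    ((D.line β (k + 1)).drop s.left.length).take s.piece.cod.length =
      List.ofFn fun i : Fin s.piece.cod.length => β (h.top i i.2) := by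
  refine List.ext_getElem (by simp [h.length_tgt]; omega) fun i h₁ h₂ => ?_
  simp [line]
  rfl

theorem sliceRule_line_iff {E : Type*} {acr : List (Strand ι) → E → List Λ → E}
    {rule : E → Piece ι → List Λ → List Λ → Prop} {A : E} {k : ℕ} {s : Slice ι}
    (h : D.Occurs k s) (β : D.Pt → Λ) :
    SliceRule acr rule A s (D.line β k) (D.line β (k + 1)) ↔
      (∀ i (hi : i < s.left.length), β (h.leftBot i hi) = β (h.leftTop i hi)) ∧
      (∀ i (hi : i < s.right.length), β (h.rightBot i hi) = β (h.rightTop i hi)) ∧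
      rule (acr s.left A ((D.line β k).take s.left.length)) s.piece
        (List.ofFn fun i : Fin s.piece.dom.length => β (h.bot i i.2))
        (List.ofFn fun i : Fin s.piece.cod.length => β (h.top i i.2)) := by
  rw [sliceRule_iff (by rw [length_line, h.level_eq]) (by rw [length_line, D.tgt_eq k s h])]
  rw [line_bot h, line_top h]
  refine and_congr (forall₂_congr fun i hi => ?_) (and_congr_left' (forall₂_congr fun i hi => ?_))
  · have h₁ := getElem?_line β (h.leftBot i hi)
    have h₂ := getElem?_line β (h.leftTop i hi)
    simp only [Occurs.leftBot, Occurs.leftTop] at h₁ h₂ ⊢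
    rw [h₁, h₂, Option.some_inj]
  · have h₁ := getElem?_line β (h.rightBot i hi)
    have h₂ := getElem?_line β (h.rightTop i hi)
    simp only [Occurs.rightBot, Occurs.rightTop] at h₁ h₂ ⊢
    rw [h₁, h₂, Option.some_inj]

end Diagram

end Lines

/-! ### Homomorphisms as values on beads -/

section Beads

variable {ι : Type} {X : Type u} [TwistedVirtualBirack X] {S : Type v} [TwistedShadow X S]
  {G : Type w} [AddCommGroup G] [Module (ShadowAlgebra X S) G] {D : Diagram ι}

/-- The value of a homomorphism at the bead on a semiarc. -/
noncomputable def beadVal {f : Labeling X S D} (h : BeadModule G f) (e : D.Semiarc) : G :=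
  h (Submodule.Quotient.mk (Finsupp.single e 1))

/-- The relations between the values of a homomorphism at the beads. -/
def IsBeading (f : Labeling X S D) (β : D.Semiarc → G) : Prop :=
  (∀ c : D.Crossing, TypeRule c.type (f.region c.base) (f.arc c.inLArc, β c.inLArc)
    (f.arc c.inRArc, β c.inRArc) (f.arc c.outLArc, β c.outLArc) (f.arc c.outRArc, β c.outRArc)) ∧
  ∀ b : D.Bar, (f.arc b.outArc, β b.outArc) = tau (f.region b.base) (f.arc b.inArc, β b.inArc)

theorem beadVal_injective {f : Labeling X S D} {h h' : BeadModule G f}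
    (e : beadVal h = beadVal h') : h = h' := by
  refine Submodule.linearMap_qext _ (Finsupp.lhom_ext' fun i => LinearMap.ext_ring ?_)
  exact congrFun e i

/-- Every relator is a bead minus a multiple of another, so its vanishing is one equation of values.
These are the bead parts of the crossing and bar rules; their label parts hold since `f` is a
labeling. -/
theorem isBeading_iff {f : Labeling X S D} {β : D.Semiarc → G} :
    IsBeading f β ↔ ∀ m, BeadRelator f m → Finsupp.linearCombination (ShadowAlgebra X S) β m = 0 := by
  constructor
  · rintro ⟨hc, hb⟩ m (⟨c, h⟩ | ⟨c, h⟩ | ⟨c, h⟩ | ⟨c, h⟩ | ⟨c, h⟩ | ⟨c, h⟩ | b)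
    all_goals
      rw [map_sub, Finsupp.linearCombination_single, Finsupp.linearCombination_single, one_smul,
        sub_eq_zero]
    case bar_q => exact (Prod.ext_iff.1 (hb b)).2
    all_goals
      have h' := hc c
      rw [h] at h'
    · exact h'.2.1
    · exact h'.2.2
    · exact h'.2.1
    · exact h'.2.2
    · exact h'.2.1
    · exact h'.2.2
  · intro h
    have key : ∀ {m : D.Semiarc →₀ ShadowAlgebra X S} {e e' : D.Semiarc} {a : ShadowAlgebra X S},
        BeadRelator f m → m = Finsupp.single e 1 - Finsupp.single e' a → β e = a • β e' := by
      rintro _ e e' a hm rfl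
      have := h _ hm
      rwa [map_sub, Finsupp.linearCombination_single, Finsupp.linearCombination_single, one_smul,
        sub_eq_zero] at this
    refine ⟨fun c => ?_, fun b => ?_⟩
    · have hf := f.crossing c
      cases hτ : c.type <;> rw [hτ] at hf
      · exact ⟨hf, key (.pos_t c hτ) rfl, key (.pos_r c hτ) rfl⟩
      · exact ⟨hf, key (.neg_t c hτ) rfl, key (.neg_r c hτ) rfl⟩
      · exact ⟨hf, key (.virt_v c hτ) rfl, key (.virt_vInv c hτ) rfl⟩
    · exact Prod.ext (f.bar b) (key (.bar_q b) rfl)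

theorem isBeading_beadVal {f : Labeling X S D} (h : BeadModule G f) : IsBeading f (beadVal h) := by
  refine isBeading_iff.2 fun m hm => ?_
  have : Finsupp.linearCombination (ShadowAlgebra X S) (beadVal h) =
      h ∘ₗ Submodule.mkQ _ := by
    refine Finsupp.lhom_ext' fun i => LinearMap.ext_ring ?_
    simp [beadVal]
  rw [this, LinearMap.comp_apply, Submodule.mkQ_apply,
    (Submodule.Quotient.mk_eq_zero _).2 (Submodule.subset_span hm), map_zero]

theorem IsBeading.exists_hom {f : Labeling X S D} {β : D.Semiarc → G} (h : IsBeading f β) :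
    ∃ g : BeadModule G f, beadVal g = β := by
  refine ⟨Submodule.liftQ _ (Finsupp.linearCombination (ShadowAlgebra X S) β) ?_, ?_⟩
  · rw [Submodule.span_le]
    exact fun m hm => isBeading_iff.1 h m hm
  · funext e
    simp [beadVal]

end Beads

/-! ### Rules for crossings and regions versus rules for lines -/

section Bridge

open TwistedShadow (act)

variable {ι : Type} {X : Type u} [TwistedVirtualBirack X] {S : Type v} [TwistedShadow X S]
  {G : Type w} [AddCommGroup G] [Module (ShadowAlgebra X S) G] {D : Diagram ι}

namespace Diagram

theorem strand_eq (p : D.Pt) : (level D.word p.1.1)[p.1.2]? = some (D.strand p) :=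
  List.getElem?_eq_getElem p.2

theorem strand_bot {k : ℕ} {s : Slice ι} (h : D.Occurs k s) (i : ℕ) (hi : i < s.piece.dom.length) :
    D.strand (h.bot i hi) = s.piece.dom[i] := by
  have := strand_eq (h.bot i hi)
  simp only [Occurs.bot] at this
  rw [h.level_eq, Slice.src, List.append_assoc, List.getElem?_append_right (by omega),
    Nat.add_sub_cancel_left, List.getElem?_append_left hi, List.getElem?_eq_getElem hi] at this
  exact (Option.some.inj this).symm

theorem strand_top {k : ℕ} {s : Slice ι} (h : D.Occurs k s) (i : ℕ) (hi : i < s.piece.cod.length) :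
    D.strand (h.top i hi) = s.piece.cod[i] := by
  have := strand_eq (h.top i hi)
  simp only [Occurs.top] at this
  rw [← D.tgt_eq k s h, Slice.tgt, List.append_assoc, List.getElem?_append_right (by omega),
    Nat.add_sub_cancel_left, List.getElem?_append_left hi, List.getElem?_eq_getElem hi] at this
  exact (Option.some.inj this).symm

theorem strand_left {k : ℕ} {s : Slice ι} (h : D.Occurs k s) (i : ℕ) (hi : i < s.left.length) :
    D.strand (h.leftBot i hi) = D.strand (h.leftTop i hi) := by
  have h₁ := strand_eq (h.leftBot i hi)
  have h₂ := strand_eq (h.leftTop i hi)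
  rw [Occurs.leftBot] at h₁
  rw [Occurs.leftTop] at h₂
  rw [h.level_eq, Slice.src, List.append_assoc, List.getElem?_append_left hi] at h₁
  rw [← D.tgt_eq k s h, Slice.tgt, List.append_assoc, List.getElem?_append_left hi] at h₂
  exact Option.some.inj (h₁.symm.trans h₂)

theorem strand_right {k : ℕ} {s : Slice ι} (h : D.Occurs k s) (i : ℕ) (hi : i < s.right.length) :
    D.strand (h.rightBot i hi) = D.strand (h.rightTop i hi) := by
  have h₁ := strand_eq (h.rightBot i hi)
  have h₂ := strand_eq (h.rightTop i hi)
  rw [Occurs.rightBot] at h₁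
  rw [Occurs.rightTop] at h₂
  rw [h.level_eq, Slice.src, List.getElem?_append_right (by simp)] at h₁
  rw [← D.tgt_eq k s h, Slice.tgt, List.getElem?_append_right (by simp)] at h₂
  simp only [List.length_append, Nat.add_sub_cancel_left] at h₁ h₂
  exact Option.some.inj (h₁.symm.trans h₂)

/-- The region in a gap, computed from the leftmost region `A`. -/
noncomputable def gapVal (A : S) (β : D.Pt → X × G) (k j : ℕ) : S :=
  acrossAll ((level D.word k).take j) A ((D.line β k).take j)

/-- The region to the right of a point for a traveler along the oriented strand. -/
noncomputable def rightVal (A : S) (β : D.Pt → X × G) (p : D.Pt) : S :=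
  if (D.strand p).up then gapVal A β p.1.1 (p.1.2 + 1) else gapVal A β p.1.1 p.1.2

theorem gapVal_zero (A : S) (β : D.Pt → X × G) (k : ℕ) : gapVal A β k 0 = A := by
  simp [gapVal]

theorem gapVal_add (A : S) (β : D.Pt → X × G) (k i n : ℕ) :
    gapVal A β k (i + n) = acrossAll (((level D.word k).drop i).take n) (gapVal A β k i)
      (((D.line β k).drop i).take n) := by
  rw [gapVal, List.take_add, List.take_add, acrossAll_append (by simp)]
  rfl

theorem gapVal_succ (A : S) (β : D.Pt → X × G) (p : D.Pt) :
    gapVal A β p.1.1 (p.1.2 + 1) = across (D.strand p).up (gapVal A β p.1.1 p.1.2) (β p) := by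
  have h : p.1.2 < (D.line β p.1.1).length := by simpa using p.2
  rw [gapVal_add, List.drop_eq_getElem_cons p.2, List.drop_eq_getElem_cons h]
  have hβ := getElem?_line β p
  rw [List.getElem?_eq_getElem h] at hβ
  rw [Option.some.inj hβ]
  rfl

theorem rightVal_eq (A : S) (β : D.Pt → X × G) (p : D.Pt) :
    rightVal A β p = rightOf (D.strand p).up (gapVal A β p.1.1 p.1.2) (β p) := by
  rw [rightVal, gapVal_succ]
  cases (D.strand p).up <;> rfl

/-- Walking along a line from left to right, each strand forces the next region. -/
theorem gapVal_unique {A : S} {β : D.Pt → X × G} {g : D.Gap → S}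
    (h₀ : ∀ q : D.Gap, q.1.2 = 0 → g q = A)
    (h₁ : ∀ p : D.Pt, g (D.gapRight p) = across (D.strand p).up (g (D.gapLeft p)) (β p)) (q : D.Gap) :
    g q = gapVal A β q.1.1 q.1.2 := by
  obtain ⟨⟨k, j⟩, hk, hj⟩ := q
  induction j with
  | zero => exact (h₀ _ rfl).trans (gapVal_zero A β k).symm
  | succ j ih =>
    have := h₁ ⟨(k, j), hj⟩
    refine this.trans (Eq.trans (congrArg (across _ · _) ?_) (gapVal_succ A β ⟨(k, j), hj⟩).symm)
    exact ih hk (Nat.le_of_succ_le hj)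

theorem gapVal_piece {A : S} {β : D.Pt → X × G} {k : ℕ} {s : Slice ι} (h : D.Occurs k s) :
    gapVal A β k (s.left.length + s.piece.dom.length) = acrossAll s.piece.dom
      (gapVal A β k s.left.length) (List.ofFn fun i : Fin s.piece.dom.length => β (h.bot i i.2)) := by
  rw [gapVal_add, line_bot h, h.level_eq]
  simp [Slice.src]

theorem gapVal_piece' {A : S} {β : D.Pt → X × G} {k : ℕ} {s : Slice ι} (h : D.Occurs k s) :
    gapVal A β (k + 1) (s.left.length + s.piece.cod.length) = acrossAll s.piece.cod
      (gapVal A β (k + 1) s.left.length)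
        (List.ofFn fun i : Fin s.piece.cod.length => β (h.top i i.2)) := by
  rw [gapVal_add, line_top h, ← D.tgt_eq k s h]
  simp [Slice.tgt]

/-- The rules for a coloring that refer to crossings, twist bars, arcs and regions. -/
structure IsColoring (A : S) (β : D.Pt → X × G) : Prop where
  arc : ∀ p q, D.ArcRel p q → β p = β q
  region : ∀ p q, D.RegionRel p q → gapVal A β p.1.1 p.1.2 = gapVal A β q.1.1 q.1.2
  crossing : ∀ c : D.Crossing,
    TypeRule c.type (rightVal A β c.inR) (β c.inL) (β c.inR) (β c.outL) (β c.outR)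
  bar : ∀ b : D.Bar, β b.after = tau (rightVal A β b.before) (β b.before)

/-- The region to the right of both strands lies on the left of the crossing, above, below or on the
right, in the order of the four cases. Once it is expressed by the leftmost region, both rules are
the same. -/
theorem turnedRule_iff {A : S} {β : D.Pt → X × G} (c : D.Crossing)
    (hL : gapVal A β c.k c.l.length = gapVal A β (c.k + 1) c.l.length) :
    TurnedRule (c.kind.type c.a.up c.b.up) c.a.up c.b.up (gapVal A β c.k c.l.length) (β c.botLeft)
      (β c.botRight) (β c.topLeft) (β c.topRight) ↔
    TypeRule c.type (rightVal A β c.inR) (β c.inL) (β c.inR) (β c.outL) (β c.outR) := by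
  obtain ⟨k, l, kind, ⟨oa, ca⟩, ⟨ob, cb⟩, r, h⟩ := c
  have h₀ : gapVal A β k (l.length + 1) = across oa (gapVal A β k l.length) (β (h.bot 0 (by simp [Piece.dom]))) := by
    have := gapVal_succ A β (h.bot 0 (by simp [Piece.dom]))
    rwa [strand_bot] at this
  have h₀' : gapVal A β (k + 1) (l.length + 1) =
      across ob (gapVal A β (k + 1) l.length) (β (h.top 0 (by simp [Piece.cod]))) := by
    have := gapVal_succ A β (h.top 0 (by simp [Piece.cod]))
    rwa [strand_top] at this
  have h₁ : rightVal A β (h.bot 0 (by simp [Piece.dom])) = rightOf oa (gapVal A β k l.length) (β (h.bot 0 (by simp [Piece.dom]))) := by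
    rw [rightVal_eq, strand_bot]
    rfl
  have h₂ : rightVal A β (h.bot 1 (by simp [Piece.dom])) =
      rightOf ob (gapVal A β k (l.length + 1)) (β (h.bot 1 (by simp [Piece.dom]))) := by
    rw [rightVal_eq, strand_bot]
    rfl
  have h₁' : rightVal A β (h.top 0 (by simp [Piece.cod])) =
      rightOf ob (gapVal A β (k + 1) l.length) (β (h.top 0 (by simp [Piece.cod]))) := by
    rw [rightVal_eq, strand_top]
    rfl
  have h₂' : rightVal A β (h.top 1 (by simp [Piece.cod])) =
      rightOf oa (gapVal A β (k + 1) (l.length + 1)) (β (h.top 1 (by simp [Piece.cod]))) := by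
    rw [rightVal_eq, strand_top]
    rfl
  dsimp only at hL
  cases oa <;> cases ob
  · change TypeRule _ (gapVal A β k l.length) _ _ _ _ ↔
      TypeRule _ (rightVal A β (h.top 0 (by simp [Piece.cod]))) _ _ _ _
    rw [h₁', ← hL]
    rfl
  · change TypeRule _ (across true (gapVal A β k l.length) _) _ _ _ _ ↔
      TypeRule _ (rightVal A β (h.top 1 (by simp [Piece.cod]))) _ _ _ _
    rw [h₂', h₀', ← hL]
    rfl
  · change TypeRule _ (across true (gapVal A β k l.length) _) _ _ _ _ ↔
      TypeRule _ (rightVal A β (h.bot 0 (by simp [Piece.dom]))) _ _ _ _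
    rw [h₁]
    rfl
  · change TypeRule _ (across true (across true (gapVal A β k l.length) _) _) _ _ _ _ ↔
      TypeRule _ (rightVal A β (h.bot 1 (by simp [Piece.dom]))) _ _ _ _
    rw [h₂, h₀]
    rfl

/-- On a downward strand the bar is read against the drawing, which makes no difference because
`tau` is an involution. -/
theorem barMap_iff {A : S} {β : D.Pt → X × G} (b : D.Bar)
    (hL : gapVal A β b.k b.l.length = gapVal A β (b.k + 1) b.l.length) :
    β b.top = barMap b.a.up (gapVal A β b.k b.l.length) (β b.bot) ↔
    β b.after = tau (rightVal A β b.before) (β b.before) := by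
  obtain ⟨k, l, ⟨o, i⟩, r, h⟩ := b
  cases o
  · change β (h.top 0 (by simp [Piece.cod])) = tau (gapVal A β k l.length) (β (h.bot 0 (by simp [Piece.dom]))) ↔
      β (h.bot 0 (by simp [Piece.dom])) = tau (rightVal A β (h.top 0 (by simp [Piece.cod]))) (β (h.top 0 (by simp [Piece.cod])))
    rw [rightVal_eq, strand_top]
    change _ ↔ β (h.bot 0 (by simp [Piece.dom])) = tau (gapVal A β (k + 1) l.length) (β (h.top 0 (by simp [Piece.cod])))
    rw [show gapVal A β (k + 1) l.length = gapVal A β k l.length from hL.symm]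
    constructor
    · intro e
      rw [e, tau_tau]
    · intro e
      rw [e, tau_tau]
  · change β (h.top 0 (by simp [Piece.cod])) = _ ↔ β (h.top 0 (by simp [Piece.cod])) = tau (rightVal A β (h.bot 0 (by simp [Piece.dom]))) (β (h.bot 0 (by simp [Piece.dom])))
    rw [rightVal_eq, strand_bot]
    rfl

/-- Lines only know the leftmost region. That the computed regions fit together across a slice is
not a further condition: it follows from the rule of the piece and the equal labels on vertical
strands. -/
theorem isColoring_iff {A : S} {β : D.Pt → X × G} :
    IsColoring A β ↔ ∀ k s, D.word[k]? = some s → LineRule A s (D.line β k) (D.line β (k + 1)) := by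
  have hL : ∀ {k : ℕ} {s : Slice ι} (h : D.Occurs k s), acrossAll s.left A
      ((D.line β k).take s.left.length) = gapVal A β k s.left.length := by
    intro k s h
    rw [gapVal, h.level_eq]
    simp [Slice.src]
  constructor
  · rintro ⟨ha, hr, hc, hb⟩ k s h
    have h : D.Occurs k s := h
    rw [LineRule, sliceRule_line_iff h]
    refine ⟨fun i hi => ha _ _ (.left h i hi), fun i hi => ha _ _ (.right h i hi), ?_⟩
    rw [hL h]
    have hl := hr _ _ (.left h s.left.length le_rfl)
    have hr := hr _ _ (.right h 0 (Nat.zero_le _))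
    obtain ⟨l, P, r⟩ := s
    cases P with
    | cup a => exact ⟨rfl, β (h.top 0 (by simp [Piece.cod])),
        congrArg (fun p => [_, p]) (ha _ _ (.cup h)).symm⟩
    | cap a => exact ⟨rfl, β (h.bot 0 (by simp [Piece.dom])),
        congrArg (fun p => [_, p]) (ha _ _ (.cap h)).symm⟩
    | cross κ a b =>
      refine ⟨_, _, _, _, rfl, rfl, ?_, (turnedRule_iff ⟨k, l, κ, a, b, r, h⟩ hl).2 (hc _)⟩
      have e := (gapVal_piece (A := A) (β := β) h).symm.trans (hr.trans (gapVal_piece' h))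
      have hl : gapVal A β k l.length = gapVal A β (k + 1) l.length := hl
      rw [← hl] at e
      exact e
    | bar a =>
      exact ⟨_, rfl, congrArg (fun p => [p]) ((barMap_iff ⟨k, l, a, r, h⟩ hl).2 (hb _))⟩
  · intro H
    have H' := fun {k s} (h : D.Occurs k s) => (sliceRule_line_iff h β).1 (H k s h)
    have harc : ∀ p q, D.ArcRel p q → β p = β q := by
      intro p q h
      cases h with
      | left h i hi => exact (H' h).1 i hi
      | right h i hi => exact (H' h).2.1 i hi
      | cup h =>
        obtain ⟨-, p, hp⟩ := (H' h).2.2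
        have hp : [β (h.top 0 (by simp [Piece.cod])), β (h.top 1 (by simp [Piece.cod]))] = [p, p] := hp
        simp only [List.cons.injEq, and_true] at hp
        exact hp.1.trans hp.2.symm
      | cap h =>
        obtain ⟨-, p, hp⟩ := (H' h).2.2
        have hp : [β (h.bot 0 (by simp [Piece.dom])), β (h.bot 1 (by simp [Piece.dom]))] = [p, p] := hp
        simp only [List.cons.injEq, and_true] at hp
        exact hp.1.trans hp.2.symm
    have hleft : ∀ {k s} (h : D.Occurs k s) (i : ℕ) (hi : i ≤ s.left.length),
        gapVal A β k i = gapVal A β (k + 1) i := by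
      intro k s h i hi
      induction i with
      | zero => rw [gapVal_zero, gapVal_zero]
      | succ i ih =>
        have h₁ := gapVal_succ A β (h.leftBot i hi)
        have h₂ := gapVal_succ A β (h.leftTop i hi)
        rw [← strand_left, ← harc _ _ (.left h i hi)] at h₂
        simp only [Occurs.leftBot, Occurs.leftTop] at h₁ h₂
        rw [h₁, h₂, ih (by omega)]
    have hregion : ∀ p q, D.RegionRel p q → gapVal A β p.1.1 p.1.2 = gapVal A β q.1.1 q.1.2 := by
      intro p q h
      cases h with
      | left h i hi => exact hleft h i hi
      | @right k s h i hi =>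
        simp only [Occurs.gapRightBot, Occurs.gapRightTop]
        induction i with
        | zero =>
          simp only [Nat.add_zero]
          -- Directly to the right of the piece, the regions below and above agree because every
          -- piece respects regions.
          rw [gapVal_piece h, gapVal_piece' h, ← hleft h _ le_rfl,
            ← hL h]
          exact (H' h).2.2.acrossAll_eq
        | succ i ih =>
          have h₁ := gapVal_succ A β (h.rightBot i hi)
          have h₂ := gapVal_succ A β (h.rightTop i hi)
          rw [← strand_right, ← harc _ _ (.right h i hi)] at h₂
          simp only [Occurs.rightBot, Occurs.rightTop] at h₁ h₂
          rw [← add_assoc, ← add_assoc, h₁, h₂, ih (by omega)]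
    refine ⟨harc, hregion, fun c => ?_, fun b => ?_⟩
    · refine (turnedRule_iff c (hleft c.occurs _ le_rfl)).1 ?_
      obtain ⟨p, q, p', q', e₁, e₂, h⟩ := (H' c.occurs).2.2
      have e₁ : [β c.botLeft, β c.botRight] = [p, q] := e₁
      have e₂ : [β c.topLeft, β c.topRight] = [p', q'] := e₂
      simp only [List.cons.injEq, and_true] at e₁ e₂
      rw [← e₁.1, ← e₁.2, ← e₂.1, ← e₂.2, hL c.occurs] at h
      exact h.2
    · refine (barMap_iff b (hleft b.occurs _ le_rfl)).1 ?_
      obtain ⟨p, e₁, e₂⟩ := (H' b.occurs).2.2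
      have e₁ : [β b.bot] = [p] := e₁
      have e₂ : [β b.top] = [barMap b.a.up _ p] := e₂
      rw [hL b.occurs] at e₂
      simp only [List.cons.injEq, and_true] at e₁ e₂
      rw [e₂, e₁]

end Diagram

end Bridge

/-! ### From natural bijections of colorings to isomorphisms of modules -/

section Comparison

open TwistedShadow (act)

variable {ι : Type} {X : Type u} [TwistedVirtualBirack X] {S : Type v} [TwistedShadow X S]
  {G : Type w} [AddCommGroup G] [Module (ShadowAlgebra X S) G] {D : Diagram ι}

namespace Labeling

/-- The leftmost region. -/
def leftmost (f : Labeling X S D) : S :=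
  f.region (Quot.mk _ ⟨(0, 0), Nat.zero_le _, Nat.zero_le _⟩)

/-- The labels with beads on the points of a diagram. -/
noncomputable def points (f : Labeling X S D) (h : BeadModule G f) (p : D.Pt) : X × G :=
  (f.arc (Quot.mk _ p), beadVal h (Quot.mk _ p))

/-- The leftmost gaps of all lines are joined from slice to slice and belong to one region. From
there the labels determine the regions of each line. -/
theorem region_eq_gapVal (f : Labeling X S D) (h : BeadModule G f) (q : D.Gap) :
    f.region (Quot.mk _ q) = Diagram.gapVal f.leftmost (f.points h) q.1.1 q.1.2 := by
  refine Diagram.gapVal_unique (g := fun q => f.region (Quot.mk _ q)) ?_ ?_ q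
  · rintro ⟨⟨k, j⟩, hk, hj⟩ rfl
    induction k with
    | zero => rfl
    | succ k ih =>
      refine Eq.trans ?_ (ih (Nat.le_of_succ_le hk) (Nat.zero_le _))
      have ho : D.Occurs k D.word[k] := List.getElem?_eq_getElem hk
      exact (congrArg f.region (Quot.sound (.left ho 0 (Nat.zero_le _)))).symm
  · intro p
    have hp := f.region_eq p
    rw [Diagram.leftRegion, Diagram.rightRegion] at hp
    cases ho : (D.strand p).up
    · rw [ho] at hp
      exact hp
    · rw [ho] at hp
      have hp' : f.region (Quot.mk _ (D.gapLeft p)) =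
        act (f.region (Quot.mk _ (D.gapRight p))) (f.arc (Quot.mk _ p)) := hp
      exact (actInv_act _ _).symm.trans (congrArg (actInv · (f.arc (Quot.mk _ p))) hp'.symm)

theorem region_rightRegion (f : Labeling X S D) (h : BeadModule G f) (p : D.Pt) :
    f.region (Diagram.rightRegion p) = Diagram.rightVal f.leftmost (f.points h) p := by
  rw [Diagram.rightRegion, Diagram.rightVal]
  split_ifs
  · exact f.region_eq_gapVal h (D.gapRight p)
  · exact f.region_eq_gapVal h (D.gapLeft p)

theorem isColoring_points (f : Labeling X S D) (h : BeadModule G f) :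
    Diagram.IsColoring f.leftmost (f.points h) := by
  have hb := isBeading_beadVal h
  refine ⟨fun p q e => ?_, fun p q e => ?_, fun c => ?_, fun b => ?_⟩
  · rw [points, points, Quot.sound e]
  · rw [← f.region_eq_gapVal h, ← f.region_eq_gapVal h, Quot.sound e]
  · rw [← f.region_rightRegion h]
    exact hb.1 c
  · rw [← f.region_rightRegion h]
    exact hb.2 b

/-- The first components, with the computed regions, form a labeling; the second components satisfy
its bead relations and hence extend to a homomorphism. -/
theorem exists_of_isColoring {A : S} {β : D.Pt → X × G} (h : Diagram.IsColoring A β) :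
    ∃ (f : Labeling X S D) (g : BeadModule G f), f.leftmost = A ∧ f.points g = β := by
  have hr : ∀ p : D.Pt, Quot.lift (fun q : D.Gap => Diagram.gapVal A β q.1.1 q.1.2) h.region
      (Diagram.rightRegion p) = Diagram.rightVal A β p := by
    intro p
    rw [Diagram.rightRegion, Diagram.rightVal]
    split_ifs <;> rfl
  let f : Labeling X S D :=
    { arc := Quot.lift (fun p => (β p).1) fun p q e => congrArg Prod.fst (h.arc p q e)
      region := Quot.lift (fun q : D.Gap => Diagram.gapVal A β q.1.1 q.1.2) h.region
      region_eq := by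
        intro p
        have e := Diagram.gapVal_succ A β p
        rw [hr, Diagram.leftRegion, Diagram.rightVal]
        cases ho : (D.strand p).up <;> rw [ho] at e
        · exact e
        · rw [if_pos rfl, e]
          exact (act_actInv _ _).symm
      crossing := by
        intro c
        have hc := h.crossing c
        cases hτ : c.type <;> rw [hτ] at hc <;> exact hc.1
      bar := fun b => congrArg Prod.fst (h.bar b) }
  have hf : IsBeading f
      (Quot.lift (fun p => (β p).2) fun p q e => congrArg Prod.snd (h.arc p q e)) := by
    refine ⟨fun c => ?_, fun b => ?_⟩
    · have hc := h.crossing c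
      rw [← hr] at hc
      exact hc
    · have hb := h.bar b
      rw [← hr] at hb
      exact hb
  obtain ⟨g, hg⟩ := hf.exists_hom
  refine ⟨f, g, Diagram.gapVal_zero A β 0, funext fun p => ?_⟩
  rw [points, hg]

/-- The coloring of the lines of a diagram by a labeling with beads. -/
noncomputable def toCol (f : Labeling X S D) (h : BeadModule G f) : Col X S G (dotted D.word 0) :=
  ⟨(f.leftmost, (List.range D.word.length).map fun k => D.line (f.points h) (k + 1)), by
    rw [isPath_dotted_zero (d := 0) fun _ _ => rfl]
    have := isPath_states.2 (Diagram.isColoring_iff.1 (f.isColoring_points h))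
    rwa [List.eq_nil_of_length_eq_zero (l := D.line (f.points h) 0)
        (by rw [Diagram.length_line, D.level_zero]; rfl),
      List.eq_nil_of_length_eq_zero (l := D.line (f.points h) D.word.length)
        (by rw [Diagram.length_line, level, List.getElem?_eq_none le_rfl]; rfl)] at this⟩

theorem toCol_injective {f f' : Labeling X S D} {h : BeadModule G f} {h' : BeadModule G f'}
    (e : f.toCol h = f'.toCol h') :
    (⟨f, h⟩ : Σ f : Labeling X S D, BeadModule G f) = ⟨f', h'⟩ := by
  obtain ⟨e₁, e₂⟩ := Prod.ext_iff.1 (Subtype.ext_iff.1 e)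
  have e₁ : f.leftmost = f'.leftmost := e₁
  have hp : f.points h = f'.points h' := by
    refine Diagram.line_injective fun k => ?_
    cases k with
    | zero =>
      rw [List.eq_nil_of_length_eq_zero (l := D.line (f.points h) 0)
        (by rw [Diagram.length_line, D.level_zero]; rfl), List.eq_nil_of_length_eq_zero
        (l := D.line (f'.points h') 0) (by rw [Diagram.length_line, D.level_zero]; rfl)]
    | succ k =>
      by_cases hk : k < D.word.length
      · exact List.map_inj_left.1 e₂ k (List.mem_range.2 hk)
      · have h0 : (level D.word (k + 1)).length = 0 := by
          rw [level, List.getElem?_eq_none (by omega)]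
          rfl
        rw [List.eq_nil_of_length_eq_zero (l := D.line (f.points h) (k + 1))
          (by rw [Diagram.length_line, h0]), List.eq_nil_of_length_eq_zero
          (l := D.line (f'.points h') (k + 1)) (by rw [Diagram.length_line, h0])]
  obtain rfl : f = f' := by
    refine Labeling.ext (funext fun a => ?_) (funext fun a => ?_)
    · obtain ⟨p, rfl⟩ := Quot.exists_rep a
      exact congrArg Prod.fst (congrFun hp p)
    · obtain ⟨q, rfl⟩ := Quot.exists_rep a
      rw [f.region_eq_gapVal h, f'.region_eq_gapVal h', hp, e₁]
  obtain rfl : h = h' := beadVal_injective <| funext fun a => by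
    obtain ⟨p, rfl⟩ := Quot.exists_rep a
    exact congrArg Prod.snd (congrFun hp p)
  rfl

theorem toCol_surjective (c : Col X S G (dotted D.word 0)) :
    ∃ (f : Labeling X S D) (h : BeadModule G f), f.toCol h = c := by
  obtain ⟨⟨A, ys⟩, hc⟩ := c
  dsimp only at hc
  rw [isPath_dotted_zero (d := 0) fun _ _ => rfl] at hc
  obtain ⟨st, h₀, h₁, rfl⟩ := hc.exists_states
  have hst := isPath_states (R := LineRule A) (W := D.word) (st := st) |>.1 (by rwa [h₀, h₁])
  have hlen : ∀ k ≤ D.word.length, (st k).length = (level D.word k).length := by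
    intro k hk
    rcases hk.lt_or_eq with hk | rfl
    · have ho := List.getElem?_eq_getElem hk
      rw [(hst k _ ho).length_src, level, ho]
    · rw [h₁, level, List.getElem?_eq_none le_rfl]
      rfl
  -- Beyond the last line the states are arbitrary; they are replaced by the empty line.
  obtain ⟨β, hβ⟩ := Diagram.exists_line (D := D)
    (st := fun k => if k ≤ D.word.length then st k else []) fun k => by
      split_ifs with hk
      · exact hlen k hk
      · rw [level, List.getElem?_eq_none (by omega)]
        rfl
  have hcol : Diagram.IsColoring A β := Diagram.isColoring_iff.2 fun k s hs => by
    have hk := (List.getElem?_eq_some_iff.1 hs).1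
    rw [hβ, hβ, if_pos hk.le, if_pos (Nat.succ_le_of_lt hk)]
    exact hst k s hs
  obtain ⟨f, g, rfl, hg⟩ := exists_of_isColoring hcol
  refine ⟨f, g, Subtype.ext (Prod.ext rfl (List.map_congr_left fun k hk => ?_))⟩
  rw [hg, hβ, if_pos (Nat.succ_le_of_lt (List.mem_range.1 hk))]

theorem toCol_map {H : Type w} [AddCommGroup H] [Module (ShadowAlgebra X S) H]
    (φ : G →ₗ[ShadowAlgebra X S] H) (f : Labeling X S D) (h : BeadModule G f) :
    (f.toCol h).map φ = f.toCol (φ ∘ₗ h) := by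
  refine Subtype.ext (Prod.ext rfl ?_)
  simp only [toCol, Col.map, List.map_map]
  refine List.map_congr_left fun k _ => ?_
  rw [Function.comp_apply, Diagram.map_line]
  rfl

end Labeling

/-- An argument in the style of Yoneda. Naturality under the zero map shows that the labeling of an
image does not depend on the beads, which gives a bijection of the labelings. For corresponding
labelings, the map of beads is additive by naturality under the projections and their sum `G × G →
G`, and linear over `End G` by naturality under endomorphisms. -/
theorem Sim.exists_equiv {D' : Diagram ι}
    (h : Sim.{u, v, w} X S (dotted D.word 0) (dotted D'.word 0)) (G : Type w) [AddCommGroup G]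
    [Module (ShadowAlgebra X S) G] :
    ∃ E : Labeling X S D ≃ Labeling X S D', ∀ f,
      Nonempty (BeadModule G f ≃ₗ[EndRing (X := X) (S := S) G] BeadModule G (E f)) := by
  obtain ⟨e, he⟩ := h
  have tot : ∀ (H : Type w) [AddCommGroup H] [Module (ShadowAlgebra X S) H] (f : Labeling X S D)
      (h : BeadModule H f), ∃ (f' : Labeling X S D') (h' : BeadModule H f'),
        e H (f.toCol h) = f'.toCol h' := fun H _ _ f h =>
    let ⟨f', h', eq⟩ := Labeling.toCol_surjective (e H (f.toCol h))
    ⟨f', h', eq.symm⟩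
  have nat : ∀ {H K : Type w} [AddCommGroup H] [Module (ShadowAlgebra X S) H]
      [AddCommGroup K] [Module (ShadowAlgebra X S) K] (φ : H →ₗ[ShadowAlgebra X S] K)
      {f : Labeling X S D} {f' : Labeling X S D'} {h : BeadModule H f} {h' : BeadModule H f'},
      e H (f.toCol h) = f'.toCol h' →
        e K (f.toCol (φ ∘ₗ h)) = f'.toCol (φ ∘ₗ h') := by
    intro H K _ _ _ _ φ f f' h h' eq
    rw [← Labeling.toCol_map, ← Labeling.toCol_map, he, eq]
  -- `E f` is read off from the image of `f` with all beads zero; the zero map shows that the beads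
  -- `z f` of this image may be replaced by zero.
  choose E z hz using fun f : Labeling X S D => tot G f 0
  have hE : ∀ f, e G (f.toCol 0) = (E f).toCol 0 := by
    intro f
    have := nat (0 : G →ₗ[ShadowAlgebra X S] G) (hz f)
    rwa [LinearMap.zero_comp, LinearMap.zero_comp] at this
  have E_eq : ∀ {f : Labeling X S D} {f' : Labeling X S D'} {h : BeadModule G f}
      {h' : BeadModule G f'}, e G (f.toCol h) = f'.toCol h' → E f = f' := by
    intro f f' h h' eq
    have := nat (0 : G →ₗ[ShadowAlgebra X S] G) eq
    rw [LinearMap.zero_comp, LinearMap.zero_comp, hE] at this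
    exact congrArg Sigma.fst (Labeling.toCol_injective this)
  have bij : Function.Bijective E := by
    constructor
    · intro f f' eq
      have h₁ := hE f
      rw [eq, ← hE f'] at h₁
      exact congrArg Sigma.fst (Labeling.toCol_injective ((e G).injective h₁))
    · intro f'
      obtain ⟨f, h, eq⟩ := Labeling.toCol_surjective ((e G).symm (f'.toCol (0 : BeadModule G f')))
      exact ⟨f, E_eq ((Equiv.eq_symm_apply _).1 eq)⟩
  refine ⟨Equiv.ofBijective E bij, fun f => ?_⟩
  change Nonempty (BeadModule G f ≃ₗ[EndRing (X := X) (S := S) G] BeadModule G (E f))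
  have ex : ∀ h : BeadModule G f, ∃ h' : BeadModule G (E f), e G (f.toCol h) = (E f).toCol h' := by
    intro h
    obtain ⟨f', h', eq⟩ := tot G f h
    obtain rfl := E_eq eq
    exact ⟨h', eq⟩
  choose M hM using ex
  have M_eq : ∀ {h : BeadModule G f} {h' : BeadModule G (E f)}, e G (f.toCol h) = (E f).toCol h' →
      M h = h' := by
    intro h h' eq
    rw [hM] at eq
    exact eq_of_heq (Sigma.mk.inj (Labeling.toCol_injective eq)).2
  refine ⟨LinearEquiv.ofBijective
    { toFun := M, map_add' := fun h k => ?_, map_smul' := fun φ h => ?_ } ⟨fun h k eq => ?_, fun h' => ?_⟩⟩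
  -- Color with beads `(h, k)` in `G × G`: the two projections and their sum recover the images of
  -- `h`, `k` and `h + k` from a single coloring.
  · obtain ⟨f', m, eq⟩ := tot (G × G) f (h.prod k)
    have e₁ := nat (LinearMap.fst _ G G) eq
    have e₂ := nat (LinearMap.snd _ G G) eq
    have e₃ := nat (LinearMap.fst _ G G + LinearMap.snd _ G G) eq
    rw [LinearMap.fst_prod] at e₁
    rw [LinearMap.snd_prod] at e₂
    rw [LinearMap.add_comp, LinearMap.add_comp, LinearMap.fst_prod, LinearMap.snd_prod] at e₃
    obtain rfl := E_eq e₁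
    rw [M_eq e₁, M_eq e₂, M_eq e₃]
  · exact M_eq (nat φ (hM h))
  · have eq : M h = M k := eq
    have h₁ := hM h
    rw [eq, ← hM k] at h₁
    exact eq_of_heq (Sigma.mk.inj (Labeling.toCol_injective ((e G).injective h₁))).2
  · obtain ⟨f₁, h, eq⟩ := Labeling.toCol_surjective ((e G).symm ((E f).toCol h'))
    have eq := (Equiv.eq_symm_apply _).1 eq
    obtain rfl := bij.1 (E_eq eq)
    exact ⟨h, M_eq eq⟩

end Comparison

/-! ### Connectedness of components after inserting a kink -/

section Components

variable {ι : Type} {Λ : Type*}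

/-- The relation between the labels at the bottom and the top of a piece if labels are constant
along the components. -/
def ThroughRule (_ : Unit) : Piece ι → List Λ → List Λ → Prop
  | .cup _, x, y => x = [] ∧ ∃ p, y = [p, p]
  | .cap _, x, y => y = [] ∧ ∃ p, x = [p, p]
  | .cross _ _ _, x, y => ∃ p q, x = [p, q] ∧ y = [q, p]
  | .bar _, x, y => ∃ p, x = [p] ∧ y = [p]

/-- The relation between the labels at the bottom and the top of a slice if labels are constant
along the components. -/
def Through : Slice ι → List Λ → List Λ → Prop := SliceRule (fun _ _ _ => ()) ThroughRule ()

theorem through_line_iff {D : Diagram ι} {β : D.Pt → Λ} :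
    (∀ p q, D.CompRel p q → β p = β q) ↔
      ∀ k s, D.word[k]? = some s → Through s (D.line β k) (D.line β (k + 1)) := by
  constructor
  · intro H k s h
    have h : D.Occurs k s := h
    rw [Through, Diagram.sliceRule_line_iff h]
    refine ⟨fun i hi => H _ _ (.arc (.left h i hi)), fun i hi => H _ _ (.arc (.right h i hi)), ?_⟩
    obtain ⟨l, P, r⟩ := s
    cases P with
    | cup a => exact ⟨rfl, β (h.top 0 (by simp [Piece.cod])),
        congrArg (fun p => [_, p]) (H _ _ (.arc (.cup h))).symm⟩
    | cap a => exact ⟨rfl, β (h.bot 0 (by simp [Piece.dom])),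
        congrArg (fun p => [_, p]) (H _ _ (.arc (.cap h))).symm⟩
    | cross κ a b =>
      exact ⟨β (h.bot 0 (by simp [Piece.dom])), β (h.bot 1 (by simp [Piece.dom])), rfl,
        congrArg₂ (fun p q => [p, q]) (H _ _ (.cross_right h)).symm (H _ _ (.cross_left h)).symm⟩
    | bar a => exact ⟨β (h.bot 0 (by simp [Piece.dom])), rfl,
        congrArg (fun p => [p]) (H _ _ (.bar h)).symm⟩
  · intro H p q h
    have H' := fun {k s} (h : D.Occurs k s) => (Diagram.sliceRule_line_iff h β).1 (H k s h)
    rcases h with ⟨h⟩ | h | h | h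
    · cases h with
      | left h i hi => exact (H' h).1 i hi
      | right h i hi => exact (H' h).2.1 i hi
      | cup h =>
        obtain ⟨-, p, hp⟩ := (H' h).2.2
        have hp : [β (h.top 0 (by simp [Piece.cod])), β (h.top 1 (by simp [Piece.cod]))] = [p, p] := hp
        simp only [List.cons.injEq, and_true] at hp
        exact hp.1.trans hp.2.symm
      | cap h =>
        obtain ⟨-, p, hp⟩ := (H' h).2.2
        have hp : [β (h.bot 0 (by simp [Piece.dom])), β (h.bot 1 (by simp [Piece.dom]))] = [p, p] := hp
        simp only [List.cons.injEq, and_true] at hp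
        exact hp.1.trans hp.2.symm
    · obtain ⟨p, e₁, e₂⟩ := (H' h).2.2
      have e₁ : [β (h.bot 0 (by simp [Piece.dom]))] = [p] := e₁
      have e₂ : [β (h.top 0 (by simp [Piece.cod]))] = [p] := e₂
      simp only [List.cons.injEq, and_true] at e₁ e₂
      exact e₁.trans e₂.symm
    all_goals
      obtain ⟨p, q, e₁, e₂⟩ := (H' h).2.2
      have e₁ : [β (h.bot 0 (by simp [Piece.dom])), β (h.bot 1 (by simp [Piece.dom]))] = [p, q] := e₁
      have e₂ : [β (h.top 0 (by simp [Piece.cod])), β (h.top 1 (by simp [Piece.cod]))] = [q, p] := e₂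
      simp only [List.cons.injEq, and_true] at e₁ e₂
    · exact e₁.1.trans e₂.2.symm
    · exact e₁.2.trans e₂.1.symm

/-- Labels that are constant along the components only depend on the names of the components. -/
def Separated (W : List (Slice ι)) : Prop :=
  ∀ ys : List (List Prop), IsPath Through W [] ys [] →
    ∃ g : ι → Prop, ys = W.map fun s => s.tgt.map fun a => g a.comp

theorem Diagram.line_comp {D : Diagram ι} (g : ι → Λ) (k : ℕ) :
    D.line (fun p => g (D.strand p).comp) k = (level D.word k).map fun a => g a.comp := by
  refine List.ext_getElem (by simp) fun i h₁ h₂ => ?_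
  simp [Diagram.line, Diagram.strand]

/-- Connectedness is expressed by labels that are constant along the strands, because these are
paths along the word and are easy to follow when slices are inserted. -/
theorem LinkDiagram.separated (L : LinkDiagram ι) : Separated L.word := by
  intro ys h
  obtain ⟨st, h₀, h₁, rfl⟩ := h.exists_states
  have hst := isPath_states (R := Through) (W := L.word) (st := st) |>.1 (by rwa [h₀, h₁])
  have hlen : ∀ k ≤ L.word.length, (st k).length = (level L.word k).length := by
    intro k hk
    rcases hk.lt_or_eq with hk | rfl
    · have ho := List.getElem?_eq_getElem hk
      obtain ⟨xl, xr, p, q, e, -, hl, hr, h⟩ := hst k _ ho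
      have hp : p.length = (L.word[k]).piece.dom.length := by
        cases hP : (L.word[k]).piece <;> rw [hP] at h <;> simp only [ThroughRule] at h
        · rw [h.1]; rfl
        · obtain ⟨-, _, rfl⟩ := h; rfl
        · obtain ⟨_, _, rfl, -⟩ := h; rfl
        · obtain ⟨_, rfl, -⟩ := h; rfl
      rw [level, ho, e]
      simp [Slice.src, hl, hr, hp]
    · rw [h₁, level, List.getElem?_eq_none le_rfl]
      rfl
  obtain ⟨β, hβ⟩ := Diagram.exists_line (D := L.toDiagram)
    (st := fun k => if k ≤ L.word.length then st k else []) fun k => by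
      split_ifs with hk
      · exact hlen k hk
      · rw [level, List.getElem?_eq_none (by omega)]
        rfl
  have hcomp : ∀ p q, L.toDiagram.CompRel p q → β p = β q := through_line_iff.2 fun k s hs => by
    have hk := (List.getElem?_eq_some_iff.1 hs).1
    rw [hβ, hβ, if_pos hk.le, if_pos (Nat.succ_le_of_lt hk)]
    exact hst k s hs
  have hconn : ∀ p q, Relation.EqvGen L.toDiagram.CompRel p q → β p = β q := by
    intro p q h
    induction h with
    | rel p q h => exact hcomp p q h
    | refl => rfl
    | symm p q _ ih => exact ih.symm
    | trans p q r _ _ ih ih' => exact ih.trans ih'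
  choose P hP using L.surjective
  have hβ' : β = fun p => β (P (L.toDiagram.strand p).comp) :=
    funext fun p => hconn _ _ (L.connected _ _ (hP _).symm)
  refine ⟨fun i => β (P i), List.ext_getElem (by simp) fun k h₁ h₂ => ?_⟩
  simp only [List.length_map, List.length_range] at h₁
  have e := hβ (k + 1)
  rw [if_pos (Nat.succ_le_of_lt h₁), hβ', Diagram.line_comp fun i => β (P i)] at e
  simp only [List.getElem_map, List.getElem_range]
  rw [← e, L.tgt_eq k _ (List.getElem?_eq_getElem h₁)]

theorem Separated.connected {D : Diagram ι} (h : Separated D.word) (p q : D.Pt)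
    (hpq : (D.strand p).comp = (D.strand q).comp) : Relation.EqvGen D.CompRel p q := by
  -- Use the label that tells whether a point is joined to `p`. It is constant along the strands, so
  -- it depends only on the name of the component.
  obtain ⟨g, hg⟩ := h ((List.range D.word.length).map fun k =>
    D.line (Relation.EqvGen D.CompRel p) (k + 1)) (by
      have := isPath_states.2 (through_line_iff.1 fun x y (hxy : D.CompRel x y) =>
        (propext ⟨fun hx => hx.trans _ _ _ (.rel _ _ hxy),
          fun hy => hy.trans _ _ _ (.symm _ _ (.rel _ _ hxy))⟩ :
          Relation.EqvGen D.CompRel p x = Relation.EqvGen D.CompRel p y))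
      rwa [List.eq_nil_of_length_eq_zero (l := D.line (Relation.EqvGen D.CompRel p) 0)
          (by rw [Diagram.length_line, D.level_zero]; rfl),
        List.eq_nil_of_length_eq_zero (l := D.line (Relation.EqvGen D.CompRel p) D.word.length)
          (by rw [Diagram.length_line, level, List.getElem?_eq_none le_rfl]; rfl)] at this)
  have key : ∀ x : D.Pt, Relation.EqvGen D.CompRel p x = g (D.strand x).comp := by
    rintro ⟨⟨k, j⟩, hj⟩
    cases k with
    | zero =>
      rw [D.level_zero] at hj
      exact absurd hj (Nat.not_lt_zero _)
    | succ k =>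
      have hk : k < D.word.length := by
        by_contra hk
        rw [level, List.getElem?_eq_none (by simp only; omega)] at hj
        exact absurd hj (Nat.not_lt_zero _)
      have e := congrArg (fun ys => ys[k]?) hg
      simp only [List.getElem?_map, List.getElem?_range hk, List.getElem?_eq_getElem hk,
        Option.map_some, Option.some_inj] at e
      rw [D.tgt_eq k _ (List.getElem?_eq_getElem hk), ← Diagram.line_comp] at e
      have e' := Diagram.getElem?_line (Relation.EqvGen D.CompRel p) ⟨(k + 1, j), hj⟩
      have e'' := Diagram.getElem?_line (fun x => g (D.strand x).comp) ⟨(k + 1, j), hj⟩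
      dsimp only at e' e''
      rw [e, e''] at e'
      exact (Option.some.inj e').symm
  rw [key, ← hpq, ← key]
  exact .refl p

theorem IsPath.eq_map_of_chain {g : ι → Prop} {ρ τ : List (Strand ι)} {W : List (Slice ι)}
    {x z : List Prop} (hW : Chain ρ W τ) (hx : x = ρ.map fun a => g a.comp)
    (h : IsPath Through W x (W.map fun s => s.tgt.map fun a => g a.comp) z) :
    z = τ.map fun a => g a.comp := by
  induction W generalizing ρ x with
  | nil => rw [← h.2, hx, hW]
  | cons s W ih =>
    obtain ⟨y, ys, e, -, h⟩ := h
    obtain ⟨rfl, rfl⟩ := List.cons.inj e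
    exact ih hW.2 rfl h

/-- A kink on a strand that is directed upward or downward. -/
def kinkWord (k : CrossKind) (a : Strand ι) : List (Slice ι) :=
  [⟨[a], .cup a, []⟩, ⟨[], .cross k a a, [a.rev]⟩, ⟨[a], .cap a, []⟩]

theorem chain_kinkWord (k : CrossKind) (a : Strand ι) : Chain [a] (kinkWord k a) [a] := by
  simp [kinkWord, Chain, Slice.src, Slice.tgt, Piece.dom, Piece.cod, Strand.rev]

theorem isPath_kinkWord {k : CrossKind} {a : Strand ι} {l r : List (Strand ι)} {x z : List Λ}
    {ys : List (List Λ)} (h : IsPath Through ((kinkWord k a).map (Slice.whisker l r)) x ys z) :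
    ∃ xl p xr, xl.length = l.length ∧ x = xl ++ p :: xr ∧ z = x ∧
      ys = [xl ++ p :: p :: p :: xr, xl ++ p :: p :: p :: xr, x] := by
  obtain ⟨y₁, _, rfl, ⟨xl₁, xr₁, _, _, rfl, rfl, hl₁, hr₁, rfl, p, rfl⟩, y₂, _, rfl,
    ⟨xl₂, xr₂, _, _, e₁, rfl, hl₂, hr₂, q₁, q₂, rfl, rfl⟩, y₃, _, rfl,
    ⟨xl₃, xr₃, _, _, e₂, rfl, hl₃, hr₃, rfl, t, rfl⟩, rfl, rfl⟩ := h
  simp only [Slice.whisker, List.length_append, List.length_cons, List.length_nil] at hl₁ hl₂ hl₃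
  obtain ⟨xl, q, rfl⟩ : ∃ xl q, xl₁ = xl ++ [q] :=
    ⟨_, _, (List.dropLast_append_getLast (by rintro rfl; simp at hl₁)).symm⟩
  rw [List.append_assoc] at e₁
  obtain ⟨rfl, f₁⟩ := List.append_inj e₁ (by simp at hl₁; omega)
  simp only [List.cons_append, List.nil_append, List.cons.injEq] at f₁
  obtain ⟨rfl, rfl, rfl⟩ := f₁
  obtain ⟨xl', q', rfl⟩ : ∃ xl q, xl₃ = xl ++ [q] :=
    ⟨_, _, (List.dropLast_append_getLast (by rintro rfl; simp at hl₃)).symm⟩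
  rw [List.append_assoc] at e₂
  obtain ⟨rfl, f₂⟩ := List.append_inj e₂ (by simp at hl₃; omega)
  simp only [List.cons_append, List.nil_append, List.cons.injEq] at f₂
  obtain ⟨rfl, rfl, rfl, rfl⟩ := f₂
  exact ⟨xl, p, xr₁, by omega, by simp, by simp, by simp⟩

/-- A label that is constant along the strands has a single value on the whole kink, and the lines
at its two ends agree. Deleting the kink leaves a path along the old word, and the function of names
found for it also describes the kink. -/
theorem Separated.insert_kink {k : CrossKind} {a : Strand ι} {l r : List (Strand ι)}
    {pre post : List (Slice ι)} (hpre : Chain [] pre (l ++ a :: r))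
    (h : Separated (pre ++ post)) :
    Separated (pre ++ (kinkWord k a).map (Slice.whisker l r) ++ post) := by
  intro ys g
  obtain ⟨_, ys₃, y', rfl, g, g₃⟩ := isPath_append.1 g
  obtain ⟨ys₁, ys₂, y, rfl, g₁, g₂⟩ := isPath_append.1 g
  obtain ⟨xl, p, xr, hl, rfl, rfl, rfl⟩ := isPath_kinkWord g₂
  obtain ⟨f, hf⟩ := h (ys₁ ++ ys₃) (isPath_append.2 ⟨_, _, _, rfl, g₁, g₃⟩)
  rw [List.map_append] at hf
  obtain ⟨rfl, rfl⟩ := List.append_inj hf (by rw [g₁.length_eq, List.length_map])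
  refine ⟨f, ?_⟩
  have e := g₁.eq_map_of_chain hpre rfl
  rw [List.map_append, List.map_cons] at e
  obtain ⟨rfl, e'⟩ := List.append_inj e (by simpa using hl)
  obtain ⟨rfl, rfl⟩ := List.cons.inj e'
  simp [kinkWord, Slice.whisker, Slice.tgt, Piece.cod, Strand.rev]

end Components

/-! ### Diagrams with prescribed writhes -/

section Framing

variable {ι : Type} [DecidableEq ι]

/-- Insert a kink at a point of the component `i`. A self-crossing of kind `leftOver` in `kinkWord`
has two parallel strands, so it is positive for either direction. -/
theorem LinkDiagram.exists_insert_kink (L : LinkDiagram ι) (i : ι) :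
    ∃ L' : LinkDiagram ι, Isotopic L L' ∧
      ∀ j, L'.writhe j = L.writhe j + if i = j then 1 else 0 := by
  obtain ⟨⟨⟨k, j⟩, hj⟩, rfl⟩ := L.surjective i
  have hk : k < L.word.length := by
    by_contra hk
    rw [level, List.getElem?_eq_none (by simp only; omega)] at hj
    exact absurd hj (Nat.not_lt_zero _)
  obtain ⟨pre, post, hW, rfl⟩ : ∃ pre post, L.word = pre ++ post ∧ pre.length = k :=
    ⟨L.word.take k, L.word.drop k, (List.take_append_drop _ _).symm, by simp; omega⟩
  have hch := L.chain
  rw [hW] at hch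
  obtain ⟨ρ, hpre, hpost⟩ := chain_append.1 hch
  have hlev : level L.word pre.length = ρ := by
    rw [hW, ← Nat.add_zero pre.length, level_append_right, hpost.level_zero]
  obtain ⟨l, a, r, rfl, hl⟩ : ∃ l a r, ρ = l ++ a :: r ∧ l.length = j := by
    have hj : j < ρ.length := by rwa [← hlev]
    refine ⟨ρ.take j, ρ[j], ρ.drop (j + 1), ?_, by simp; omega⟩
    rw [← List.drop_eq_getElem_cons hj, List.take_append_drop]
  have ha : (L.toDiagram.strand ⟨(pre.length, j), hj⟩).comp = a.comp := by
    have e := hasComp_pt (D := L.toDiagram) ⟨(pre.length, j), hj⟩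
    rw [HasComp] at e
    simp only [hlev] at e
    rw [List.getElem?_append_right hl.le, hl, Nat.sub_self, List.getElem?_cons_zero] at e
    exact (Option.some.inj e).symm
  rw [ha]
  have hmid := (chain_kinkWord .leftOver a).map_whisker l r
  rw [List.append_assoc] at hmid
  have hch' := chain_append.2 ⟨_, chain_append.2 ⟨_, hpre, hmid⟩, hpost⟩
  refine ⟨⟨hch'.diagram, fun i => ?_, Separated.connected (Separated.insert_kink hpre (hW ▸ L.separated))⟩, ?_, fun i => ?_⟩
  · obtain ⟨p, e⟩ : ∃ p, HasComp L.word p i := by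
      obtain ⟨p, rfl⟩ := L.surjective i
      exact ⟨_, hasComp_pt p⟩
    rw [hW] at e
    suffices h : ∃ q, HasComp (pre ++ (kinkWord .leftOver a).map (Slice.whisker l r) ++ post) q i by
      obtain ⟨q, hq⟩ := h
      obtain ⟨q', -, hq'⟩ := HasComp.exists_pt (D := hch'.diagram) hq
      exact ⟨q', hq'⟩
    by_cases hk : p.1 < pre.length
    · rw [hasComp_append_left hk] at e
      exact ⟨p, by rwa [List.append_assoc, hasComp_append_left hk]⟩
    · rw [hasComp_append_right (not_lt.1 hk)] at e
      -- A kink consists of three slices.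
      refine ⟨(p.1 + 3, p.2), ?_⟩
      rw [hasComp_append_right (by simp [kinkWord]; omega)]
      convert e using 2
      simp [kinkWord]
  · exact .symm _ _ (.rel _ _ ⟨pre, post, l, r, kinkWord .leftOver a, [], .kink_right _ _, rfl,
      by simp [hW]⟩)
  · have hL : L.writhe i = wordWrithe i (pre ++ post) := hW ▸ rfl
    rw [hL]
    change wordWrithe i (pre ++ _ ++ post) = _
    rw [wordWrithe_append, wordWrithe_append, wordWrithe_append, wordWrithe_whisker]
    have e : wordWrithe i (kinkWord .leftOver a) = if a.comp = i then 1 else 0 := by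
      simp [wordWrithe, kinkWord, Slice.writhe, CrossKind.type, CrossType.sign]
    rw [e]
    ring

theorem LinkDiagram.exists_writhe_add (L : LinkDiagram ι) (s : Multiset ι) :
    ∃ L' : LinkDiagram ι, Isotopic L L' ∧ ∀ j, L'.writhe j = L.writhe j + s.count j := by
  induction s using Multiset.induction_on with
  | empty => exact ⟨L, .refl L, by simp⟩
  | cons i s ih =>
    obtain ⟨L₁, h₁, e₁⟩ := ih
    obtain ⟨L₂, h₂, e₂⟩ := L₁.exists_insert_kink i
    refine ⟨L₂, h₁.trans _ _ _ h₂, fun j => ?_⟩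
    rw [e₂, e₁, Multiset.count_cons]
    simp only [eq_comm (a := j)]
    split_ifs <;> push_cast <;> ring

theorem FramingTile.nonempty [Fintype ι] (L : LinkDiagram ι) {N : ℕ} (hN : 0 < N) :
    Nonempty (FramingTile L N) := by
  have : NeZero N := ⟨hN.ne'⟩
  have h : ∀ w : ι → ZMod N, ∃ L' : LinkDiagram ι, Isotopic L L' ∧
      ∀ i, ((L'.writhe i : ℤ) : ZMod N) = w i := by
    intro w
    -- Only positive kinks are added, so the missing writhes are represented by natural numbers
    -- below `N`.
    obtain ⟨L', h, e⟩ := L.exists_writhe_add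
      (∑ i, Multiset.replicate (w i - ((L.writhe i : ℤ) : ZMod N)).val i)
    refine ⟨L', h, fun i => ?_⟩
    rw [e, Multiset.count_sum']
    simp [Multiset.count_replicate]
  choose F h e using h
  exact ⟨⟨F, h, e⟩⟩

end Framing

/-! ### Renumbering the components -/

section Renaming

variable {ι : Type} {X : Type u} [TwistedVirtualBirack X] {S : Type v} [TwistedShadow X S]

section

variable {G : Type w} [AddCommGroup G] [Module (ShadowAlgebra X S) G]

theorem acrossAll_rename (f : ι → ι) (σ : List (Strand ι)) (A : S) (x : List (X × G)) :
    acrossAll (σ.map (Strand.rename f)) A x = acrossAll σ A x := by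
  induction σ generalizing A x with
  | nil => simp
  | cons a σ ih =>
    cases x with
    | nil => rfl
    | cons p x => exact ih _ _

theorem dotLine_rename (f : ι → ι) (σ : List (Strand ι)) (n : ℕ → ℤ) (A : S) (x : List (X × G)) :
    dotLine (σ.map (Strand.rename f)) n A x = dotLine σ n A x := by
  induction σ generalizing n A x with
  | nil => simp
  | cons a σ ih =>
    cases x with
    | nil => rfl
    | cons p x => exact congrArg (_ :: ·) (ih _ _ _)

theorem src_rename (f : ι → ι) (s : Slice ι) : (s.rename f).src = s.src.map (Strand.rename f) := by
  obtain ⟨l, P, r⟩ := s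
  cases P <;> simp [Slice.rename, Piece.rename, Slice.src, Piece.dom, Strand.rename, Strand.rev]

theorem dotRule_rename (f : ι → ι) (n : ℕ → ℤ) (s : Slice ι) (A : S) (x y : List (X × G)) :
    DotRule A (n, s.rename f) x y ↔ DotRule A (n, s) x y := by
  have hP : ∀ (A : S) (p q : List (X × G)),
      PieceRule A (s.piece.rename f) p q ↔ PieceRule A s.piece p q := by
    intro A p q
    cases s.piece <;> rfl
  simp only [DotRule, src_rename, dotLine_rename]
  simp only [LineRule, SliceRule, Slice.rename, acrossAll_rename, List.length_map, hP]

theorem isPath_rename (f : ι → ι) (W : List (Slice ι)) (d : ℕ → ℕ → ℤ) (A : S)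
    (x z : List (X × G)) (ys : List (List (X × G))) :
    IsPath (DotRule A) (dotted (W.map (Slice.rename f)) d) x ys z ↔
      IsPath (DotRule A) (dotted W d) x ys z := by
  induction W generalizing d x ys with
  | nil => rfl
  | cons s W ih => simp only [List.map_cons, dotted, isPath_cons, dotRule_rename, ih]

end

theorem level_rename (f : ι → ι) (W : List (Slice ι)) (k : ℕ) :
    level (W.map (Slice.rename f)) k = (level W k).map (Strand.rename f) := by
  rw [level, level, List.getElem?_map]
  cases W[k]? with
  | none => rfl
  | some s => exact src_rename f s

theorem HasComp.rename {W : List (Slice ι)} {p : ℕ × ℕ} {i : ι} (h : HasComp W p i) (f : ι → ι) :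
    HasComp (W.map (Slice.rename f)) p (f i) := by
  obtain ⟨a, ha, rfl⟩ := Option.map_eq_some_iff.1 h
  rw [HasComp, level_rename, List.getElem?_map, ha]
  rfl

theorem wordWrithe_rename [DecidableEq ι] (σ : Equiv.Perm ι) (i : ι) (W : List (Slice ι)) :
    wordWrithe (σ i) (W.map (Slice.rename σ)) = wordWrithe i W := by
  rw [wordWrithe, wordWrithe, List.map_map]
  congr 1
  refine List.map_congr_left fun s _ => ?_
  obtain ⟨l, P, r⟩ := s
  cases P <;> simp [Slice.writhe, Slice.rename, Piece.rename, Strand.rename]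

/-- `D` without kinks corresponds to `L` with as many kinks as the writhes of `D` exceed those of
`L`. After renaming, these correspond to kinks on `D'` that make up for the difference of the
writhes of `D` and `D'`. This is a multiple of the rank on every component and has no effect. -/
theorem sim_of_twistedVirtuallyIsotopic [Fintype ι] [DecidableEq ι] {L L' D D' M : LinkDiagram ι}
    {σ : Equiv.Perm ι} (hM : M.word = L.word.map (Slice.rename σ)) (h : Isotopic M L')
    (hD : Isotopic L D) (hD' : Isotopic L' D')
    (hw : ∀ i, (birackRank X : ℤ) ∣ D.writhe (σ.symm i) - D'.writhe i) :
    Sim.{u, v, w} X S (dotted D.word 0) (dotted D'.word 0) := by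
  obtain ⟨P, hP⟩ := L.exists_placement
  obtain ⟨Q, hQ⟩ := D.exists_placement
  obtain ⟨Q', hQ'⟩ := D'.exists_placement
  have h₁ := framedSim_of_isotopic.{u, v, w} (X := X) (S := S) hD
    (fun i => D.writhe i - L.writhe i) (fun _ => 0) (fun i => by simp) P Q hP hQ
  have hwM : ∀ i, M.writhe i = L.writhe (σ.symm i) := by
    intro i
    rw [writhe_eq, hM, writhe_eq, ← wordWrithe_rename σ (σ.symm i), Equiv.apply_symm_apply]
  have h₂ := framedSim_of_isotopic.{u, v, w} (X := X) (S := S) (h.trans _ _ _ hD')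
    (fun i => D.writhe (σ.symm i) - L.writhe (σ.symm i))
    (fun i => D.writhe (σ.symm i) - D'.writhe i) (fun i => by rw [hwM]; ring)
    (fun i => P (σ.symm i)) Q' (fun i => by
      have := (hP (σ.symm i)).rename σ
      rwa [← hM, Equiv.apply_symm_apply] at this) hQ'
  -- Renaming changes the names of the components but leaves the kinks at the same points.
  have hplace : place (fun i => P (σ.symm i)) (fun i => D.writhe (σ.symm i) - L.writhe (σ.symm i)) =
      place P fun i => D.writhe i - L.writhe i :=
    Equiv.sum_comp σ.symm fun i => dot (P i) (D.writhe i - L.writhe i)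
  rw [hplace, hM] at h₂
  have h₃ : Sim.{u, v, w} X S (dotted (L.word.map (Slice.rename σ))
      (place P fun i => D.writhe i - L.writhe i))
      (dotted L.word (place P fun i => D.writhe i - L.writhe i)) :=
    Sim.of_iff fun G _ _ A ys => isPath_rename σ L.word _ A [] [] ys
  exact (sim_place_zero (fun _ => dvd_zero _) _ _).symm.trans (h₁.symm.trans
    (h₃.symm.trans (h₂.trans (sim_place_zero hw _ _))))

end Renaming

/-! ### Invariance of the multiset and the polynomial -/

section Invariance

variable {ι : Type} {X : Type u} [TwistedVirtualBirack X] {S : Type v} [TwistedShadow X S]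

theorem beadClass_eq (G : Type w) [AddCommGroup G] [Module (ShadowAlgebra X S) G]
    {D D' : Diagram ι} {f : Labeling X S D} {f' : Labeling X S D'}
    (e : BeadModule G f ≃ₗ[EndRing (X := X) (S := S) G] BeadModule G f') :
    beadClass G f = beadClass G f' :=
  Quotient.sound ⟨e.toModuleIso⟩

theorem exists_labeling_equiv [Fintype ι] [DecidableEq ι] {L L' : LinkDiagram ι}
    (h : TwistedVirtuallyIsotopic L L') (G : Type w) [AddCommGroup G]
    [Module (ShadowAlgebra X S) G] (F : FramingTile L (birackRank X))
    (F' : FramingTile L' (birackRank X)) :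
    ∃ (σ : Equiv.Perm ι) (E : ∀ w : ι → ZMod (birackRank X),
      Labeling X S (F.diagram w).toDiagram ≃ Labeling X S (F'.diagram fun i => w (σ.symm i)).toDiagram),
      ∀ w f, Nonempty (BeadModule G f ≃ₗ[EndRing (X := X) (S := S) G] BeadModule G (E w f)) := by
  obtain ⟨σ, M, hM, h⟩ := h
  have := fun w : ι → ZMod (birackRank X) => Sim.exists_equiv
    (sim_of_twistedVirtuallyIsotopic.{u, v, w} (X := X) (S := S) hM h (F.isotopic w)
      (F'.isotopic fun i => w (σ.symm i)) fun i => by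
        rw [← ZMod.intCast_zmod_eq_zero_iff_dvd, Int.cast_sub, F.writhe_eq, F'.writhe_eq, sub_self]) G
  choose E hE using this
  exact ⟨σ, E, hE⟩

end Invariance

end TwistedVirtual

open TwistedVirtual in
theorem theorem7
    (X : Type u) [TwistedVirtualBirack X] (hX : 0 < birackRank X)
    (S : Type v) [TwistedShadow X S]
    (G : Type w) [AddCommGroup G] [Module (ShadowAlgebra X S) G]
    {c : ℕ} (L L' : LinkDiagram (Fin c)) (hL : TwistedVirtuallyIsotopic L L') :
    Nonempty (FramingTile L (birackRank X)) ∧ Nonempty (FramingTile L' (birackRank X)) ∧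
    ∀ (F : FramingTile L (birackRank X)) (F' : FramingTile L' (birackRank X)),
      moduleMultiset (X := X) (S := S) G F = moduleMultiset (X := X) (S := S) G F' ∧
      (Finite X → Finite S →
        modulePolynomial (X := X) (S := S) G F = modulePolynomial (X := X) (S := S) G F') := by
  refine ⟨FramingTile.nonempty L hX, FramingTile.nonempty L' hX, fun F F' => ?_⟩
  obtain ⟨σ, E, hE⟩ := exists_labeling_equiv (S := S) hL G F F'
  constructor
  · funext M
    -- `σ` permutes the writhe vectors and `E w` matches the labelings. The modules of matched
    -- labelings are isomorphic, so every class has the same multiplicity on both sides.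
    refine Cardinal.mk_congr (Equiv.subtypeEquiv
      (Equiv.sigmaCongr (Equiv.arrowCongr σ (Equiv.refl _)) E) fun f => ?_)
    obtain ⟨w, f⟩ := f
    obtain ⟨e⟩ := hE w f
    rw [beadClass_eq G e]
    rfl
  · intro _ _
    refine Eq.trans (finsum_congr fun w => ?_) (finsum_comp_equiv (Equiv.arrowCongr σ (Equiv.refl _)))
    refine Eq.trans (finsum_congr fun f => ?_) (finsum_comp_equiv (E w))
    obtain ⟨e⟩ := hE w f
    rw [Nat.card_congr e.toEquiv]
    rfl
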